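/- Consider $n$ nodes with positions $X=(X_1,\dots,X_n)$ independent and uniform in the unit square, where edge effects are eliminated by identifying opposite sides of the square (distances $d$ are Euclidean distances modulo $\mathbb Z^2$). Two distinct nodes are neighbours if their distance is less than the transmission range $r=r_n>0$; assume $r_n=\Theta(\sqrt{\log n/n})$ and that $r_n$ ensures connectivity, i.e. the resulting random geometric graph is connected with probability tending to $1$ as $n\to\infty$. In the velocity-constrained mobility model with velocity constraint $v=v_n>0$, where $v_{n}=O(1)$, the nodes move independently in one time slot, node $i$ to a new position $Y_i$ uniformly distributed in the disk of radius $v_n$ centred at $X_i$ (modulo $\mathbb Z^2$). After the move, node $i$ contacts node $j$ with probability $P_{ij}(Y)=1/|\mathcal N_i(Y)|$ if $j$ belongs to the set $\mathcal N_i(Y)=\{j\ne i: d(Y_i,Y_j)<r_n\}$ of its new neighbours, and $P_{ij}(Y)=0$ otherwise. The mobile conductance, given the positions $X$ before the move, is $$\Phi_m(X)=\min_{\emptyset\ne S\subseteq\{1,\dots,n\},\ |S|\le n/2}\ \mathbb E\left[\frac{1}{|S|}\sum_{i\in S,\ j\notin S}P_{ij}(Y)\ \Big|\ X\right].$$ Say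 that $\Phi_m$ scales as $\Theta(f_n)$ if there are constants $0<c\le C$ with $c f_n\le\Phi_m(X)\le C f_n$ with probability (over $X$) tending to $1$ as $n\to\infty$. Then: 1. if $v_n=\omega(r_n)$, then $\Phi_m$ scales as $\Theta(v_n)$; 2. if $v_n=o(r_n)$, then $\Phi_m$ scales as $\Theta(r_n)$; 3. if $v_n=\Theta(r_n)$, then $\Phi_m$ scales both as $\Theta(v_n)$ and as $\Theta(r_n)$. -/

import Mathlib

open Filter Topology MeasureTheory Asymptotics

noncomputable section

namespace MobileNetwork

/-- Points of the plane with the Euclidean norm. -/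
abbrev Plane : Type := EuclideanSpace ℝ (Fin 2)

/-- The unit square `[0,1)²`. -/
def unitSquare : Set Plane := {x | ∀ k, 0 ≤ x k ∧ x k < 1}

/-- The integer vector `(m₀, m₁)` as a point of the plane. -/
def intVec (m : Fin 2 → ℤ) : Plane := WithLp.toLp 2 (fun k => (m k : ℝ))

/-- Euclidean distance on the unit square with opposite sides identified (so that there are no
edge effects), computed on arbitrary representatives in the plane. -/
def torusDist (x y : Plane) : ℝ := ⨅ m : Fin 2 → ℤ, ‖x - y + intVec m‖

theorem torusDist_comm (x y : Plane) : torusDist x y = torusDist y x := by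
  unfold torusDist
  refine (Equiv.neg (Fin 2 → ℤ)).iInf_congr fun m => ?_
  rw [← norm_neg]
  congr 1
  ext k
  simp [intVec]
  ring

/-- The uniform probability law on a planar set of positive finite area. -/
def uniformLaw (s : Set Plane) : Measure Plane := ProbabilityTheory.cond volume s

/-- The graph of a configuration `X` of `n` nodes with transmission range `r`: two distinct nodes
are neighbours when their distance is smaller than `r`. -/
def geometricGraph {n : ℕ} (r : ℝ) (X : Fin n → Plane) : SimpleGraph (Fin n) where
  Adj i j := i ≠ j ∧ torusDist (X i) (X j) < r
  symm := ⟨fun _ _ h => ⟨h.1.symm, torusDist_comm _ _ ▸ h.2⟩⟩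
  loopless := ⟨fun _ h => h.1 rfl⟩

open Classical in
/-- The probability that node `i` contacts node `j` in the gossip step, for node positions `X`:
node `i` chooses one of its neighbours uniformly at random. -/
def contactProb {n : ℕ} (r : ℝ) (X : Fin n → Plane) (i j : Fin n) : ℝ :=
  if (geometricGraph r X).Adj i j then
    1 / (((geometricGraph r X).neighborSet i).ncard : ℝ)
  else 0

/-- `n` independent uniform points of the unit square. -/
def initialLaw (n : ℕ) : Measure (Fin n → Plane) :=
  Measure.pi fun _ => uniformLaw unitSquare

/-- The velocity-constrained move: given the positions `X` before the move, the nodes move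
independently, node `i` to a uniform point of the disk of radius `v` centred at `X i`. (Positions
are understood modulo `ℤ²`, since only `torusDist` is applied to them.) -/
def moveLaw {n : ℕ} (v : ℝ) (X : Fin n → Plane) : Measure (Fin n → Plane) :=
  Measure.pi fun i => uniformLaw (Metric.closedBall (X i) v)

/-- The mobile conductance for positions `X` before the move: the minimum, over nonempty node sets
`S` with `|S| ≤ n/2`, of the expectation, over the positions `Y` after the move, of
`(∑_{i ∈ S, j ∉ S} P_ij(Y)) / |S|`. -/
def mobileConductance {n : ℕ} (r v : ℝ) (X : Fin n → Plane) : ℝ :=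
  ⨅ S : {S : Finset (Fin n) // S.Nonempty ∧ 2 * S.card ≤ n},
    ∫ Y, (∑ i ∈ S.1, ∑ j ∈ S.1ᶜ, contactProb r Y i j) / (S.1.card : ℝ) ∂(moveLaw v X)

/-- The event `p n` has probability tending to one, as the number `n` of nodes, placed
independently and uniformly in the unit square, tends to infinity. -/
def WithHighProbability (p : (n : ℕ) → (Fin n → Plane) → Prop) : Prop :=
  Tendsto (fun n => initialLaw n {X | ¬ p n X}) atTop (𝓝 0)

/-- The mobile conductance with ranges `r n` and velocity constraints `v n` scales as `Θ (f n)`,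
with high probability. -/
def ConductanceScalesAs (r v f : ℕ → ℝ) : Prop :=
  ∃ c > 0, ∃ C > 0, WithHighProbability fun n X =>
    c * f n ≤ mobileConductance (r n) (v n) X ∧ mobileConductance (r n) (v n) X ≤ C * f n

end MobileNetwork

end

/-! Upper bound. Let S be the nodes in a vertical strip of width 1/8. Two nodes that are neighbours
after the move were within 2v + r of each other before it, so only the nodes of S within 2v + r of
the two sides of the strip can contact the outside. By Chernoff bounds these are a proportion O(v +
r) of S (`mobileConductance_le_strip`, `initialLaw_mobileConductance_gt_le`).

Lower bound of order r, for every v > 0. Translations of the torus preserve the uniform law, so the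
positions after the move are again independent and uniform (`lintegral_moveLaw`). By Markov's
inequality it is enough that a connected random geometric graph has, with high probability,
conductance at least c r for all admissible S at once (`exists_tendsto_expandingPositions`). Cut the
torus into cells of side between r/5 and r/4: nodes in neighbouring cells are adjacent, and edges
span at most 5 cells. The mean occupancy is of order log n, but its constant may be too small for
every cell to be well filled. Group the cells into M × M windows. A Chernoff bound for K + 1 cells
taken together shows that no 3 × 3 block of windows contains more than K sparse cells, so each
window is surrounded by a thick frame of good cells. If no cut edge starts nearby, the frame lies on
one side of the cut, and connectivity forces the nodes inside onto the same side (`frame_uniform`).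
Give each window the majority side of one good cell. Nodes that disagree with their window are
charged to nearby cut edges. If these are few, both types occupy many windows, and a row-and-column
argument (`grid_isoperimetry`) produces many cut edges. The degrees are O(log n), so a large cut is
a large conductance.

Lower bound of order v when r = o(v). Before the move, join nodes at distance less than v. Cells of
side comparable to v have mean occupancy at least 8 log n, so all are regularly filled, and the same
isoperimetry gives at least a constant times |S| n v³ cut pairs (`card_le_cutPairs_of_regular`).
Each such pair is within r after the move with probability at least r²/(16 v²) (`moveLaw_adj_ge`),
while the new degrees are O(log n) = O(n r²). Hence the expected conductance is at least of order n
v³ · (r²/v²) / (n r²) = v. -/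

noncomputable section

namespace MobileNetwork

/-! ### Grid isoperimetry, majorities and the frame argument. -/

section Combinatorics

variable {V : Type*}

open Classical in
/-- The ordered pairs of adjacent nodes leading out of `S`. -/
def cutPairs [Fintype V] (G : SimpleGraph V) (S : Finset V) : Finset (V × V) :=
  Finset.univ.filter fun p => p.1 ∈ S ∧ p.2 ∉ S ∧ G.Adj p.1 p.2

theorem mem_cutPairs [Fintype V] {G : SimpleGraph V} {S : Finset V} {p : V × V} :
    p ∈ cutPairs G S ↔ p.1 ∈ S ∧ p.2 ∉ S ∧ G.Adj p.1 p.2 := by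
  simp [cutPairs]

theorem line_iff_of_le (P : ℤ → Prop) {s t : ℤ} (hst : s ≤ t)
    (h : ∀ a, s ≤ a → a < t → (P a ↔ P (a + 1))) : P s ↔ P t := by
  induction t, hst using Int.leInduction with
  | base => rfl
  | succ k hk ih =>
    exact (ih fun a ha hak => h a ha (by omega)).trans (h k hk (by omega))

theorem line_iff (P : ℤ → Prop) {lo hi s t : ℤ} (hs : lo ≤ s) (hs' : s < hi) (ht : lo ≤ t)
    (ht' : t < hi) (h : ∀ a, lo ≤ a → a + 1 < hi → (P a ↔ P (a + 1))) : P s ↔ P t := by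
  rcases le_total s t with hst | hst
  · exact line_iff_of_le P hst fun a ha hat => h a (by omega) (by omega)
  · exact (line_iff_of_le P hst fun a ha hat => h a (by omega) (by omega)).symm

theorem card_fiber_sum_le {α β : Type*} [DecidableEq β] (Q : Finset α) (f : α → β)
    (R : Finset β) : ∑ y ∈ R, (Q.filter fun p => f p = y).card ≤ Q.card := by
  classical
  rw [← Finset.card_biUnion]
  · refine Finset.card_le_card fun p hp => ?_
    simp only [Finset.mem_biUnion, Finset.mem_filter] at hp
    obtain ⟨_, _, hp, _⟩ := hp
    exact hp
  · intro y _ y' _ hne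
    refine Finset.disjoint_left.2 fun p hp hp' => hne ?_
    rw [Finset.mem_filter] at hp hp'
    exact hp.2.symm.trans hp'.2

open Classical in
-- A row or column containing both types has a change between consecutive windows, hence carries at
-- least l elements of `Q`. Each element has one row and one column, so there are at most |Q|/l
-- mixed rows and as many mixed columns, whereas many pairs of opposite type require many mixed
-- lines.
theorem grid_isoperimetry {α : Type*} {L : ℕ} (τ : ℤ → ℤ → Prop) (Q : Finset α)
    (wx wy : α → ℤ) {l : ℝ}
    (hrow : ∀ x y : ℤ, 0 ≤ x → x + 1 < L → 0 ≤ y → y < L → ¬ (τ x y ↔ τ (x + 1) y) →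
      l ≤ (Q.filter fun p => wy p = y).card)
    (hcol : ∀ x y : ℤ, 0 ≤ x → x < L → 0 ≤ y → y + 1 < L → ¬ (τ x y ↔ τ x (y + 1)) →
      l ≤ (Q.filter fun p => wx p = x).card)
    (hl : 0 ≤ l) {A A' : Finset (ℤ × ℤ)}
    (hA : ∀ p q, (p, q) ∈ A → (0 ≤ p ∧ p < L) ∧ (0 ≤ q ∧ q < L) ∧ τ p q)
    (hA' : ∀ p q, (p, q) ∈ A' → (0 ≤ p ∧ p < L) ∧ (0 ≤ q ∧ q < L) ∧ ¬ τ p q) :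
    l * (A.card * A'.card) ≤ 2 * (L : ℝ) ^ 3 * Q.card := by
  set I := Finset.Ico (0 : ℤ) L with hI
  have cI : I.card = L := by simp [hI]
  set R := I.filter fun y => ∃ x x', x ∈ I ∧ x' ∈ I ∧ τ x y ∧ ¬ τ x' y
  set C := I.filter fun x => ∃ y y', y ∈ I ∧ y' ∈ I ∧ τ x y ∧ ¬ τ x y'
  -- Look at the corner (x', y) between (x, y) and (x', y'): according to its type, either column x'
  -- or row y is mixed.
  have hsub : A ×ˢ A' ⊆ ((I ×ˢ R) ×ˢ (I ×ˢ I)) ∪ ((I ×ˢ I) ×ˢ (C ×ˢ I)) := by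
    rintro ⟨⟨x, y⟩, ⟨x', y'⟩⟩ h
    rw [Finset.mem_product] at h
    obtain ⟨hx, hy, h1⟩ := hA x y h.1
    obtain ⟨hx', hy', h2⟩ := hA' x' y' h.2
    rw [← Finset.mem_Ico] at hx hy hx' hy'
    simp only [Finset.mem_union, Finset.mem_product, R, C, Finset.mem_filter]
    by_cases h3 : τ x' y
    · exact Or.inr ⟨⟨hx, hy⟩, ⟨hx', y, y', hy, hy', h3, h2⟩, hy'⟩
    · exact Or.inl ⟨⟨hx, hy, x, x', hx, hx', h1, h3⟩, hx', hy'⟩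
  have hcard : A.card * A'.card ≤ L ^ 3 * R.card + L ^ 3 * C.card := by
    have := (Finset.card_le_card hsub).trans (Finset.card_union_le _ _)
    simp only [Finset.card_product, cI] at this
    calc _ ≤ _ := this
      _ = _ := by ring
  have hR : l * R.card ≤ Q.card := by
    have : ∑ y ∈ R, l ≤ ∑ y ∈ R, ((Q.filter fun p => wy p = y).card : ℝ) := by
      refine Finset.sum_le_sum fun y hy => ?_
      simp only [R, Finset.mem_filter] at hy
      obtain ⟨hyI, x, x', hx, hx', h1, h2⟩ := hy
      simp only [hI, Finset.mem_Ico] at hyI hx hx'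
      by_contra hcon
      refine h2 ((line_iff (fun x => τ x y) hx.1 hx.2 hx'.1 hx'.2 fun a ha ha' => ?_).1 h1)
      by_contra hne
      exact hcon (hrow a y ha ha' hyI.1 hyI.2 hne)
    rw [Finset.sum_const, nsmul_eq_mul, mul_comm] at this
    exact this.trans (by exact_mod_cast card_fiber_sum_le Q wy R)
  have hC : l * C.card ≤ Q.card := by
    have : ∑ x ∈ C, l ≤ ∑ x ∈ C, ((Q.filter fun p => wx p = x).card : ℝ) := by
      refine Finset.sum_le_sum fun x hx => ?_
      simp only [C, Finset.mem_filter] at hx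
      obtain ⟨hxI, y, y', hy, hy', h1, h2⟩ := hx
      simp only [hI, Finset.mem_Ico] at hxI hy hy'
      by_contra hcon
      refine h2 ((line_iff (fun y => τ x y) hy.1 hy.2 hy'.1 hy'.2 fun a ha ha' => ?_).1 h1)
      by_contra hne
      exact hcon (hcol x a hxI.1 hxI.2 ha ha' hne)
    rw [Finset.sum_const, nsmul_eq_mul, mul_comm] at this
    exact this.trans (by exact_mod_cast card_fiber_sum_le Q wx C)
  have hcard' : (A.card : ℝ) * A'.card ≤ (L : ℝ) ^ 3 * R.card + (L : ℝ) ^ 3 * C.card := by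
    exact_mod_cast hcard
  calc l * ((A.card : ℝ) * A'.card)
      ≤ l * ((L : ℝ) ^ 3 * R.card + (L : ℝ) ^ 3 * C.card) := by gcongr
    _ = (L : ℝ) ^ 3 * (l * R.card) + (L : ℝ) ^ 3 * (l * C.card) := by ring
    _ ≤ (L : ℝ) ^ 3 * Q.card + (L : ℝ) ^ 3 * Q.card := by gcongr
    _ = _ := by ring

/-- The arithmetic that turns the isoperimetric inequality into a bound for the size of a set by
the size of its boundary. -/
theorem size_le_of_isoperimetry {s n q A A' U E l L : ℝ} (hq : 0 ≤ q) (hU : 0 ≤ U)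
    (hA : 0 ≤ A) (hl : 0 < l) (hn : 0 < n)
    (h1 : s ≤ U * A + E * q) (h2 : n - s ≤ U * A' + E * q)
    (h3 : l * (A * A') ≤ 2 * L ^ 3 * q) (hsn : 2 * s ≤ n) :
    s ≤ max (2 * E) (16 * U ^ 2 * L ^ 3 / (l * n)) * q := by
  -- Either the exceptional nodes make up half of the set, or more than s/2 nodes of the set and n/4
  -- of its complement lie in windows of their own type.
  by_cases h4 : s ≤ 2 * E * q
  · exact h4.trans (mul_le_mul_of_nonneg_right (le_max_left _ _) hq)
  · refine le_trans ?_ (mul_le_mul_of_nonneg_right (le_max_right _ _) hq)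
    have h5 : s / 2 ≤ U * A := by linarith
    have h6 : n / 4 ≤ U * A' := by linarith
    have h7 : s / 2 * (n / 4) ≤ U * A * (U * A') := by gcongr
    have h8 : U * A * (U * A') * l ≤ U ^ 2 * (2 * L ^ 3 * q) := by
      calc _ = U ^ 2 * (l * (A * A')) := by ring
        _ ≤ _ := by gcongr
    rw [div_mul_eq_mul_div, le_div_iff₀ (by positivity)]
    nlinarith [mul_le_mul_of_nonneg_right h7 hl.le]

open Classical in
-- All pairs from `c ∩ S` to `c' \ S` are cut pairs, and each factor has at least g/2 elements. A
-- tie counts as a majority for `S`.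
theorem majority_cutPairs [Fintype V] {G : SimpleGraph V} {S c c' : Finset V} {g : ℝ} (hg : 0 ≤ g)
    (hadj : ∀ i ∈ c, ∀ j ∈ c', i ≠ j → G.Adj i j) (hc : g ≤ c.card) (hc' : g ≤ c'.card)
    (h : c.card ≤ 2 * (c ∩ S).card) (h' : ¬ c'.card ≤ 2 * (c' ∩ S).card) :
    g ^ 2 / 4 ≤ ((cutPairs G S).filter fun p => p.1 ∈ c ∧ p.2 ∈ c').card := by
  have hsub : (c ∩ S) ×ˢ (c' \ S) ⊆ (cutPairs G S).filter fun p => p.1 ∈ c ∧ p.2 ∈ c' := by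
    rintro ⟨i, j⟩ hp
    simp only [Finset.mem_product, Finset.mem_inter, Finset.mem_sdiff] at hp
    obtain ⟨⟨hi, hiS⟩, hj, hjS⟩ := hp
    simp only [Finset.mem_filter, mem_cutPairs]
    exact ⟨⟨hiS, hjS, hadj i hi j hj fun hij => hjS (hij ▸ hiS)⟩, hi, hj⟩
  have h1 := Finset.card_le_card hsub
  rw [Finset.card_product] at h1
  have h2 := Finset.card_sdiff_add_card_inter c' S
  have h3 : g / 2 ≤ ((c ∩ S).card : ℝ) := by
    have : (c.card : ℝ) ≤ 2 * (c ∩ S).card := by exact_mod_cast h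
    linarith
  have h4 : g / 2 ≤ ((c' \ S).card : ℝ) := by
    have : (c'.card : ℝ) ≤ 2 * (c' \ S).card := by exact_mod_cast (by omega)
    linarith
  calc g ^ 2 / 4 = (g / 2) * (g / 2) := by ring
    _ ≤ ((c ∩ S).card : ℝ) * ((c' \ S).card : ℝ) := by gcongr
    _ ≤ _ := by exact_mod_cast h1

/-- A square frame of nonempty cells, thicker than the range of the edges, whose vicinity meets
no edge leaving `S`, cannot surround both a node of `S` and a node outside `S`. -/
theorem frame_uniform {G : SimpleGraph V} (hG : G.Connected) {S : Finset V}
    {cell : ℤ → ℤ → Finset V} {D x₀ x₁ y₀ y₁ : ℤ} (hD : 1 ≤ D)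
    (h1 : ∀ a b a' b' i j, |a - a'| ≤ 1 → |b - b'| ≤ 1 → i ∈ cell a b → j ∈ cell a' b' →
      i ≠ j → G.Adj i j)
    (h2 : ∀ i j a b, G.Adj i j → i ∈ cell a b →
      ∃ a' b', |a' - a| ≤ D ∧ |b' - b| ≤ D ∧ j ∈ cell a' b')
        (hgood : ∀ a b, x₀ ≤ a → a < x₁ + D → y₀ ≤ b → b < y₁ + D →
      (a < x₀ + D ∨ x₁ ≤ a ∨ b < y₀ + D ∨ y₁ ≤ b) → (cell a b).Nonempty)
    (hcut : ∀ i j, i ∈ S → j ∉ S → G.Adj i j → ∀ a b, x₀ ≤ a → a < x₁ + D → y₀ ≤ b →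
      b < y₁ + D → i ∉ cell a b)
    {i j : V} {a b a' b' : ℤ} (hi : i ∈ S) (hj : j ∉ S) (hia : i ∈ cell a b)
    (hja : j ∈ cell a' b') (ha : x₀ + D ≤ a) (ha1 : a < x₁) (hb : y₀ + D ≤ b) (hb1 : b < y₁)
    (ha' : x₀ + D ≤ a') (ha1' : a' < x₁) (hb' : y₀ + D ≤ b') (hb1' : b' < y₁) : False := by
  -- edges leaving a proper nonempty set
  have hexit : ∀ P : V → Prop, (∃ i, P i) → (∃ j, ¬ P j) → ∃ p q, P p ∧ ¬ P q ∧ G.Adj p q := by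
    rintro P ⟨i, hi⟩ ⟨j, hj⟩
    obtain ⟨w⟩ := hG.preconnected i j
    obtain ⟨d, _, h1, h2⟩ := w.exists_boundary_dart {x | P x} hi hj
    exact ⟨d.fst, d.snd, h1, h2, d.adj⟩
  let In : V → Prop := fun k => ∃ a b, x₀ + D ≤ a ∧ a < x₁ ∧ y₀ + D ≤ b ∧ b < y₁ ∧ k ∈ cell a b
  have hout : ∀ p q, In p → ¬ In q → G.Adj p q → ∃ a b, x₀ ≤ a ∧ a < x₁ + D ∧ y₀ ≤ b ∧
      b < y₁ + D ∧ (a < x₀ + D ∨ x₁ ≤ a ∨ b < y₀ + D ∨ y₁ ≤ b) ∧ q ∈ cell a b := by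
    rintro p q ⟨a, b, h3, h4, h5, h6, h7⟩ hq hpq
    obtain ⟨a', b', h8, h9, h10⟩ := h2 p q a b hpq h7
    rw [abs_le] at h8 h9
    refine ⟨a', b', by omega, by omega, by omega, by omega, ?_, h10⟩
    by_contra hcon
    exact hq ⟨a', b', by omega, by omega, by omega, by omega, h10⟩
  -- an `S`-node in the frame
  obtain ⟨p, q, ⟨hp, hpS⟩, hq, hpq⟩ := hexit (fun k => In k ∧ k ∈ S)
    ⟨i, ⟨a, b, ha, ha1, hb, hb1, hia⟩, hi⟩ ⟨j, fun h => hj h.2⟩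
  have hqS : q ∈ S := by
    by_contra hqS
    obtain ⟨a, b, h3, h4, h5, h6, h7⟩ := hp
    exact hcut p q hpS hqS hpq a b (by omega) (by omega) (by omega) (by omega) h7
  obtain ⟨a₁, b₁, e1, e2, e3, e4, e5, e6⟩ := hout p q hp (fun h => hq ⟨h, hqS⟩) hpq
  -- a node outside `S` in the frame
  obtain ⟨p', q', ⟨hp', hpS'⟩, hq', hpq'⟩ := hexit (fun k => In k ∧ k ∉ S)
    ⟨j, ⟨a', b', ha', ha1', hb', hb1', hja⟩, hj⟩ ⟨i, fun h => h.2 hi⟩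
  have hqS' : q' ∉ S := by
    intro hqS
    obtain ⟨a, b, h3, h4, h5, h6, h7⟩ := hp'
    obtain ⟨c, d, h8, h9, h10⟩ := h2 p' q' a b hpq' h7
    rw [abs_le] at h8 h9
    -- Cut edges are oriented out of `S`, so the edge is read backwards from q'; its cell is within
    -- `D` of the interior, hence still in the region free of cut edges.
    exact hcut q' p' hqS hpS' hpq'.symm c d (by omega) (by omega) (by omega) (by omega) h10
  obtain ⟨a₂, b₂, f1, f2, f3, f4, f5, f6⟩ := hout p' q' hp' (fun h => hq' ⟨h, hqS'⟩) hpq'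
  -- the frame is uniform
  let σ : ℤ → ℤ → Prop := fun a b => ∃ i ∈ S, i ∈ cell a b
  let Fr : ℤ → ℤ → Prop := fun a b => x₀ ≤ a ∧ a < x₁ + D ∧ y₀ ≤ b ∧ b < y₁ + D ∧
    (a < x₀ + D ∨ x₁ ≤ a ∨ b < y₀ + D ∨ y₁ ≤ b)
  -- Nodes of neighbouring cells are adjacent, so a node outside `S` next to an `S`-node of the
  -- frame would give a forbidden cut edge.
  have hall : ∀ a b a' b', Fr a b → |a - a'| ≤ 1 → |b - b'| ≤ 1 → σ a b →
      ∀ k ∈ cell a' b', k ∈ S := by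
    rintro a b a' b' ⟨g1, g2, g3, g4, g5⟩ hA hB ⟨i, hiS, hi⟩ k hk
    by_contra hkS
    have hik : i ≠ k := fun h => hkS (h ▸ hiS)
    exact hcut i k hiS hkS (h1 a b a' b' i k hA hB hi hk hik) a b g1 g2 g3 g4 hi
  have hstep : ∀ a b a' b', Fr a b → Fr a' b' → |a - a'| ≤ 1 → |b - b'| ≤ 1 →
      (σ a b ↔ σ a' b') := by
    intro a b a' b' hF hF' hA hB
    constructor
    · intro h
      obtain ⟨k, hk⟩ := hgood a' b' hF'.1 hF'.2.1 hF'.2.2.1 hF'.2.2.2.1 hF'.2.2.2.2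
      exact ⟨k, hall a b a' b' hF hA hB h k hk, hk⟩
    · intro h
      obtain ⟨k, hk⟩ := hgood a b hF.1 hF.2.1 hF.2.2.1 hF.2.2.2.1 hF.2.2.2.2
      exact ⟨k, hall a' b' a b hF' (by rwa [abs_sub_comm]) (by rwa [abs_sub_comm]) h k hk, hk⟩
  have hH : ∀ b lo hi, (∀ a, lo ≤ a → a < hi → Fr a b) → ∀ s t, lo ≤ s → s < hi → lo ≤ t →
      t < hi → (σ s b ↔ σ t b) := by
    intro b lo hi hF s t h3 h4 h5 h6
    exact line_iff (fun a => σ a b) h3 h4 h5 h6 fun a h7 h8 =>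
      hstep a b (a + 1) b (hF a h7 (by omega)) (hF _ (by omega) h8) (by simp) (by simp)
  have hV : ∀ a lo hi, (∀ b, lo ≤ b → b < hi → Fr a b) → ∀ s t, lo ≤ s → s < hi → lo ≤ t →
      t < hi → (σ a s ↔ σ a t) := by
    intro a lo hi hF s t h3 h4 h5 h6
    exact line_iff (fun b => σ a b) h3 h4 h5 h6 fun b h7 h8 =>
      hstep a b a (b + 1) (hF b h7 (by omega)) (hF _ (by omega) h8) (by simp) (by simp)
  have hrow0 := hH y₀ x₀ (x₁ + D) fun a _ _ => ⟨by omega, by omega, by omega, by omega, by omega⟩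
  have hrow1 := hH y₁ x₀ (x₁ + D) fun a _ _ => ⟨by omega, by omega, by omega, by omega, by omega⟩
  have hcol0 := hV x₀ y₀ (y₁ + D) fun b _ _ => ⟨by omega, by omega, by omega, by omega, by omega⟩
  have hcol1 := hV x₁ y₀ (y₁ + D) fun b _ _ => ⟨by omega, by omega, by omega, by omega, by omega⟩
  have hcorner : ∀ a b, Fr a b → (σ a b ↔ σ x₀ y₀) := by
    rintro a b ⟨g1, g2, g3, g4, g5⟩
    rcases g5 with g5 | g5 | g5 | g5
    · exact (hH b x₀ (x₀ + D) (fun a _ _ => ⟨by omega, by omega, by omega, by omega, by omega⟩)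
        a x₀ (by omega) (by omega) (by omega) (by omega)).trans
        (hcol0 b y₀ (by omega) (by omega) (by omega) (by omega))
    · exact ((hH b x₁ (x₁ + D) (fun a _ _ => ⟨by omega, by omega, by omega, by omega, by omega⟩)
        a x₁ (by omega) (by omega) (by omega) (by omega)).trans
        (hcol1 b y₀ (by omega) (by omega) (by omega) (by omega))).trans
        (hrow0 x₁ x₀ (by omega) (by omega) (by omega) (by omega))
    · exact (hV a y₀ (y₀ + D) (fun a _ _ => ⟨by omega, by omega, by omega, by omega, by omega⟩)
        b y₀ (by omega) (by omega) (by omega) (by omega)).trans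
        (hrow0 a x₀ (by omega) (by omega) (by omega) (by omega))
    · exact ((hV a y₁ (y₁ + D) (fun a _ _ => ⟨by omega, by omega, by omega, by omega, by omega⟩)
        b y₁ (by omega) (by omega) (by omega) (by omega)).trans
        (hrow1 a x₀ (by omega) (by omega) (by omega) (by omega))).trans
        (hcol0 y₁ y₀ (by omega) (by omega) (by omega) (by omega))
  have hFr1 : Fr a₁ b₁ := ⟨e1, e2, e3, e4, e5⟩
  have hFr2 : Fr a₂ b₂ := ⟨f1, f2, f3, f4, f5⟩
  exact hqS' (hall a₂ b₂ a₂ b₂ hFr2 (by simp) (by simp)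
    ((hcorner _ _ hFr2).2 ((hcorner _ _ hFr1).1 ⟨q, hqS, e6⟩)) q' f6)

/-- A set of at most `K` integers leaves free one of `K + 1` consecutive blocks of length `D`. -/
theorem exists_free_block (B : Finset ℤ) {K : ℕ} (hB : B.card ≤ K) (s : ℤ) {D : ℤ} (hD : 1 ≤ D) :
    ∃ t, s ≤ t ∧ t ≤ s + K * D ∧ ∀ a, t ≤ a → a < t + D → a ∉ B := by
  by_contra! hcon
  have hK : ∀ k ∈ Finset.range (K + 1), ∃ a ∈ B, s + k * D ≤ a ∧ a < s + k * D + D := by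
    intro k hk
    rw [Finset.mem_range] at hk
    have hkK : (k : ℤ) ≤ K := by omega
    obtain ⟨a, h1, h2, h3⟩ := hcon (s + k * D) (by nlinarith) (by nlinarith)
    exact ⟨a, h3, h1, h2⟩
  choose! f hf using hK
  have hinj : Set.InjOn f (Finset.range (K + 1) : Set ℕ) := by
    intro k hk k' hk' he
    have h1 := (hf k hk).2
    have h2 := (hf k' hk').2
    rw [he] at h1
    have h3 : (k : ℤ) < k' + 1 := by
      by_contra h; push Not at h; nlinarith
    have h4 : (k' : ℤ) < k + 1 := by
      by_contra h; push Not at h; nlinarith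
    omega
  have := Finset.card_le_card_of_injOn f (fun k hk => (hf k hk).1) hinj
  rw [Finset.card_range] at this
  omega

end Combinatorics

/-! ### Cells on the torus, windows, and counting near a cut. -/

section Windows

variable {V : Type*} [Fintype V]

open Classical in
/-- The nodes in a cell of an `N × N` grid on the torus; cells are indexed modulo `N`. -/
def cellNodes (N : ℕ) (cx cy : V → ℤ) (a b : ℤ) : Finset V :=
  Finset.univ.filter fun i => cx i ≡ a [ZMOD N] ∧ cy i ≡ b [ZMOD N]

theorem mem_cellNodes {N : ℕ} {cx cy : V → ℤ} {a b : ℤ} {i : V} :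
    i ∈ cellNodes N cx cy a b ↔ cx i ≡ a [ZMOD N] ∧ cy i ≡ b [ZMOD N] := by
  simp [cellNodes]

theorem eq_of_modEq_of_mem_range {N : ℕ} {a b : ℤ} (h : a ≡ b [ZMOD N]) (ha : 0 ≤ a) (ha' : a < N)
    (hb : 0 ≤ b) (hb' : b < N) : a = b := by
  have := h
  rwa [Int.ModEq, Int.emod_eq_of_lt ha ha', Int.emod_eq_of_lt hb hb'] at this

variable {G : SimpleGraph V} {M L K : ℕ} {D : ℤ} {cx cy : V → ℤ} {g : ℝ}

open Classical in
/-- The cells with fewer than `g` nodes in the three by three windows around window `(p, q)`. -/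
def badCells (N M : ℕ) (cx cy : V → ℤ) (g : ℝ) (p q : ℤ) : Finset (ℤ × ℤ) :=
  (Finset.Ico (M * (p - 1)) (M * (p + 2)) ×ˢ Finset.Ico (M * (q - 1)) (M * (q + 2))).filter
    fun w => ((cellNodes N cx cy w.1 w.2).card : ℝ) < g

theorem good_of_notMem_fst {N : ℕ} {p q a b : ℤ}
    (h : a ∉ (badCells N M cx cy g p q).image Prod.fst)
    (ha : M * (p - 1) ≤ a) (ha' : a < M * (p + 2)) (hb : M * (q - 1) ≤ b)
    (hb' : b < M * (q + 2)) : g ≤ (cellNodes N cx cy a b).card := by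
  by_contra hcon
  refine h (Finset.mem_image.2 ⟨(a, b), ?_, rfl⟩)
  simp only [badCells, Finset.mem_filter, Finset.mem_product, Finset.mem_Ico]
  exact ⟨⟨⟨ha, ha'⟩, hb, hb'⟩, not_le.1 hcon⟩

theorem good_of_notMem_snd {N : ℕ} {p q a b : ℤ}
    (h : b ∉ (badCells N M cx cy g p q).image Prod.snd)
    (ha : M * (p - 1) ≤ a) (ha' : a < M * (p + 2)) (hb : M * (q - 1) ≤ b)
    (hb' : b < M * (q + 2)) : g ≤ (cellNodes N cx cy a b).card := by
  by_contra hcon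
  refine h (Finset.mem_image.2 ⟨(a, b), ?_, rfl⟩)
  simp only [badCells, Finset.mem_filter, Finset.mem_product, Finset.mem_Ico]
  exact ⟨⟨⟨ha, ha'⟩, hb, hb'⟩, not_le.1 hcon⟩

/-- If no edge leaving `S` starts near a window, then the nodes in the window are all in `S` or
all outside `S`. -/
theorem window_uniform (hG : G.Connected) {N : ℕ} (hD : 1 ≤ D) (hM : (K + 1) * D ≤ M)
    (h1 : ∀ a b a' b' i j, |a - a'| ≤ 1 → |b - b'| ≤ 1 → i ∈ cellNodes N cx cy a b →
      j ∈ cellNodes N cx cy a' b' → i ≠ j → G.Adj i j)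
    (h2 : ∀ i j a b, G.Adj i j → i ∈ cellNodes N cx cy a b →
      ∃ a' b', |a' - a| ≤ D ∧ |b' - b| ≤ D ∧ j ∈ cellNodes N cx cy a' b')
    (hg : 0 < g) {p q : ℤ} (hbad : (badCells N M cx cy g p q).card ≤ K) {S : Finset V}
    (hcut : ∀ i j, i ∈ S → j ∉ S → G.Adj i j → ∀ a b, M * (p - 1) ≤ a → a < M * (p + 2) →
      M * (q - 1) ≤ b → b < M * (q + 2) → i ∉ cellNodes N cx cy a b)
    {i j : V} {a b a' b' : ℤ} (hi : i ∈ S) (hia : i ∈ cellNodes N cx cy a b)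
    (hja : j ∈ cellNodes N cx cy a' b') (ha : M * p ≤ a) (ha1 : a < M * (p + 1)) (hb : M * q ≤ b)
    (hb1 : b < M * (q + 1)) (ha' : M * p ≤ a') (ha1' : a' < M * (p + 1)) (hb' : M * q ≤ b')
    (hb1' : b' < M * (q + 1)) : j ∈ S := by
  by_contra hj
  have c1 : ((badCells N M cx cy g p q).image Prod.fst).card ≤ K :=
    Finset.card_image_le.trans hbad
  have c2 : ((badCells N M cx cy g p q).image Prod.snd).card ≤ K :=
    Finset.card_image_le.trans hbad
  -- The sparse cells meet at most `K` columns and `K` rows, so each neighbouring strip of `M` lines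
  -- contains `D` consecutive lines free of them; (K + 1) D ≤ M keeps these four blocks outside the
  -- central window.
  obtain ⟨x₀, hx0, hx0', hx0g⟩ := exists_free_block _ c1 (M * (p - 1)) hD
  obtain ⟨x₁, hx1, hx1', hx1g⟩ := exists_free_block _ c1 (M * (p + 1)) hD
  obtain ⟨y₀, hy0, hy0', hy0g⟩ := exists_free_block _ c2 (M * (q - 1)) hD
  obtain ⟨y₁, hy1, hy1', hy1g⟩ := exists_free_block _ c2 (M * (q + 1)) hD
  have e1 : ((K : ℤ) + 1) * D = K * D + D := by ring
  have e2 : ∀ t : ℤ, (M : ℤ) * (t - 1) = M * t - M := fun t => by ring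
  have e3 : ∀ t : ℤ, (M : ℤ) * (t + 1) = M * t + M := fun t => by ring
  have e4 : ∀ t : ℤ, (M : ℤ) * (t + 2) = M * t + 2 * M := fun t => by ring
  have p1 := e2 p
  have p2 := e3 p
  have p3 := e4 p
  have q1 := e2 q
  have q2 := e3 q
  have q3 := e4 q
  have hne : ∀ a b, g ≤ (cellNodes N cx cy a b).card → (cellNodes N cx cy a b).Nonempty := by
    intro a b h
    rw [← Finset.card_pos]
    exact_mod_cast hg.trans_le h
  refine frame_uniform (x₀ := x₀) (x₁ := x₁) (y₀ := y₀) (y₁ := y₁) hG hD h1 h2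
    (fun a b k1 k2 k3 k4 k5 => hne a b ?_)
    (fun i j hi hj hij a b k1 k2 k3 k4 => hcut i j hi hj hij a b (by omega) (by omega) (by omega)
      (by omega)) hi hj hia hja (by omega) (by omega) (by omega) (by omega) (by omega) (by omega)
      (by omega) (by omega)
  rcases k5 with k5 | k5 | k5 | k5
  · exact good_of_notMem_fst (hx0g a k1 k5) (by omega) (by omega) (by omega) (by omega)
  · exact good_of_notMem_fst (hx1g a k5 k2) (by omega) (by omega) (by omega) (by omega)
  · exact good_of_notMem_snd (hy0g b k3 k5) (by omega) (by omega) (by omega) (by omega)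
  · exact good_of_notMem_snd (hy1g b k5 k4) (by omega) (by omega) (by omega) (by omega)

/-- Near every window there is a column and a row of good cells. -/
theorem exists_good_lines {N : ℕ} (hM : K + 1 ≤ M) {p q : ℤ}
    (hbad : (badCells N M cx cy g p q).card ≤ K) :
    ∃ a₀ b₀, (M * p ≤ a₀ ∧ a₀ < M * (p + 1)) ∧ (M * q ≤ b₀ ∧ b₀ < M * (q + 1)) ∧
      (∀ b, M * (q - 1) ≤ b → b < M * (q + 2) → g ≤ (cellNodes N cx cy a₀ b).card) ∧
      (∀ a, M * (p - 1) ≤ a → a < M * (p + 2) → g ≤ (cellNodes N cx cy a b₀).card) := by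
  have c1 : ((badCells N M cx cy g p q).image Prod.fst).card ≤ K :=
    Finset.card_image_le.trans hbad
  have c2 : ((badCells N M cx cy g p q).image Prod.snd).card ≤ K :=
    Finset.card_image_le.trans hbad
  obtain ⟨a₀, h1, h2, h3⟩ := exists_free_block _ c1 (M * p) le_rfl
  obtain ⟨b₀, h4, h5, h6⟩ := exists_free_block _ c2 (M * q) le_rfl
  have e2 : ∀ t : ℤ, (M : ℤ) * (t - 1) = M * t - M := fun t => by ring
  have e3 : ∀ t : ℤ, (M : ℤ) * (t + 1) = M * t + M := fun t => by ring
  have e4 : ∀ t : ℤ, (M : ℤ) * (t + 2) = M * t + 2 * M := fun t => by ring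
  have p1 := e2 p
  have p2 := e3 p
  have p3 := e4 p
  have q1 := e2 q
  have q2 := e3 q
  have q3 := e4 q
  refine ⟨a₀, b₀, ⟨by omega, by omega⟩, ⟨by omega, by omega⟩, fun b hb hb' => ?_,
    fun a ha ha' => ?_⟩
  · exact good_of_notMem_fst (h3 a₀ le_rfl (by omega)) (by omega) (by omega) hb hb'
  · exact good_of_notMem_snd (h6 b₀ le_rfl (by omega)) ha ha' (by omega) (by omega)

open Classical in
-- Charge each node to a cut pair starting nearby: a pair is charged only from the (2R + 1)² cells
-- around its start, each holding at most u nodes.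
theorem card_exceptional_le {N : ℕ} {S X : Finset V} {R : ℕ} {u : ℝ}
    (hu : ∀ a b, ((cellNodes N cx cy a b).card : ℝ) ≤ u)
    (hX : ∀ i ∈ X, ∃ c ∈ cutPairs G S, ∃ a b, |a - cx i| ≤ R ∧ |b - cy i| ≤ R ∧
      c.1 ∈ cellNodes N cx cy a b) :
    (X.card : ℝ) ≤ (2 * R + 1) ^ 2 * u * (cutPairs G S).card := by
  set J := Finset.Icc (-(R : ℤ)) R
  have cJ : (J.card : ℝ) = 2 * R + 1 := by
    have : J.card = 2 * R + 1 := by simp [J]; omega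
    rw [this]; push_cast; ring
  have hsub : X ⊆ (cutPairs G S ×ˢ (J ×ˢ J)).biUnion fun t =>
      cellNodes N cx cy (cx t.1.1 + t.2.1) (cy t.1.1 + t.2.2) := by
    intro i hi
    obtain ⟨c, hc, a, b, ha, hb, hab⟩ := hX i hi
    rw [abs_le] at ha hb
    rw [mem_cellNodes] at hab
    refine Finset.mem_biUnion.2 ⟨(c, (cx i - a, cy i - b)), ?_, ?_⟩
    · simp only [Finset.mem_product, J, Finset.mem_Icc]
      exact ⟨hc, ⟨by omega, by omega⟩, by omega, by omega⟩
    · rw [mem_cellNodes]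
      constructor
      · have := (hab.1.add_right (cx i - a)).symm
        rwa [add_sub_cancel] at this
      · have := (hab.2.add_right (cy i - b)).symm
        rwa [add_sub_cancel] at this
  calc (X.card : ℝ) ≤ ∑ t ∈ cutPairs G S ×ˢ (J ×ˢ J),
        ((cellNodes N cx cy (cx t.1.1 + t.2.1) (cy t.1.1 + t.2.2)).card : ℝ) := by
        exact_mod_cast (Finset.card_le_card hsub).trans Finset.card_biUnion_le
    _ ≤ ∑ t ∈ cutPairs G S ×ˢ (J ×ˢ J), u := Finset.sum_le_sum fun t _ => hu _ _
    _ = _ := by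
        rw [Finset.sum_const, nsmul_eq_mul, Finset.card_product, Finset.card_product]
        push_cast
        rw [cJ]; ring

open Classical in
theorem card_window_le {N : ℕ} (hM : 0 < M) {u : ℝ}
    (hu : ∀ a b, ((cellNodes N cx cy a b).card : ℝ) ≤ u)
    (p q : ℤ) : ((Finset.univ.filter fun i : V => cx i / M = p ∧ cy i / M = q).card : ℝ)
      ≤ M ^ 2 * u := by
  set J : ℤ → Finset ℤ := fun p => Finset.Ico (M * p) (M * p + M)
  have cJ : ∀ p, (J p).card = M := fun p => by simp [J]
  have hsub : (Finset.univ.filter fun i : V => cx i / M = p ∧ cy i / M = q) ⊆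
      (J p ×ˢ J q).biUnion fun t => cellNodes N cx cy t.1 t.2 := by
    intro i hi
    simp only [Finset.mem_filter, Finset.mem_univ, true_and] at hi
    refine Finset.mem_biUnion.2 ⟨(cx i, cy i), ?_, ?_⟩
    · have hM' : (0 : ℤ) < M := by exact_mod_cast hM
      have h1 := Int.emod_add_mul_ediv (cx i) M
      have h2 := Int.emod_add_mul_ediv (cy i) M
      have h3 := Int.emod_nonneg (cx i) hM'.ne'
      have h4 := Int.emod_nonneg (cy i) hM'.ne'
      have h5 := Int.emod_lt_of_pos (cx i) hM'
      have h6 := Int.emod_lt_of_pos (cy i) hM'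
      rw [hi.1] at h1
      rw [hi.2] at h2
      simp only [Finset.mem_product, J, Finset.mem_Ico]
      exact ⟨⟨by omega, by omega⟩, by omega, by omega⟩
    · exact mem_cellNodes.2 ⟨rfl, rfl⟩
  calc _ ≤ ∑ t ∈ J p ×ˢ J q, ((cellNodes N cx cy t.1 t.2).card : ℝ) := by
        exact_mod_cast (Finset.card_le_card hsub).trans Finset.card_biUnion_le
    _ ≤ ∑ t ∈ J p ×ˢ J q, u := Finset.sum_le_sum fun t _ => hu _ _
    _ = _ := by
        rw [Finset.sum_const, nsmul_eq_mul, Finset.card_product, cJ, cJ]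
        push_cast
        ring

end Windows

/-! ### Isoperimetry when each block of windows has few sparse cells. -/

section Windows

variable {V : Type*} [Fintype V]
variable {G : SimpleGraph V} {M L K : ℕ} {D : ℤ} {cx cy : V → ℤ} {g : ℝ}

open Classical in
/-- Counting the nodes of a set by windows, up to exceptional nodes. -/
theorem card_le_of_windows {α : Type*} [Fintype α] (wx wy : α → ℤ) {L : ℕ} (τ : ℤ → ℤ → Prop)
    (hwx : ∀ i, 0 ≤ wx i ∧ wx i < L) (hwy : ∀ i, 0 ≤ wy i ∧ wy i < L) {U : ℝ}
    (hU : ∀ p q, ((Finset.univ.filter fun i => wx i = p ∧ wy i = q).card : ℝ) ≤ U)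
    {A : Finset (ℤ × ℤ)} (hA : ∀ p q : ℤ, 0 ≤ p → p < L → 0 ≤ q → q < L → τ p q → (p, q) ∈ A)
    {T X : Finset α} (hX : ∀ i ∈ T, ¬ τ (wx i) (wy i) → i ∈ X) {e : ℝ} (he : (X.card : ℝ) ≤ e) :
    (T.card : ℝ) ≤ U * A.card + e := by
  have hsub : T ⊆ (A.biUnion fun w => Finset.univ.filter fun i => wx i = w.1 ∧ wy i = w.2) ∪
      X := by
    intro i hi
    by_cases h : τ (wx i) (wy i)
    · exact Finset.mem_union_left _ (Finset.mem_biUnion.2 ⟨(wx i, wy i),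
        hA _ _ (hwx i).1 (hwx i).2 (hwy i).1 (hwy i).2 h, by simp⟩)
    · exact Finset.mem_union_right _ (hX i hi h)
  have h1 : (T.card : ℝ) ≤ ∑ w ∈ A, ((Finset.univ.filter
      fun i => wx i = w.1 ∧ wy i = w.2).card : ℝ) + X.card := by
    exact_mod_cast (Finset.card_le_card hsub).trans ((Finset.card_union_le _ _).trans
      (Nat.add_le_add_right Finset.card_biUnion_le _))
  have h2 : ∑ w ∈ A, ((Finset.univ.filter fun i => wx i = w.1 ∧ wy i = w.2).card : ℝ)
      ≤ ∑ w ∈ A, U := Finset.sum_le_sum fun w _ => hU _ _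
  rw [Finset.sum_const, nsmul_eq_mul] at h2
  linarith

open Classical in
/-- A change of majority between two good cells joined by a line of good cells inside a family
of cells produces many cut pairs starting in that family. -/
theorem majority_const_of_few_cutPairs {ι : Type*} [Fintype ι] {G : SimpleGraph ι} {S : Finset ι}
    {g : ℝ} (hg : 0 ≤ g)
    (c : ℤ → Finset ι) {lo hi : ℤ} (hc : ∀ a, lo ≤ a → a < hi → g ≤ (c a).card)
    (hadj : ∀ a a', |a - a'| ≤ 1 → ∀ i ∈ c a, ∀ j ∈ c a', i ≠ j → G.Adj i j) (F : ι → Prop)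
    (hF : ∀ a, lo ≤ a → a < hi → ∀ i ∈ c a, F i)
    {Q : Finset (ι × ι)} (hQ : ∀ p ∈ cutPairs G S, F p.1 → p ∈ Q) (hfew : Q.card < g ^ 2 / 4)
    {s t : ℤ} (hs : lo ≤ s) (hs' : s < hi) (ht : lo ≤ t) (ht' : t < hi) :
    ((c s).card ≤ 2 * (c s ∩ S).card ↔ (c t).card ≤ 2 * (c t ∩ S).card) := by
  have key : ∀ a a', lo ≤ a → a < hi → lo ≤ a' → a' < hi → |a - a'| ≤ 1 →
      (c a).card ≤ 2 * (c a ∩ S).card → (c a').card ≤ 2 * (c a' ∩ S).card := by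
    intro a a' h1 h2 h3 h4 h5 h6
    by_contra h7
    have := majority_cutPairs hg (hadj a a' h5) (hc a h1 h2) (hc a' h3 h4) h6 h7
    have hle : ((cutPairs G S).filter fun p => p.1 ∈ c a ∧ p.2 ∈ c a').card ≤
        Q.card := by
      refine Finset.card_le_card fun p hp => ?_
      rw [Finset.mem_filter] at hp
      exact hQ p hp.1 (hF a h1 h2 _ hp.2.1)
    have hle' : (((cutPairs G S).filter fun p => p.1 ∈ c a ∧ p.2 ∈ c a').card : ℝ) ≤
        Q.card := by exact_mod_cast hle
    linarith
  refine line_iff (fun a => (c a).card ≤ 2 * (c a ∩ S).card) hs hs' ht ht' fun a h1 h2 => ?_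
  exact ⟨key a (a + 1) h1 (by omega) (by omega) h2 (by simp),
    key (a + 1) a (by omega) h2 h1 (by omega) (by simp)⟩

open Classical in
/-- **Isoperimetry in a graph on a torus grid with few bad cells.** -/
theorem card_le_cutPairs_of_few_badCells (hG : G.Connected) (hD : 1 ≤ D)
    (hM : (K + 1) * D ≤ M)
    (hcx : ∀ i, 0 ≤ cx i ∧ cx i < (M * L : ℕ)) (hcy : ∀ i, 0 ≤ cy i ∧ cy i < (M * L : ℕ))
    (h1 : ∀ a b a' b' i j, |a - a'| ≤ 1 → |b - b'| ≤ 1 → i ∈ cellNodes (M * L) cx cy a b →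
      j ∈ cellNodes (M * L) cx cy a' b' → i ≠ j → G.Adj i j)
    (h2 : ∀ i j a b, G.Adj i j → i ∈ cellNodes (M * L) cx cy a b →
      ∃ a' b', |a' - a| ≤ D ∧ |b' - b| ≤ D ∧ j ∈ cellNodes (M * L) cx cy a' b')
    (hg : 0 < g) {u : ℝ} (hu : ∀ a b, ((cellNodes (M * L) cx cy a b).card : ℝ) ≤ u)
    (hbad : ∀ p q : ℤ, 0 ≤ p → p < L → 0 ≤ q → q < L →
      (badCells (M * L) M cx cy g p q).card ≤ K)
    {S : Finset V} (hS : 2 * S.card ≤ Fintype.card V) (hV : 0 < Fintype.card V) :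
    (S.card : ℝ) ≤ max (2 * ((2 * (2 * M : ℕ) + 1) ^ 2 * u))
      (16 * (M ^ 2 * u) ^ 2 * L ^ 3 / (g ^ 2 / 4 * Fintype.card V)) * (cutPairs G S).card := by
  have hKM : K + 1 ≤ M := by
    have : ((K : ℤ) + 1) * 1 ≤ (K + 1) * D := by gcongr
    omega
  have hM0 : 0 < M := by omega
  have hM0' : (0 : ℤ) < M := by exact_mod_cast hM0
  have hreps : ∀ p q : ℤ, ∃ a₀ b₀, (0 ≤ p → p < L → 0 ≤ q → q < L →
      (M * p ≤ a₀ ∧ a₀ < M * (p + 1)) ∧ (M * q ≤ b₀ ∧ b₀ < M * (q + 1)) ∧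
      (∀ b, M * (q - 1) ≤ b → b < M * (q + 2) →
        g ≤ (cellNodes (M * L) cx cy a₀ b).card) ∧
      (∀ a, M * (p - 1) ≤ a → a < M * (p + 2) →
        g ≤ (cellNodes (M * L) cx cy a b₀).card)) := by
    intro p q
    by_cases h : 0 ≤ p ∧ p < L ∧ 0 ≤ q ∧ q < L
    · obtain ⟨a₀, b₀, h⟩ := exists_good_lines hKM (hbad p q h.1 h.2.1 h.2.2.1 h.2.2.2)
      exact ⟨a₀, b₀, fun _ _ _ _ => h⟩
    -- Outside the L × L array of windows the representative is arbitrary.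
    · exact ⟨0, 0, fun h1 h2 h3 h4 => absurd ⟨h1, h2, h3, h4⟩ h⟩
  choose ρx ρy hρ using hreps
  set cell := cellNodes (M * L) cx cy with hcell
  -- The type of a window is the majority side of its representative cell, where a good row and a
  -- good column cross.
  obtain ⟨τ, hτ⟩ : ∃ τ : ℤ → ℤ → Prop, ∀ p q, τ p q ↔ (cell (ρx p q) (ρy p q)).card ≤
      2 * (cell (ρx p q) (ρy p q) ∩ S).card := ⟨_, fun _ _ => Iff.rfl⟩
  have hdiv : ∀ t : ℤ, M * (t / M) ≤ t ∧ t < M * (t / M) + M := by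
    intro t
    have h1 := Int.emod_add_mul_ediv t M
    have h2 := Int.emod_nonneg t hM0'.ne'
    have h3 := Int.emod_lt_of_pos t hM0'
    constructor <;> omega
  have hdivL : ∀ t : ℤ, 0 ≤ t → t < (M * L : ℕ) → 0 ≤ t / M ∧ t / M < L := by
    intro t ht ht'
    push_cast at ht'
    exact ⟨Int.ediv_nonneg ht hM0'.le, Int.ediv_lt_of_lt_mul hM0' (by rwa [mul_comm])⟩
  have e2 : ∀ t : ℤ, (M : ℤ) * (t - 1) = M * t - M := fun t => by ring
  have e3 : ∀ t : ℤ, (M : ℤ) * (t + 1) = M * t + M := fun t => by ring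
  have e4 : ∀ t : ℤ, (M : ℤ) * (t + 2) = M * t + 2 * M := fun t => by ring
  have hML : ∀ t : ℤ, t < L → M * t + M ≤ (M * L : ℕ) := by
    intro t ht
    push_cast
    nlinarith
  have hwin : ∀ (w : V → ℤ), (∀ i, 0 ≤ w i ∧ w i < (M * L : ℕ)) → ∀ (i : V) (a q : ℤ), 0 ≤ q → q < L →
      M * q ≤ a → a < M * (q + 1) → w i ≡ a [ZMOD (M * L : ℕ)] → w i / M = q := by
    intro w hw i a q hq hq' ha ha' h
    have h3 := e3 q
    have h4 := hML q hq'
    have h5 : 0 ≤ M * q := by positivity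
    have h6 := eq_of_modEq_of_mem_range h (hw i).1 (hw i).2 (by omega) (by omega)
    have h7 := hdiv (w i)
    have h8 : (M : ℤ) * (w i / M) < M * (q + 1) := by omega
    have h9 : (M : ℤ) * q < M * (w i / M + 1) := by rw [e3]; omega
    have h10 := lt_of_mul_lt_mul_left h8 hM0'.le
    have h11 := lt_of_mul_lt_mul_left h9 hM0'.le
    omega
  have hadjH : ∀ b a a', |a - a'| ≤ 1 → ∀ i ∈ cell a b, ∀ j ∈ cell a' b, i ≠ j → G.Adj i j :=
    fun b a a' h i hi j hj hij => h1 a b a' b i j h (by simp) hi hj hij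
  have hadjV : ∀ a b b', |b - b'| ≤ 1 → ∀ i ∈ cell a b, ∀ j ∈ cell a b', i ≠ j → G.Adj i j :=
    fun a b b' h i hi j hj hij => h1 a b a b' i j (by simp) h hi hj hij
  obtain ⟨A, hA⟩ : ∃ A : Finset (ℤ × ℤ), ∀ p q, (p, q) ∈ A ↔
      (0 ≤ p ∧ p < L) ∧ (0 ≤ q ∧ q < L) ∧ τ p q :=
    ⟨(Finset.Ico (0 : ℤ) L ×ˢ Finset.Ico (0 : ℤ) L).filter fun w => τ w.1 w.2,
      fun p q => by simp [and_assoc]⟩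
  obtain ⟨A', hA'⟩ : ∃ A : Finset (ℤ × ℤ), ∀ p q, (p, q) ∈ A ↔
      (0 ≤ p ∧ p < L) ∧ (0 ≤ q ∧ q < L) ∧ ¬ τ p q :=
    ⟨(Finset.Ico (0 : ℤ) L ×ˢ Finset.Ico (0 : ℤ) L).filter fun w => ¬ τ w.1 w.2,
      fun p q => by simp [and_assoc]⟩
  have hiso := grid_isoperimetry (L := L) τ (cutPairs G S) (fun p => cx p.1 / M)
    (fun p => cy p.1 / M) (l := g ^ 2 / 4) ?_ ?_ (by positivity)
    (fun p q h => (hA p q).1 h) (fun p q h => (hA' p q).1 h)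
  · -- in a window away from the cut, the type of a node is that of the window
    have hexc : ∀ i, ¬ (i ∈ S ↔ τ (cx i / M) (cy i / M)) → ∃ c ∈ cutPairs G S, ∃ a b,
        |a - cx i| ≤ (2 * M : ℕ) ∧ |b - cy i| ≤ (2 * M : ℕ) ∧ c.1 ∈ cell a b := by
      intro i hi
      by_contra hcon
      have hcon' : ∀ k j, k ∈ S → j ∉ S → G.Adj k j → ∀ a b, M * (cx i / M - 1) ≤ a →
          a < M * (cx i / M + 2) → M * (cy i / M - 1) ≤ b → b < M * (cy i / M + 2) →
          k ∉ cell a b := by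
        intro k j hk hj hkj a b k1 k2 k3 k4 k5
        have := hdiv (cx i)
        have := hdiv (cy i)
        have := e2 (cx i / M)
        have := e4 (cx i / M)
        have := e2 (cy i / M)
        have := e4 (cy i / M)
        refine hcon ⟨(k, j), mem_cutPairs.2 ⟨hk, hj, hkj⟩, a, b, ?_, ?_, k5⟩
        · rw [abs_le]; push_cast; constructor <;> omega
        · rw [abs_le]; push_cast; constructor <;> omega
      obtain ⟨hp, hp'⟩ := hdivL _ (hcx i).1 (hcx i).2
      obtain ⟨hq, hq'⟩ := hdivL _ (hcy i).1 (hcy i).2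
      obtain ⟨⟨r1, r2⟩, ⟨r3, r4⟩, r5, r6⟩ := hρ _ _ hp hp' hq hq'
      have hdx := hdiv (cx i)
      have hdy := hdiv (cy i)
      have f2 := e3 (cx i / M)
      have f3 := e3 (cy i / M)
      have f4 := e2 (cx i / M)
      have f5 := e4 (cx i / M)
      have hgood := r6 (ρx (cx i / M) (cy i / M)) (by omega) (by omega)
      have hpos : 0 < (cell (ρx (cx i / M) (cy i / M)) (ρy (cx i / M) (cy i / M))).card := by
        exact_mod_cast hg.trans_le hgood
      have hmem : i ∈ cell (cx i) (cy i) := mem_cellNodes.2 ⟨rfl, rfl⟩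
      apply hi
      constructor
      -- With no cut edge nearby the window is uniform: a node of `S` puts the whole representative
      -- cell in `S`. Conversely, a majority in that nonempty cell supplies an `S`-node, which puts
      -- i in `S`.
      · intro hiS
        have hsub : cell (ρx (cx i / M) (cy i / M)) (ρy (cx i / M) (cy i / M)) ⊆ S :=
          fun j hj => window_uniform hG hD hM h1 h2 hg (hbad _ _ hp hp' hq hq') hcon' hiS hmem hj
            (by omega) (by omega) (by omega) (by omega) r1 r2 r3 r4
        rw [hτ, Finset.inter_eq_left.2 hsub]
        omega
      · intro hτi
        obtain ⟨j, hj⟩ : (cell (ρx (cx i / M) (cy i / M)) (ρy (cx i / M) (cy i / M)) ∩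
            S).Nonempty := by
          rw [← Finset.card_pos]
          rw [hτ] at hτi
          omega
        rw [Finset.mem_inter] at hj
        exact window_uniform hG hD hM h1 h2 hg (hbad _ _ hp hp' hq hq') hcon' hj.2 hj.1 hmem
            r1 r2 r3 r4 (by omega) (by omega) (by omega) (by omega)
    obtain ⟨X, hX⟩ : ∃ X : Finset V, ∀ i, i ∈ X ↔ ¬ (i ∈ S ↔ τ (cx i / M) (cy i / M)) :=
      ⟨Finset.univ.filter fun i => ¬ (i ∈ S ↔ τ (cx i / M) (cy i / M)), by simp⟩
    -- Every cell of the 3 × 3 block around the window of i is within 2M of the cell of i in each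
    -- coordinate.
    have hXcard := card_exceptional_le (S := S) (X := X) (R := 2 * M) hu
      fun i hi => hexc i ((hX i).1 hi)
    have hS1 := card_le_of_windows (fun i => cx i / M) (fun i => cy i / M) τ
      (fun i => hdivL _ (hcx i).1 (hcx i).2) (fun i => hdivL _ (hcy i).1 (hcy i).2)
      (card_window_le hM0 hu) (fun p q h1 h2 h3 h4 h5 => (hA p q).2 ⟨⟨h1, h2⟩, ⟨h3, h4⟩, h5⟩)
      (T := S) (fun i hi hni => (hX i).2 fun h => hni (h.1 hi)) hXcard
    have hS2 := card_le_of_windows (fun i => cx i / M) (fun i => cy i / M) (fun p q => ¬ τ p q)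
      (fun i => hdivL _ (hcx i).1 (hcx i).2) (fun i => hdivL _ (hcy i).1 (hcy i).2)
      (card_window_le hM0 hu) (fun p q h1 h2 h3 h4 h5 => (hA' p q).2 ⟨⟨h1, h2⟩, ⟨h3, h4⟩, h5⟩)
      (T := Sᶜ) (fun i hi hni => (hX i).2 fun h =>
        Finset.mem_compl.1 hi (h.2 (not_not.1 hni))) hXcard
    have hcompl : ((Sᶜ).card : ℝ) = Fintype.card V - S.card := by
      rw [Finset.card_compl, Nat.cast_sub (Finset.card_le_univ S)]
    rw [hcompl] at hS2
    have hu0 : 0 ≤ u := (Nat.cast_nonneg _).trans (hu 0 0)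
    exact size_le_of_isoperimetry (Nat.cast_nonneg _) (by positivity) (Nat.cast_nonneg _)
      (by positivity) (by exact_mod_cast hV) hS1 hS2 hiso (by exact_mod_cast hS)
  · -- a change along a row
    intro p q hp hp' hq hq' hne
    by_contra hfew
    rw [not_le] at hfew
    apply hne
    rw [hτ, hτ]
    obtain ⟨⟨r1, r2⟩, ⟨r3, r4⟩, r5, r6⟩ := hρ p q hp (by omega) hq hq'
    obtain ⟨⟨s1, s2⟩, ⟨s3, s4⟩, s5, s6⟩ := hρ (p + 1) q (by omega) hp' hq hq'
    have := e2 p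
    have := e3 p
    have := e4 p
    have := e3 (p + 1)
    have := e2 q
    have := e3 q
    have := e4 q
    have hF : ∀ a b, M * q ≤ b → b < M * (q + 1) → ∀ i ∈ cell a b, cy i / M = q :=
      fun a b hb hb' i hi => hwin cy hcy i b q hq hq' hb hb' (mem_cellNodes.1 hi).2
    -- Join the two representatives by good cells: along the good row of the first window to the
    -- good column of the second, then along that column. The path stays in window row q, so its cut
    -- pairs are all counted there.
    refine (majority_const_of_few_cutPairs (lo := M * (p - 1)) (hi := M * (p + 2)) hg.le
      (fun a => cell a (ρy p q)) (fun a => r6 a) (hadjH _) (fun i => cy i / M = q)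
      (fun a _ _ i hi => hF a _ r3 r4 i hi) (fun p hp hp' => Finset.mem_filter.2 ⟨hp, hp'⟩)
      hfew (s := ρx p q) (t := ρx (p + 1) q)
      (by omega) (by omega) (by omega) (by omega)).trans ?_
    exact majority_const_of_few_cutPairs (lo := M * q) (hi := M * (q + 1)) hg.le
      (fun b => cell (ρx (p + 1) q) b) (fun b hb hb' => s5 b (by omega) (by omega)) (hadjV _)
      (fun i => cy i / M = q) (fun b hb hb' i hi => hF _ b hb hb' i hi) (fun p hp hp' => Finset.mem_filter.2 ⟨hp, hp'⟩)
      hfew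
      (by omega) (by omega) (by omega) (by omega)
  · -- a change along a column
    intro p q hp hp' hq hq' hne
    by_contra hfew
    rw [not_le] at hfew
    apply hne
    rw [hτ, hτ]
    obtain ⟨⟨r1, r2⟩, ⟨r3, r4⟩, r5, r6⟩ := hρ p q hp hp' hq (by omega)
    obtain ⟨⟨s1, s2⟩, ⟨s3, s4⟩, s5, s6⟩ := hρ p (q + 1) hp hp' (by omega) hq'
    have := e2 q
    have := e3 q
    have := e4 q
    have := e3 (q + 1)
    have := e2 p
    have := e3 p
    have := e4 p
    have hF : ∀ a b, M * p ≤ a → a < M * (p + 1) → ∀ i ∈ cell a b, cx i / M = p :=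
      fun a b hb hb' i hi => hwin cx hcx i a p hp hp' hb hb' (mem_cellNodes.1 hi).1
    refine (majority_const_of_few_cutPairs (lo := M * (q - 1)) (hi := M * (q + 2)) hg.le
      (fun b => cell (ρx p q) b) (fun b => r5 b) (hadjV _) (fun i => cx i / M = p)
      (fun b _ _ i hi => hF _ b r1 r2 i hi) (fun p hp hp' => Finset.mem_filter.2 ⟨hp, hp'⟩)
      hfew (s := ρy p q) (t := ρy p (q + 1))
      (by omega) (by omega) (by omega) (by omega)).trans ?_
    exact majority_const_of_few_cutPairs (lo := M * p) (hi := M * (p + 1)) hg.le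
      (fun a => cell a (ρy p (q + 1))) (fun a hb hb' => s6 a (by omega) (by omega)) (hadjH _)
      (fun i => cx i / M = p) (fun a hb hb' i hi => hF a _ hb hb' i hi) (fun p hp hp' => Finset.mem_filter.2 ⟨hp, hp'⟩)
      hfew
      (by omega) (by omega) (by omega) (by omega)

end Windows

/-! ### Isoperimetry when every cell is well filled. -/

section GoodCells

variable {V : Type*} [Fintype V] {G : SimpleGraph V} {cx cy : V → ℤ} {g : ℝ}

theorem card_mul_le_of_fibers {α β : Type*} [DecidableEq β] {Q : Finset α} {X : Finset β}
    (f : α → β) {t : ℝ} (h : ∀ x ∈ X, t ≤ (Q.filter fun p => f p = x).card) :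
    X.card * t ≤ Q.card := by
  have h1 := Finset.sum_le_sum h
  rw [Finset.sum_const, nsmul_eq_mul] at h1
  exact h1.trans (by exact_mod_cast card_fiber_sum_le Q f X)

open Classical in
/-- **Isoperimetry in a graph on a square grid whose cells all have comparably many nodes.** -/
theorem card_le_cutPairs_of_good_cells {L : ℕ}
    (hcx : ∀ i, 0 ≤ cx i ∧ cx i < L) (hcy : ∀ i, 0 ≤ cy i ∧ cy i < L)
    (hadj : ∀ i j, |cx i - cx j| ≤ 1 → |cy i - cy j| ≤ 1 → i ≠ j → G.Adj i j)
    (hg : 0 < g) {u : ℝ}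
    (hgood : ∀ a b : ℤ, 0 ≤ a → a < L → 0 ≤ b → b < L →
      g ≤ (Finset.univ.filter fun i => cx i = a ∧ cy i = b).card)
    (hu : ∀ a b : ℤ, ((Finset.univ.filter fun i => cx i = a ∧ cy i = b).card : ℝ) ≤ u)
    {S : Finset V} (hS : 2 * S.card ≤ Fintype.card V) (hV : 0 < Fintype.card V) :
    (S.card : ℝ) ≤ max (2 * (2 / g)) (16 * u ^ 2 * L ^ 3 / (g ^ 2 / 4 * Fintype.card V)) *
      (cutPairs G S).card := by
  obtain ⟨cell, hcell⟩ : ∃ cell : ℤ → ℤ → Finset V, ∀ a b,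
      cell a b = Finset.univ.filter fun i => cx i = a ∧ cy i = b := ⟨_, fun _ _ => rfl⟩
  have hmem : ∀ {a b i}, i ∈ cell a b ↔ cx i = a ∧ cy i = b := fun {a b i} => by simp [hcell]
  obtain ⟨τ, hτ⟩ : ∃ τ : ℤ → ℤ → Prop, ∀ p q, τ p q ↔ (cell p q).card ≤
      2 * (cell p q ∩ S).card := ⟨_, fun _ _ => Iff.rfl⟩
  obtain ⟨A, hA⟩ : ∃ A : Finset (ℤ × ℤ), ∀ p q, (p, q) ∈ A ↔
      (0 ≤ p ∧ p < L) ∧ (0 ≤ q ∧ q < L) ∧ τ p q :=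
    ⟨(Finset.Ico (0 : ℤ) L ×ˢ Finset.Ico (0 : ℤ) L).filter fun w => τ w.1 w.2,
      fun p q => by simp [and_assoc]⟩
  obtain ⟨A', hA'⟩ : ∃ A : Finset (ℤ × ℤ), ∀ p q, (p, q) ∈ A ↔
      (0 ≤ p ∧ p < L) ∧ (0 ≤ q ∧ q < L) ∧ ¬ τ p q :=
    ⟨(Finset.Ico (0 : ℤ) L ×ˢ Finset.Ico (0 : ℤ) L).filter fun w => ¬ τ w.1 w.2,
      fun p q => by simp [and_assoc]⟩
  have hgood' : ∀ a b : ℤ, 0 ≤ a → a < L → 0 ≤ b → b < L → g ≤ (cell a b).card := by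
    intro a b h1 h2 h3 h4
    rw [hcell]
    exact hgood a b h1 h2 h3 h4
  have hgoodi : ∀ i, g ≤ (cell (cx i) (cy i)).card := fun i =>
    hgood' _ _ (hcx i).1 (hcx i).2 (hcy i).1 (hcy i).2
  have hsplit : ∀ a b, (cell a b \ S).card + (cell a b ∩ S).card = (cell a b).card :=
    fun a b => Finset.card_sdiff_add_card_inter _ _
  have hadj' : ∀ i j, j ∈ cell (cx i) (cy i) → i ≠ j → G.Adj i j := by
    intro i j hj hij
    obtain ⟨h1, h2⟩ := hmem.1 hj
    exact hadj i j (by simp [h1]) (by simp [h2]) hij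
  have hiso := grid_isoperimetry (L := L) τ (cutPairs G S) (fun p => cx p.1)
    (fun p => cy p.1) (l := g ^ 2 / 4) ?_ ?_ (by positivity)
    (fun p q h => (hA p q).1 h) (fun p q h => (hA' p q).1 h)
  -- An `S`-node in a cell without an `S`-majority is adjacent to at least g/2 nodes of its own cell
  -- outside `S`, so it starts that many cut pairs.
  · have hX1 : ((S.filter fun i => ¬ τ (cx i) (cy i)).card : ℝ) ≤
        2 / g * (cutPairs G S).card := by
      have := card_mul_le_of_fibers (Q := cutPairs G S)
        (X := S.filter fun i => ¬ τ (cx i) (cy i)) Prod.fst (t := g / 2) fun i hi => by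
          rw [Finset.mem_filter, hτ] at hi
          have h1 := hsplit (cx i) (cy i)
          have h2 : ((cell (cx i) (cy i)).card : ℝ) ≤ 2 * (cell (cx i) (cy i) \ S).card := by
            exact_mod_cast (by omega)
          have h3 : (cell (cx i) (cy i) \ S).card ≤
              ((cutPairs G S).filter fun p => p.1 = i).card := by
            refine Finset.card_le_card_of_injOn (fun j => (i, j)) ?_ (by simp [Set.InjOn])
            intro j hj
            rw [Finset.mem_coe, Finset.mem_sdiff] at hj
            rw [Finset.mem_coe, Finset.mem_filter, mem_cutPairs]
            exact ⟨⟨hi.1, hj.2, hadj' i j hj.1 fun h => hj.2 (h ▸ hi.1)⟩, rfl⟩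
          have h4 : ((cell (cx i) (cy i) \ S).card : ℝ) ≤
              ((cutPairs G S).filter fun p => p.1 = i).card := by exact_mod_cast h3
          linarith [hgoodi i]
      rw [div_mul_eq_mul_div, le_div_iff₀ hg]
      linarith
    -- The mirror count: here the exceptional node is the second member of the cut pairs.
    have hX2 : ((Sᶜ.filter fun i => τ (cx i) (cy i)).card : ℝ) ≤
        2 / g * (cutPairs G S).card := by
      have := card_mul_le_of_fibers (Q := cutPairs G S)
        (X := Sᶜ.filter fun i => τ (cx i) (cy i)) Prod.snd (t := g / 2) fun i hi => by
          rw [Finset.mem_filter, hτ, Finset.mem_compl] at hi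
          have h2 : ((cell (cx i) (cy i)).card : ℝ) ≤ 2 * (cell (cx i) (cy i) ∩ S).card := by
            exact_mod_cast hi.2
          have h3 : (cell (cx i) (cy i) ∩ S).card ≤
              ((cutPairs G S).filter fun p => p.2 = i).card := by
            refine Finset.card_le_card_of_injOn (fun j => (j, i)) ?_ (by simp [Set.InjOn])
            intro j hj
            rw [Finset.mem_coe, Finset.mem_inter] at hj
            rw [Finset.mem_coe, Finset.mem_filter, mem_cutPairs]
            exact ⟨⟨hj.2, hi.1, (hadj' i j hj.1 fun h => hi.1 (h ▸ hj.2)).symm⟩, rfl⟩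
          have h4 : ((cell (cx i) (cy i) ∩ S).card : ℝ) ≤
              ((cutPairs G S).filter fun p => p.2 = i).card := by exact_mod_cast h3
          linarith [hgoodi i]
      rw [div_mul_eq_mul_div, le_div_iff₀ hg]
      linarith
    have hS1 := card_le_of_windows cx cy τ hcx hcy hu
      (fun p q h1 h2 h3 h4 h5 => (hA p q).2 ⟨⟨h1, h2⟩, ⟨h3, h4⟩, h5⟩)
      (T := S) (fun i hi hni => Finset.mem_filter.2 ⟨hi, hni⟩) hX1
    have hS2 := card_le_of_windows cx cy (fun p q => ¬ τ p q) hcx hcy hu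
      (fun p q h1 h2 h3 h4 h5 => (hA' p q).2 ⟨⟨h1, h2⟩, ⟨h3, h4⟩, h5⟩)
      (T := Sᶜ) (fun i hi hni => Finset.mem_filter.2 ⟨hi, not_not.1 hni⟩) hX2
    have hcompl : ((Sᶜ).card : ℝ) = Fintype.card V - S.card := by
      rw [Finset.card_compl, Nat.cast_sub (Finset.card_le_univ S)]
    rw [hcompl] at hS2
    have hu0 : 0 ≤ u := (Nat.cast_nonneg _).trans (hu 0 0)
    exact size_le_of_isoperimetry (Nat.cast_nonneg _) hu0 (Nat.cast_nonneg _)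
      (by positivity) (by exact_mod_cast hV) hS1 hS2 hiso (by exact_mod_cast hS)
  · intro p q hp hp' hq hq' hne
    by_contra hfew
    rw [not_le] at hfew
    apply hne
    rw [hτ, hτ]
    exact majority_const_of_few_cutPairs (lo := 0) (hi := L) hg.le
      (fun a => cell a q) (fun a h1 h2 => hgood' a q h1 h2 hq hq')
      (fun a a' h i hi j hj hij => by
        obtain ⟨h1, h2⟩ := hmem.1 hi
        obtain ⟨h3, h4⟩ := hmem.1 hj
        exact hadj i j (by rwa [h1, h3]) (by simp [h2, h4]) hij) (fun i => cy i = q)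
      (fun a _ _ i hi => (hmem.1 hi).2) (fun p hp hp' => Finset.mem_filter.2 ⟨hp, hp'⟩)
      hfew hp (by omega) (by omega) hp'
  · intro p q hp hp' hq hq' hne
    by_contra hfew
    rw [not_le] at hfew
    apply hne
    rw [hτ, hτ]
    exact majority_const_of_few_cutPairs (lo := 0) (hi := L) hg.le
      (fun b => cell p b) (fun b h1 h2 => hgood' p b hp hp' h1 h2)
      (fun a a' h i hi j hj hij => by
        obtain ⟨h1, h2⟩ := hmem.1 hi
        obtain ⟨h3, h4⟩ := hmem.1 hj
        exact hadj i j (by simp [h1, h3]) (by rwa [h2, h4]) hij) (fun i => cx i = p)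
      (fun a _ _ i hi => (hmem.1 hi).1) (fun p hp hp' => Finset.mem_filter.2 ⟨hp, hp'⟩)
      hfew hq (by omega) (by omega) hq'

end GoodCells

/-! ### Distances and cell indices on the torus. -/

section TorusGeometry

theorem torusDist_bddBelow (x y : Plane) :
    BddBelow (Set.range fun m : Fin 2 → ℤ => ‖x - y + intVec m‖) :=
  ⟨0, by rintro _ ⟨m, rfl⟩; exact norm_nonneg _⟩

theorem torusDist_le (x y : Plane) (m : Fin 2 → ℤ) : torusDist x y ≤ ‖x - y + intVec m‖ :=
  ciInf_le (torusDist_bddBelow x y) m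

theorem torusDist_lt_iff {x y : Plane} {t : ℝ} :
    torusDist x y < t ↔ ∃ m, ‖x - y + intVec m‖ < t :=
  ⟨fun h => exists_lt_of_ciInf_lt h, fun ⟨m, h⟩ => (torusDist_le x y m).trans_lt h⟩

theorem intVec_add (m m' : Fin 2 → ℤ) : intVec (m + m') = intVec m + intVec m' := by
  ext k; simp [intVec]

theorem intVec_neg (m : Fin 2 → ℤ) : intVec (-m) = -intVec m := by
  ext k; simp [intVec]

theorem intVec_apply (m : Fin 2 → ℤ) (k : Fin 2) : intVec m k = m k := rfl

theorem torusDist_add_intVec (x y : Plane) (m m' : Fin 2 → ℤ) :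
    torusDist (x + intVec m) (y + intVec m') = torusDist x y := by
  unfold torusDist
  refine (Equiv.addRight (m - m')).iInf_congr fun k => ?_
  congr 1
  rw [Equiv.coe_addRight, intVec_add, show m - m' = m + -m' from sub_eq_add_neg _ _, intVec_add,
    intVec_neg]
  abel

theorem measurable_torusDist {α : Type*} [MeasurableSpace α] {f g : α → Plane}
    (hf : Measurable f) (hg : Measurable g) : Measurable fun a => torusDist (f a) (g a) := by
  unfold torusDist
  exact Measurable.iInf fun m => by fun_prop

theorem norm_le_of_coords {x : Plane} {t : ℝ} (h : ∀ k, |x k| ≤ t) : ‖x‖ ≤ 2 * t := by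
  have ht : 0 ≤ t := (abs_nonneg _).trans (h 0)
  rw [EuclideanSpace.norm_eq, Real.sqrt_le_left (by positivity)]
  simp only [Fin.sum_univ_two, Real.norm_eq_abs]
  nlinarith [abs_nonneg (x 0), abs_nonneg (x 1), h 0, h 1]

theorem abs_coord_le_norm (x : Plane) (k : Fin 2) : |x k| ≤ ‖x‖ := by
  simpa using PiLp.norm_apply_le x k

theorem abs_coord_lt {x y : Plane} {t : ℝ} (h : torusDist x y < t) :
    ∃ m : Fin 2 → ℤ, ∀ k, |x k - y k + m k| < t := by
  obtain ⟨m, hm⟩ := torusDist_lt_iff.1 h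
  refine ⟨m, fun k => (abs_coord_le_norm _ k).trans_lt hm |>.trans_eq' ?_⟩
  simp [intVec]

theorem torusDist_lt_of_coords {x y : Plane} {t s : ℝ} {m : Fin 2 → ℤ}
    (h : ∀ k, |x k - y k + m k| ≤ s) (hs : 2 * s < t) : torusDist x y < t :=
  torusDist_lt_iff.2 ⟨m, (norm_le_of_coords fun k => by
    simpa [intVec] using h k).trans_lt hs⟩

/-- The index of the cell containing `x` on a circle of length one divided into `N` cells. -/
def cellIdx (N : ℕ) (x : ℝ) : ℤ := ⌊N * x⌋ % N

theorem cellIdx_nonneg {N : ℕ} (hN : 0 < N) (x : ℝ) : 0 ≤ cellIdx N x :=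
  Int.emod_nonneg _ (by exact_mod_cast hN.ne')

theorem cellIdx_lt {N : ℕ} (hN : 0 < N) (x : ℝ) : cellIdx N x < N :=
  Int.emod_lt_of_pos _ (by exact_mod_cast hN)

theorem measurable_cellIdx (N : ℕ) : Measurable (cellIdx N) := by
  unfold cellIdx
  exact (measurable_from_top (f := fun t : ℤ => t % N)).comp
    (Int.measurable_floor.comp (measurable_const_mul _))

theorem cellIdx_add_int (N : ℕ) (x : ℝ) (m : ℤ) : cellIdx N (x + m) = cellIdx N x := by
  unfold cellIdx
  have : (N : ℝ) * (x + m) = N * x + ((N * m : ℤ) : ℝ) := by push_cast; ring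
  rw [this, Int.floor_add_intCast, Int.add_mul_emod_self_left]

theorem cellIdx_modEq_iff {N : ℕ} {x : ℝ} {a : ℤ} :
    cellIdx N x ≡ a [ZMOD N] ↔ ∃ m : ℤ, ⌊(N : ℝ) * x⌋ = a + N * m := by
  unfold cellIdx
  rw [Int.ModEq, Int.emod_emod, ← Int.ModEq, Int.modEq_comm, Int.modEq_iff_dvd]
  constructor
  · rintro ⟨m, hm⟩
    exact ⟨m, by omega⟩
  · rintro ⟨m, hm⟩
    exact ⟨m, by omega⟩

/-- After scaling by N and an integer shift the integer parts differ by at most 1, and the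
fractional parts by less than 1. -/
theorem abs_le_of_cellIdx {N : ℕ} (hN : 0 < N) {x y : ℝ} {a b : ℤ}
    (hx : cellIdx N x ≡ a [ZMOD N]) (hy : cellIdx N y ≡ b [ZMOD N]) (hab : |a - b| ≤ 1) :
    ∃ m : ℤ, |x - y + m| ≤ 2 / N ∧ |x - y + m| < 2 / N := by
  obtain ⟨m, hm⟩ := cellIdx_modEq_iff.1 hx
  obtain ⟨m', hm'⟩ := cellIdx_modEq_iff.1 hy
  have hN' : (0 : ℝ) < N := by exact_mod_cast hN
  have h1 := Int.floor_le ((N : ℝ) * x)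
  have h2 := Int.lt_floor_add_one ((N : ℝ) * x)
  have h3 := Int.floor_le ((N : ℝ) * y)
  have h4 := Int.lt_floor_add_one ((N : ℝ) * y)
  rw [hm] at h1 h2
  rw [hm'] at h3 h4
  push_cast at h1 h2 h3 h4
  have hab' : |(a : ℝ) - b| ≤ 1 := by exact_mod_cast hab
  rw [abs_le] at hab'
  have : |x - y + ((m' - m : ℤ) : ℝ)| < 2 / N := by
    have habs : |x - y + ((m' - m : ℤ) : ℝ)| * N = |(x - y + ((m' - m : ℤ) : ℝ)) * N| := by
      rw [abs_mul, abs_of_pos hN']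
    rw [lt_div_iff₀ hN', habs, abs_lt]
    push_cast
    constructor <;> nlinarith
  exact ⟨m' - m, this.le, this⟩

/-- The scaled points differ by strictly less than the integer `D`, so their floors differ by less
than D + 1, that is, by at most `D`; no extra cell is lost to rounding. -/
theorem exists_cellIdx_of_abs_lt {N : ℕ} {x y t : ℝ} {m a D : ℤ} (hN : 0 < N)
    (h : |x - y + m| < t) (ht : N * t ≤ D) (hx : cellIdx N x ≡ a [ZMOD N]) :
    ∃ b : ℤ, |b - a| ≤ D ∧ cellIdx N y ≡ b [ZMOD N] := by
  obtain ⟨k, hk⟩ := cellIdx_modEq_iff.1 hx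
  have hN' : (0 : ℝ) < N := by exact_mod_cast hN
  have h1 := Int.floor_le ((N : ℝ) * x)
  have h2 := Int.lt_floor_add_one ((N : ℝ) * x)
  have h3 := Int.floor_le ((N : ℝ) * y)
  have h4 := Int.lt_floor_add_one ((N : ℝ) * y)
  refine ⟨⌊(N : ℝ) * y⌋ - N * m - N * k, ?_, cellIdx_modEq_iff.2 ⟨m + k, by ring⟩⟩
  have h5 : |(N : ℝ) * x - N * y + N * m| < D := by
    have : (N : ℝ) * x - N * y + N * m = N * (x - y + m) := by ring
    rw [this, abs_mul, abs_of_pos hN']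
    exact (mul_lt_mul_of_pos_left h hN').trans_le ht
  rw [abs_lt] at h5
  have h6 : a = ⌊(N : ℝ) * x⌋ - N * k := by omega
  have h7 : (⌊(N : ℝ) * y⌋ : ℝ) - N * m - ⌊(N : ℝ) * x⌋ < D + 1 := by linarith
  have h8 : -((D : ℝ) + 1) < (⌊(N : ℝ) * y⌋ : ℝ) - N * m - ⌊(N : ℝ) * x⌋ := by linarith
  have h7' : ⌊(N : ℝ) * y⌋ - N * m - ⌊(N : ℝ) * x⌋ < D + 1 := by exact_mod_cast h7
  have h8' : -(D + 1) < ⌊(N : ℝ) * y⌋ - N * m - ⌊(N : ℝ) * x⌋ := by exact_mod_cast h8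
  rw [abs_le, h6]
  constructor <;> omega

/-- Points in neighbouring cells are close. -/
theorem torusDist_lt_of_cellIdx {N : ℕ} (hN : 0 < N) {t : ℝ} (ht : 4 ≤ N * t) {x y : Plane}
    {a b : Fin 2 → ℤ} (hx : ∀ k, cellIdx N (x k) ≡ a k [ZMOD N])
    (hy : ∀ k, cellIdx N (y k) ≡ b k [ZMOD N]) (hab : ∀ k, |a k - b k| ≤ 1) :
    torusDist x y < t := by
  have h := fun k => abs_le_of_cellIdx hN (hx k) (hy k) (hab k)
  choose m hm hm' using h
  have hN' : (0 : ℝ) < N := by exact_mod_cast hN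
  -- Taking s to be the actual maximum rather than its bound 2/N keeps the inequality strict even
  -- when N t = 4.
  refine torusDist_lt_of_coords (m := m) (s := max |x 0 - y 0 + m 0| |x 1 - y 1 + m 1|) ?_ ?_
  · intro k
    fin_cases k
    · exact le_max_left _ _
    · exact le_max_right _ _
  · have h1 : max |x 0 - y 0 + m 0| |x 1 - y 1 + m 1| < 2 / N := max_lt (hm' 0) (hm' 1)
    rw [lt_div_iff₀ hN'] at h1
    by_contra hcon
    rw [not_lt] at hcon
    nlinarith [mul_le_mul_of_nonneg_left hcon hN'.le]

/-- Points at small distance are in cells at small distance. -/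
theorem exists_cellIdx_of_torusDist_lt {N : ℕ} (hN : 0 < N) {t : ℝ} {D : ℤ} (ht : N * t ≤ D)
    {x y : Plane} (h : torusDist x y < t) {a : Fin 2 → ℤ}
    (hx : ∀ k, cellIdx N (x k) ≡ a k [ZMOD N]) :
    ∃ b : Fin 2 → ℤ, ∀ k, |b k - a k| ≤ D ∧ cellIdx N (y k) ≡ b k [ZMOD N] := by
  obtain ⟨m, hm⟩ := abs_coord_lt h
  have := fun k => exists_cellIdx_of_abs_lt hN (hm k) ht (hx k)
  choose b hb using this
  exact ⟨b, hb⟩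

end TorusGeometry

/-! ### The geometric graph and its contact probabilities. -/

section Graph

variable {n : ℕ} {r : ℝ}

theorem geometricGraph_adj {X : Fin n → Plane} {i j : Fin n} :
    (geometricGraph r X).Adj i j ↔ i ≠ j ∧ torusDist (X i) (X j) < r := Iff.rfl

/-- The cells of the `N × N` grid on the torus, filled with the nodes at positions `X`. -/
def nodesInCell (N : ℕ) (X : Fin n → Plane) (a b : ℤ) : Finset (Fin n) :=
  cellNodes N (fun i => cellIdx N (X i 0)) (fun i => cellIdx N (X i 1)) a b

theorem mem_nodesInCell {N : ℕ} {X : Fin n → Plane} {a b : ℤ} {i : Fin n} :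
    i ∈ nodesInCell N X a b ↔
      cellIdx N (X i 0) ≡ a [ZMOD N] ∧ cellIdx N (X i 1) ≡ b [ZMOD N] := mem_cellNodes

theorem adj_of_mem_nodesInCell {N : ℕ} (hN : 0 < N) (hr : 4 ≤ N * r) {X : Fin n → Plane}
    (a b a' b' : ℤ) (i j : Fin n) (ha : |a - a'| ≤ 1) (hb : |b - b'| ≤ 1)
    (hi : i ∈ nodesInCell N X a b) (hj : j ∈ nodesInCell N X a' b') (hij : i ≠ j) :
    (geometricGraph r X).Adj i j := by
  rw [mem_nodesInCell] at hi hj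
  refine ⟨hij, torusDist_lt_of_cellIdx hN hr (a := ![a, b]) (b := ![a', b']) ?_ ?_ ?_⟩
  all_goals intro k; fin_cases k <;> simp [hi, hj, ha, hb]

theorem exists_cell_of_adj {N : ℕ} (hN : 0 < N) {D : ℤ} (hr : N * r ≤ D) {X : Fin n → Plane}
    (i j : Fin n) (a b : ℤ) (h : (geometricGraph r X).Adj i j) (hi : i ∈ nodesInCell N X a b) :
    ∃ a' b', |a' - a| ≤ D ∧ |b' - b| ≤ D ∧ j ∈ nodesInCell N X a' b' := by
  rw [mem_nodesInCell] at hi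
  obtain ⟨c, hc⟩ := exists_cellIdx_of_torusDist_lt hN hr h.2 (a := ![a, b]) (by
    intro k; fin_cases k <;> simp [hi])
  exact ⟨c 0, c 1, by simpa using (hc 0).1, by simpa using (hc 1).1,
    mem_nodesInCell.2 ⟨(hc 0).2, (hc 1).2⟩⟩

/-- The degrees are controlled by the maximal number of nodes in a cell. -/
theorem ncard_neighborSet_le {N : ℕ} (hN : 0 < N) {D : ℕ} (hr : N * r ≤ D) {X : Fin n → Plane}
    {u : ℝ} (hu : ∀ a b, ((nodesInCell N X a b).card : ℝ) ≤ u) (i : Fin n) :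
    (((geometricGraph r X).neighborSet i).ncard : ℝ) ≤ (2 * D + 1) ^ 2 * u := by
  classical
  set J := Finset.Icc (-(D : ℤ)) D
  have cJ : (J.card : ℝ) = 2 * D + 1 := by
    have : J.card = 2 * D + 1 := by simp [J]; omega
    rw [this]; push_cast; ring
  have hsub : (geometricGraph r X).neighborSet i ⊆ ↑((J ×ˢ J).biUnion fun t =>
      nodesInCell N X (cellIdx N (X i 0) + t.1) (cellIdx N (X i 1) + t.2)) := by
    intro j hj
    obtain ⟨a, b, ha, hb, hj'⟩ := exists_cell_of_adj hN (D := D) (by exact_mod_cast hr) i j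
      (cellIdx N (X i 0)) (cellIdx N (X i 1)) hj (mem_nodesInCell.2 ⟨rfl, rfl⟩)
    rw [abs_le] at ha hb
    rw [Finset.mem_coe]
    refine Finset.mem_biUnion.2 ⟨(a - cellIdx N (X i 0), b - cellIdx N (X i 1)), ?_, by simpa⟩
    simp only [Finset.mem_product, J, Finset.mem_Icc]
    exact ⟨⟨by omega, by omega⟩, by omega, by omega⟩
  have h1 := Set.ncard_le_ncard hsub (Finset.finite_toSet _)
  rw [Set.ncard_coe_finset] at h1
  calc (((geometricGraph r X).neighborSet i).ncard : ℝ)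
      ≤ ∑ t ∈ J ×ˢ J, ((nodesInCell N X (cellIdx N (X i 0) + t.1)
        (cellIdx N (X i 1) + t.2)).card : ℝ) := by
        exact_mod_cast h1.trans Finset.card_biUnion_le
    _ ≤ ∑ t ∈ J ×ˢ J, u := Finset.sum_le_sum fun t _ => hu _ _
    _ = _ := by
        rw [Finset.sum_const, nsmul_eq_mul, Finset.card_product]
        push_cast
        rw [cJ]; ring

theorem contactProb_nonneg (X : Fin n → Plane) (i j : Fin n) : 0 ≤ contactProb r X i j := by
  unfold contactProb
  split_ifs <;> positivity

theorem sum_contactProb_le_one (X : Fin n → Plane) (i : Fin n) (T : Finset (Fin n)) :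
    ∑ j ∈ T, contactProb r X i j ≤ 1 := by
  classical
  unfold contactProb
  rw [← Finset.sum_filter, Finset.sum_const, nsmul_eq_mul, mul_one_div]
  refine div_le_one_of_le₀ ?_ (Nat.cast_nonneg _)
  have : (T.filter fun j => (geometricGraph r X).Adj i j).card ≤
      ((geometricGraph r X).neighborSet i).ncard := by
    rw [← Set.ncard_coe_finset]
    exact Set.ncard_le_ncard (fun j hj => (Finset.mem_filter.1 hj).2) (Set.toFinite _)
  exact_mod_cast this

theorem contactProb_ge {X : Fin n → Plane} {i j : Fin n} {d : ℝ}
    (hd : (((geometricGraph r X).neighborSet i).ncard : ℝ) ≤ d)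
    (h : (geometricGraph r X).Adj i j) : 1 / d ≤ contactProb r X i j := by
  unfold contactProb
  rw [if_pos h]
  refine one_div_le_one_div_of_le ?_ hd
  have : 0 < ((geometricGraph r X).neighborSet i).ncard :=
    (Set.ncard_pos (Set.toFinite _)).2 ⟨j, h⟩
  exact_mod_cast this

theorem geometricGraph_add_intVec (X : Fin n → Plane) (m : Fin n → Fin 2 → ℤ) :
    geometricGraph r (fun i => X i + intVec (m i)) = geometricGraph r X := by
  ext i j
  simp only [geometricGraph_adj, torusDist_add_intVec]

theorem contactProb_add_intVec (X : Fin n → Plane) (m : Fin n → Fin 2 → ℤ) (i j : Fin n) :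
    contactProb r (fun i => X i + intVec (m i)) i j = contactProb r X i j := by
  unfold contactProb
  rw [geometricGraph_add_intVec]

theorem measurableSet_adj (i j : Fin n) :
    MeasurableSet {X : Fin n → Plane | (geometricGraph r X).Adj i j} := by
  have h2 : Measurable fun X : Fin n → Plane => torusDist (X i) (X j) :=
    measurable_torusDist (measurable_pi_apply i) (measurable_pi_apply j)
  have h3 : MeasurableSet {X : Fin n → Plane | torusDist (X i) (X j) < r} :=
    measurableSet_lt h2 measurable_const
  by_cases hij : i = j
  · simp only [geometricGraph_adj, hij, ne_eq, not_true_eq_false, false_and, Set.ofPred_false,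
      MeasurableSet.empty]
  · simpa only [geometricGraph_adj, hij, ne_eq, not_false_eq_true, true_and] using h3

/-- The degree is a finite sum of indicators of adjacency events, which makes the contact
probability an explicit measurable expression. -/
theorem measurable_contactProb (i j : Fin n) :
    Measurable fun X : Fin n → Plane => contactProb r X i j := by
  classical
  have h : ∀ X : Fin n → Plane, contactProb r X i j =
      Set.indicator {X : Fin n → Plane | (geometricGraph r X).Adj i j} (fun X => 1 / ∑ k,
        Set.indicator {X : Fin n → Plane | (geometricGraph r X).Adj i k} (fun _ => (1 : ℝ)) X)
        X := by
    intro X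
    unfold contactProb
    rw [Set.indicator_apply]
    refine if_congr Iff.rfl ?_ rfl
    congr 1
    simp only [Set.indicator_apply, Finset.sum_boole]
    rw [← Set.ncard_coe_finset]
    congr 2
    ext k
    simp
  have h1 : ∀ k, Measurable (Set.indicator {X : Fin n → Plane | (geometricGraph r X).Adj i k}
      (fun _ => (1 : ℝ))) := fun k => measurable_const.indicator (measurableSet_adj i k)
  have h2 : Measurable fun X : Fin n → Plane => ∑ k,
      Set.indicator {X : Fin n → Plane | (geometricGraph r X).Adj i k} (fun _ => (1 : ℝ)) X :=
    Finset.measurable_sum _ fun k _ => h1 k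
  have h3 : Measurable fun X : Fin n → Plane => 1 / ∑ k,
      Set.indicator {X : Fin n → Plane | (geometricGraph r X).Adj i k} (fun _ => (1 : ℝ)) X :=
    h2.const_div 1
  have h4 := h3.indicator (measurableSet_adj (r := r) i j)
  rwa [← funext h] at h4

end Graph

/-! ### Chernoff bounds. -/

section Chernoff

variable {α : Type*} [MeasurableSpace α] (μ : Measure α) [IsProbabilityMeasure μ] {A : Set α}

open Classical in
/-- Chernoff's bound for the number of independent points that fall into a set. -/
theorem count_tail_le (hA : MeasurableSet A) (n : ℕ) (t s : ℝ) :
    (Measure.pi fun _ : Fin n => μ).real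
      {X | t * s ≤ t * (Finset.univ.filter fun i => X i ∈ A).card} ≤
      Real.exp (n * μ.real A * (Real.exp t - 1) - t * s) := by
  set ν := Measure.pi fun _ : Fin n => μ
  -- This is the exponential of t times the indicator of `A`, written in a form whose integral is
  -- immediate. Keeping t on both sides of the event covers the upper tail for t > 0 and the lower
  -- tail for t < 0.
  set h : α → ℝ := fun x => 1 + A.indicator (fun _ => Real.exp t - 1) x with hh
  have hexp : ∀ x, h x = Real.exp (t * A.indicator (fun _ => 1) x) := by
    intro x
    by_cases hx : x ∈ A <;> simp [hh, hx]
  have hprod : ∀ X : Fin n → α, ∏ i, h (X i) =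
      Real.exp (t * (Finset.univ.filter fun i => X i ∈ A).card) := by
    intro X
    simp only [hexp]
    rw [← Real.exp_sum, ← Finset.mul_sum]
    simp [Set.indicator_apply]
  have hint : Integrable (fun X : Fin n → α => ∏ i, h (X i)) ν := by
    refine Integrable.fintype_prod (f := fun _ => h) fun _ => ?_
    exact (integrable_const _).add ((integrable_const _).indicator hA)
  have hval : ∫ X : Fin n → α, ∏ i, h (X i) ∂ν ≤
      Real.exp (n * μ.real A * (Real.exp t - 1)) := by
    rw [integral_fintype_prod_eq_prod (fun _ : Fin n => h) (μ := fun _ => μ)]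
    have h1 : ∫ x, h x ∂μ = 1 + μ.real A * (Real.exp t - 1) := by
      rw [hh, integral_add (integrable_const _) ((integrable_const _).indicator hA),
        integral_indicator hA]
      simp
    rw [Finset.prod_const, h1, Finset.card_univ, Fintype.card_fin, mul_assoc, mul_comm (n : ℝ),
      Real.exp_mul, Real.rpow_natCast]
    refine pow_le_pow_left₀ ?_ (by linarith [Real.add_one_le_exp (μ.real A * (Real.exp t - 1))]) n
    have h2 : μ.real A ≤ 1 := measureReal_le_one
    have h3 : 0 ≤ μ.real A := measureReal_nonneg
    nlinarith [Real.exp_pos t]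
  have hmarkov := mul_meas_ge_le_integral_of_nonneg (μ := ν)
    (Eventually.of_forall fun X => Finset.prod_nonneg fun i _ => by rw [hexp]; positivity)
    hint (Real.exp (t * s))
  have hset : {X : Fin n → α | Real.exp (t * s) ≤ ∏ i, h (X i)} =
      {X | t * s ≤ t * (Finset.univ.filter fun i => X i ∈ A).card} := by
    ext X
    simp only [Set.mem_ofPred_eq, hprod, Real.exp_le_exp]
  rw [hset] at hmarkov
  rw [Real.exp_sub, le_div_iff₀ (Real.exp_pos _), mul_comm]
  exact hmarkov.trans hval

open Classical in
-- Take t = 1 in Chernoff's bound and use e - 1 ≤ 2.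
theorem count_ge_le (hA : MeasurableSet A) (n : ℕ) (s : ℝ) :
    (Measure.pi fun _ : Fin n => μ)
      {X | s ≤ (Finset.univ.filter fun i => X i ∈ A).card} ≤
      ENNReal.ofReal (Real.exp (2 * (n * μ.real A) - s)) := by
  have h := count_tail_le μ hA n 1 s
  simp only [one_mul] at h
  rw [← ofReal_measureReal]
  refine ENNReal.ofReal_le_ofReal (h.trans (Real.exp_le_exp.2 ?_))
  have h1 : 0 ≤ n * μ.real A := by positivity
  nlinarith [Real.exp_one_lt_d9]

open Classical in
-- Take t = -1 in Chernoff's bound and use 1/e - 1 ≤ -1/2.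
theorem count_le_le (hA : MeasurableSet A) (n : ℕ) (s : ℝ) :
    (Measure.pi fun _ : Fin n => μ)
      {X | ((Finset.univ.filter fun i => X i ∈ A).card : ℝ) ≤ s} ≤
      ENNReal.ofReal (Real.exp (s - n * μ.real A / 2)) := by
  have h := count_tail_le μ hA n (-1) s
  simp only [neg_mul, one_mul, neg_le_neg_iff] at h
  rw [← ofReal_measureReal]
  refine ENNReal.ofReal_le_ofReal (h.trans (Real.exp_le_exp.2 ?_))
  have h1 : 0 ≤ n * μ.real A := by positivity
  have h2 : Real.exp (-1) ≤ 1 / 2 := by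
    rw [Real.exp_neg, inv_le_comm₀ (Real.exp_pos _) (by norm_num)]
    linarith [Real.exp_one_gt_d9]
  nlinarith

end Chernoff

/-! ### Areas of cells and strips under the uniform law. -/

section UniformLaw

theorem volume_box (a b : Fin 2 → ℝ) :
    volume {x : Plane | ∀ k, x k ∈ Set.Ico (a k) (b k)} = ∏ k, ENNReal.ofReal (b k - a k) := by
  rw [← Real.volume_pi_Ico, ← (EuclideanSpace.volume_preserving_symm_measurableEquiv_toLp
    (Fin 2)).measure_preimage (MeasurableSet.univ_pi fun k => measurableSet_Ico).nullMeasurableSet]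
  congr 1
  ext x
  simp [Set.mem_pi]

theorem measurable_coord (k : Fin 2) : Measurable fun x : Plane => x k := by fun_prop

theorem measurableSet_unitSquare : MeasurableSet unitSquare := by
  have : unitSquare = ⋂ k, {x : Plane | x k ∈ Set.Ico 0 1} := by
    ext x; simp [unitSquare]
  rw [this]
  exact MeasurableSet.iInter fun k => measurable_coord k measurableSet_Ico

theorem volume_unitSquare : volume unitSquare = 1 := by
  have := volume_box (fun _ => 0) (fun _ => 1)
  simpa [unitSquare] using this

instance : IsProbabilityMeasure (uniformLaw unitSquare) :=
  ProbabilityTheory.cond_isProbabilityMeasure_of_finite (by rw [volume_unitSquare]; simp)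
    (by rw [volume_unitSquare]; simp)

theorem uniformLaw_unitSquare_apply (A : Set Plane) :
    uniformLaw unitSquare A = volume (unitSquare ∩ A) := by
  rw [uniformLaw, ProbabilityTheory.cond_apply measurableSet_unitSquare, volume_unitSquare]
  simp

theorem uniformLaw_real_eq {A : Set Plane} {a b : Fin 2 → ℝ} (hab : ∀ k, a k ≤ b k)
    (hA : unitSquare ∩ A = {x : Plane | ∀ k, x k ∈ Set.Ico (a k) (b k)}) :
    (uniformLaw unitSquare).real A = ∏ k, (b k - a k) := by
  rw [measureReal_def, uniformLaw_unitSquare_apply, hA, volume_box,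
    ← ENNReal.ofReal_prod_of_nonneg fun k _ => sub_nonneg.2 (hab k),
    ENNReal.toReal_ofReal (Finset.prod_nonneg fun k _ => sub_nonneg.2 (hab k))]

/-- The region of the cell with the given index. -/
def cellRegion (N : ℕ) (a b : ℤ) : Set Plane :=
  {x | cellIdx N (x 0) = a ∧ cellIdx N (x 1) = b}

theorem measurableSet_cellRegion (N : ℕ) (a b : ℤ) : MeasurableSet (cellRegion N a b) :=
  ((measurable_cellIdx N).comp (measurable_coord 0) (measurableSet_singleton a)).inter
    ((measurable_cellIdx N).comp (measurable_coord 1) (measurableSet_singleton b))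

theorem cellIdx_eq_iff {N : ℕ} (hN : 0 < N) {x : ℝ} {a : ℤ} (ha : 0 ≤ a) (ha' : a < N) :
    ((0 ≤ x ∧ x < 1) ∧ cellIdx N x = a) ↔ ((a : ℝ) / N ≤ x ∧ x < (a + 1) / N) := by
  have hN' : (0 : ℝ) < N := by exact_mod_cast hN
  have ha0 : (0 : ℝ) ≤ a := by exact_mod_cast ha
  have ha1 : (a : ℝ) + 1 ≤ N := by exact_mod_cast ha'
  have key : 0 ≤ x → x < 1 → cellIdx N x = ⌊(N : ℝ) * x⌋ := by
    intro h0 h1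
    refine Int.emod_eq_of_lt (Int.floor_nonneg.2 (by positivity)) (Int.floor_lt.2 ?_)
    push_cast
    nlinarith
  rw [div_le_iff₀ hN', lt_div_iff₀ hN']
  constructor
  · rintro ⟨⟨h0, h1⟩, h2⟩
    rw [key h0 h1, Int.floor_eq_iff] at h2
    constructor <;> linarith
  · rintro ⟨h1, h2⟩
    have h3 : 0 ≤ x := by
      by_contra h; push Not at h; nlinarith
    have h4 : x < 1 := by
      by_contra h; push Not at h; nlinarith
    refine ⟨⟨h3, h4⟩, ?_⟩
    rw [key h3 h4, Int.floor_eq_iff]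
    constructor <;> linarith

theorem uniformLaw_cellRegion {N : ℕ} (hN : 0 < N) {a b : ℤ} (ha : 0 ≤ a) (ha' : a < N)
    (hb : 0 ≤ b) (hb' : b < N) :
    (uniformLaw unitSquare).real (cellRegion N a b) = 1 / (N : ℝ) ^ 2 := by
  have hN' : (0 : ℝ) < N := by exact_mod_cast hN
  rw [uniformLaw_real_eq (a := fun k => ((![a, b] k : ℤ) : ℝ) / N)
    (b := fun k => (((![a, b] k : ℤ) : ℝ) + 1) / N)]
  · simp only [Fin.prod_univ_two]
    field_simp
    simp
  · intro k
    gcongr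
    linarith
  · ext x
    have h0 := cellIdx_eq_iff hN (x := x 0) ha ha'
    have h1 := cellIdx_eq_iff hN (x := x 1) hb hb'
    simp only [unitSquare, cellRegion, Set.mem_inter_iff, Set.mem_ofPred_eq, Fin.forall_fin_two,
      Set.mem_Ico, Matrix.cons_val_zero, Matrix.cons_val_one]
    tauto

theorem uniformLaw_strip {a b : ℝ} (ha : 0 ≤ a) (hab : a ≤ b) (hb : b ≤ 1) :
    (uniformLaw unitSquare).real {x | Int.fract (x 0) ∈ Set.Ico a b} = b - a := by
  rw [uniformLaw_real_eq (a := ![a, 0]) (b := ![b, 1])]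
  · simp
  · intro k; fin_cases k <;> simp [hab]
  · ext x
    simp only [unitSquare, Set.mem_inter_iff, Set.mem_ofPred_eq, Fin.forall_fin_two,
      Set.mem_Ico, Matrix.cons_val_zero, Matrix.cons_val_one]
    constructor
    · rintro ⟨⟨⟨h1, h2⟩, h3⟩, h4⟩
      rw [Int.fract_eq_self.2 ⟨h1, h2⟩] at h4
      exact ⟨h4, h3⟩
    · rintro ⟨h4, h3⟩
      have h1 : 0 ≤ x 0 ∧ x 0 < 1 := ⟨ha.trans h4.1, h4.2.trans_le hb⟩
      rw [Int.fract_eq_self.2 h1]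
      exact ⟨⟨h1, h3⟩, h4⟩

theorem measurableSet_strip (a b : ℝ) :
    MeasurableSet {x : Plane | Int.fract (x 0) ∈ Set.Ico a b} :=
  (measurable_fract.comp (measurable_coord 0)) measurableSet_Ico

end UniformLaw

/-! ### The move preserves the uniform law on the torus. -/

section Move

theorem exists_intVec_of_mem_span {x : Plane}
    (hx : x ∈ Submodule.span ℤ (Set.range (EuclideanSpace.basisFun (Fin 2) ℝ).toBasis)) :
    ∃ m, x = intVec m := by
  induction hx using Submodule.span_induction with
  | mem x h =>
    obtain ⟨k, rfl⟩ := h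
    refine ⟨Pi.single k 1, ?_⟩
    ext j
    by_cases hjk : j = k
    · subst hjk; simp [intVec]
    · simp [intVec, hjk]
  | zero => exact ⟨0, by ext k; simp [intVec]⟩
  | add x y _ _ hx hy =>
    obtain ⟨m, rfl⟩ := hx
    obtain ⟨m', rfl⟩ := hy
    exact ⟨m + m', (intVec_add m m').symm⟩
  | smul c x _ hx =>
    obtain ⟨m, rfl⟩ := hx
    exact ⟨c • m, by ext k; simp [intVec]⟩

theorem fundamentalDomain_eq_unitSquare :
    ZSpan.fundamentalDomain (EuclideanSpace.basisFun (Fin 2) ℝ).toBasis = unitSquare := by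
  ext x
  rw [ZSpan.mem_fundamentalDomain]
  simp [unitSquare]

open scoped Pointwise in
/-- The area of a periodic set within the unit square does not change under translations. -/
theorem volume_unitSquare_inter_shift {A : Set Plane} (hA : MeasurableSet A)
    (hinv : ∀ x m, x + intVec m ∈ A ↔ x ∈ A) (u : Plane) :
    volume (unitSquare ∩ {x | x + u ∈ A}) = volume (unitSquare ∩ A) := by
  have hF := ZSpan.isAddFundamentalDomain (EuclideanSpace.basisFun (Fin 2) ℝ).toBasis
    (volume : Measure Plane)
  rw [fundamentalDomain_eq_unitSquare] at hF
  have : VAddInvariantMeasure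
      (Submodule.span ℤ (Set.range (EuclideanSpace.basisFun (Fin 2) ℝ).toBasis)) Plane volume :=
    ⟨fun c s _ => measure_preimage_add volume c.1 s⟩
  have hF' := hF.vadd_of_comm u
  -- The unit square and its translate by u are both fundamental domains of the integer lattice, so
  -- a periodic set has the same area in each.
  have h1 := hF.measure_set_eq hF' hA (by
    rintro ⟨g, hg⟩
    obtain ⟨m, rfl⟩ := exists_intVec_of_mem_span hg
    ext x
    rw [← hinv x m, add_comm]
    rfl)
  rw [Set.inter_comm unitSquare A, h1, ← measure_preimage_add_right volume u (A ∩ (u +ᵥ unitSquare))]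
  congr 1
  ext x
  simp only [Set.mem_inter_iff, Set.mem_preimage, Set.mem_ofPred_eq, Set.mem_vadd_set,
    vadd_eq_add]
  constructor
  · rintro ⟨h1, h2⟩
    exact ⟨h2, x, h1, add_comm _ _⟩
  · rintro ⟨h2, y, h1, h3⟩
    rw [add_comm] at h3
    obtain rfl := add_right_cancel h3
    exact ⟨h1, h2⟩

/-- The representative of a point in the unit square. -/
def reduce (x : Plane) : Plane := x + intVec fun k => -⌊x k⌋

theorem reduce_apply (x : Plane) (k : Fin 2) : reduce x k = Int.fract (x k) := by
  rw [Int.fract, sub_eq_add_neg, ← Int.cast_neg]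
  rfl

theorem measurable_reduce : Measurable reduce := by
  have : reduce = fun x => WithLp.toLp 2 fun k => Int.fract (x k) := by
    funext x; ext k; rw [reduce_apply]
  rw [this]
  refine (MeasurableEquiv.toLp 2 (Fin 2 → ℝ)).measurable.comp (measurable_pi_lambda _ fun k => ?_)
  exact measurable_fract.comp (measurable_coord k)

theorem reduce_add_intVec (x : Plane) (m : Fin 2 → ℤ) : reduce (x + intVec m) = reduce x := by
  ext k
  rw [reduce_apply, reduce_apply]
  simp [intVec]

theorem reduce_of_mem {x : Plane} (hx : x ∈ unitSquare) : reduce x = x := by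
  ext k
  rw [reduce_apply]
  exact Int.fract_eq_self.2 (hx k)

theorem measurePreserving_reduce_add (u : Plane) :
    MeasurePreserving (fun x => reduce (x + u)) (uniformLaw unitSquare)
      (uniformLaw unitSquare) := by
  have hm : Measurable fun x => reduce (x + u) := measurable_reduce.comp (measurable_add_const u)
  refine ⟨hm, ?_⟩
  ext B hB
  rw [Measure.map_apply hm hB,
    uniformLaw_unitSquare_apply, uniformLaw_unitSquare_apply]
  have := volume_unitSquare_inter_shift (A := reduce ⁻¹' B) (measurable_reduce hB)
    (fun x m => by rw [Set.mem_preimage, reduce_add_intVec, Set.mem_preimage]) u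
  refine Eq.trans this ?_
  congr 1
  ext x
  simp only [Set.mem_inter_iff, Set.mem_preimage]
  exact and_congr_right fun hx => by rw [reduce_of_mem hx]

variable {n : ℕ} {v : ℝ}

instance (n : ℕ) : IsProbabilityMeasure (initialLaw n) := by
  unfold initialLaw; infer_instance

/-- Translating independent uniform points on the torus does not change their law. -/
theorem initialLaw_shift {E : Set (Fin n → Plane)} (hE : MeasurableSet E)
    (hinv : ∀ X (m : Fin n → Fin 2 → ℤ), (fun i => X i + intVec (m i)) ∈ E ↔ X ∈ E)
    (U : Fin n → Plane) : initialLaw n {X | (fun i => X i + U i) ∈ E} = initialLaw n E := by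
  have h := measurePreserving_pi (fun _ : Fin n => uniformLaw unitSquare)
    (fun _ => uniformLaw unitSquare) fun i => measurePreserving_reduce_add (U i)
  have h1 := h.measure_preimage hE.nullMeasurableSet
  rw [initialLaw, ← h1]
  congr 1
  ext X
  exact (hinv (fun i => X i + U i) _).symm

theorem volume_closedBall_pos (x : Plane) (hv : 0 < v) : volume (Metric.closedBall x v) ≠ 0 :=
  (Metric.measure_closedBall_pos volume x hv).ne'

theorem volume_closedBall_ne_top (x : Plane) : volume (Metric.closedBall x v) ≠ ⊤ :=
  measure_closedBall_lt_top.ne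

theorem isProbabilityMeasure_uniformLaw_closedBall (x : Plane) (hv : 0 < v) :
    IsProbabilityMeasure (uniformLaw (Metric.closedBall x v)) :=
  ProbabilityTheory.cond_isProbabilityMeasure_of_finite (volume_closedBall_pos x hv)
    (volume_closedBall_ne_top x)

theorem isProbabilityMeasure_moveLaw (X : Fin n → Plane) (hv : 0 < v) :
    IsProbabilityMeasure (moveLaw v X) := by
  have := fun i => isProbabilityMeasure_uniformLaw_closedBall (X i) hv
  unfold moveLaw
  infer_instance

theorem uniformLaw_closedBall_eq_map (x : Plane) :
    uniformLaw (Metric.closedBall x v) =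
      (uniformLaw (Metric.closedBall 0 v)).map fun u => x + u := by
  ext A hA
  rw [Measure.map_apply (measurable_const_add x) hA, uniformLaw, uniformLaw,
    ProbabilityTheory.cond_apply measurableSet_closedBall,
    ProbabilityTheory.cond_apply measurableSet_closedBall]
  have h1 : (fun u => x + u) ⁻¹' Metric.closedBall x v = Metric.closedBall 0 v := by
    ext u; simp
  rw [← h1, ← Set.preimage_inter, measure_preimage_add, measure_preimage_add]

/-- The displacement of a node has a law that does not depend on its starting point, so the move
adds an independent random vector. -/
theorem moveLaw_eq_map (X : Fin n → Plane) (hv : 0 < v) :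
    moveLaw v X = (moveLaw v fun _ : Fin n => (0 : Plane)).map fun U i => X i + U i := by
  have := isProbabilityMeasure_uniformLaw_closedBall 0 hv
  have hp : ∀ i, IsProbabilityMeasure
      ((uniformLaw (Metric.closedBall 0 v)).map fun u => X i + u) := fun i =>
    Measure.isProbabilityMeasure_map (measurable_const_add (X i)).aemeasurable
  unfold moveLaw
  rw [Measure.pi_map_pi (f := fun i u => X i + u)
    fun i => (measurable_const_add (X i)).aemeasurable]
  simp only [← uniformLaw_closedBall_eq_map]

theorem moveLaw_apply (X : Fin n → Plane) (hv : 0 < v) {E : Set (Fin n → Plane)}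
    (hE : MeasurableSet E) :
    moveLaw v X E = moveLaw v (fun _ : Fin n => (0 : Plane)) {U | (fun i => X i + U i) ∈ E} := by
  rw [moveLaw_eq_map X hv, Measure.map_apply (by fun_prop) hE]
  rfl

theorem measurable_moveLaw_apply (hv : 0 < v) {E : Set (Fin n → Plane)} (hE : MeasurableSet E) :
    Measurable fun X : Fin n → Plane => moveLaw v X E := by
  have := isProbabilityMeasure_moveLaw (fun _ : Fin n => (0 : Plane)) hv
  simp only [moveLaw_apply _ hv hE]
  have hm : Measurable fun p : (Fin n → Plane) × (Fin n → Plane) => fun i => p.1 i + p.2 i := by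
    fun_prop
  exact measurable_measure_prodMk_left (hm hE)

/-- After the move, the nodes are again independent and uniform on the torus. -/
theorem lintegral_moveLaw (hv : 0 < v) {E : Set (Fin n → Plane)} (hE : MeasurableSet E)
    (hinv : ∀ X (m : Fin n → Fin 2 → ℤ), (fun i => X i + intVec (m i)) ∈ E ↔ X ∈ E) :
    ∫⁻ X, moveLaw v X E ∂(initialLaw n) = initialLaw n E := by
  have := isProbabilityMeasure_moveLaw (fun _ : Fin n => (0 : Plane)) hv
  simp only [moveLaw_apply _ hv hE]
  have hm : Measurable fun p : (Fin n → Plane) × (Fin n → Plane) => fun i => p.1 i + p.2 i := by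
    fun_prop
  have h1 := Measure.prod_apply (μ := initialLaw n)
    (ν := moveLaw v fun _ : Fin n => (0 : Plane)) (hm hE)
  -- By Fubini the displacements may be fixed first; for fixed displacements the move is a
  -- translation, which preserves the law of periodic events.
  have h2 := Measure.prod_apply_symm (μ := initialLaw n)
    (ν := moveLaw v fun _ : Fin n => (0 : Plane)) (hm hE)
  refine h1.symm.trans (h2.trans ?_)
  have h3 : ∀ U : Fin n → Plane, initialLaw n ((fun X => (X, U)) ⁻¹'
      ((fun p : (Fin n → Plane) × (Fin n → Plane) => fun i => p.1 i + p.2 i) ⁻¹' E)) =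
      initialLaw n E := fun U => initialLaw_shift hE hinv U
  simp only [h3, lintegral_const, measure_univ, mul_one]

/-- If an event is unlikely for uniform nodes, then for most initial positions it is unlikely
after the move. -/
theorem initialLaw_moveLaw_ge_le (hv : 0 < v) {E : Set (Fin n → Plane)} (hE : MeasurableSet E)
    (hinv : ∀ X (m : Fin n → Fin 2 → ℤ), (fun i => X i + intVec (m i)) ∈ E ↔ X ∈ E)
    {ε : ENNReal} (h0 : ε ≠ 0) (h1 : ε ≠ ⊤) :
    initialLaw n {X | ε ≤ moveLaw v X E} ≤ initialLaw n E / ε := by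
  rw [← lintegral_moveLaw hv hE hinv]
  exact meas_ge_le_lintegral_div (measurable_moveLaw_apply hv hE).aemeasurable h0 h1

end Move

/-! ### From cuts and degrees to conductance. -/

section Conductance

variable {n : ℕ} {r v : ℝ}

/-- The conductance of the node set `S` in the graph on the positions `Y`. -/
def setConductance (r : ℝ) (S : Finset (Fin n)) (Y : Fin n → Plane) : ℝ :=
  (∑ i ∈ S, ∑ j ∈ Sᶜ, contactProb r Y i j) / (S.card : ℝ)

theorem setConductance_nonneg (S : Finset (Fin n)) (Y : Fin n → Plane) :
    0 ≤ setConductance r S Y :=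
  div_nonneg (Finset.sum_nonneg fun _ _ => Finset.sum_nonneg fun _ _ => contactProb_nonneg _ _ _)
    (Nat.cast_nonneg _)

theorem setConductance_le_one (S : Finset (Fin n)) (Y : Fin n → Plane) :
    setConductance r S Y ≤ 1 := by
  refine div_le_one_of_le₀ ?_ (Nat.cast_nonneg _)
  calc _ ≤ ∑ i ∈ S, (1 : ℝ) := Finset.sum_le_sum fun i _ => sum_contactProb_le_one Y i _
    _ = _ := by simp

theorem measurable_setConductance (S : Finset (Fin n)) :
    Measurable (setConductance r S) := by
  have h : Measurable fun Y : Fin n → Plane => ∑ i ∈ S, ∑ j ∈ Sᶜ, contactProb r Y i j :=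
    Finset.measurable_sum _ fun i _ => Finset.measurable_sum _ fun j _ =>
      measurable_contactProb i j
  exact h.div_const _

theorem setConductance_add_intVec (S : Finset (Fin n)) (Y : Fin n → Plane)
    (m : Fin n → Fin 2 → ℤ) :
    setConductance r S (fun i => Y i + intVec (m i)) = setConductance r S Y := by
  unfold setConductance
  simp only [contactProb_add_intVec]

theorem integrable_setConductance (S : Finset (Fin n)) (μ : Measure (Fin n → Plane))
    [IsFiniteMeasure μ] : Integrable (setConductance r S) μ :=
  Integrable.of_bound (measurable_setConductance S).aestronglyMeasurable 1
    (Eventually.of_forall fun Y => by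
      rw [Real.norm_of_nonneg (setConductance_nonneg S Y)]; exact setConductance_le_one S Y)

theorem mobileConductance_le (X : Fin n → Plane) {S : Finset (Fin n)}
    (hS : S.Nonempty) (hSn : 2 * S.card ≤ n) :
    mobileConductance r v X ≤ ∫ Y, setConductance r S Y ∂(moveLaw v X) := by
  refine ciInf_le (f := fun S : {S : Finset (Fin n) // S.Nonempty ∧ 2 * S.card ≤ n} =>
    ∫ Y, setConductance r S.1 Y ∂(moveLaw v X)) ⟨0, ?_⟩ ⟨S, hS, hSn⟩
  rintro _ ⟨S, rfl⟩
  exact integral_nonneg fun Y => setConductance_nonneg _ _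

theorem le_mobileConductance (hn : 2 ≤ n) (X : Fin n → Plane) {c : ℝ}
    (h : ∀ S : Finset (Fin n), S.Nonempty → 2 * S.card ≤ n →
      c ≤ ∫ Y, setConductance r S Y ∂(moveLaw v X)) : c ≤ mobileConductance r v X := by
  have : Nonempty {S : Finset (Fin n) // S.Nonempty ∧ 2 * S.card ≤ n} :=
    ⟨⟨{⟨0, by omega⟩}, by simp, by simpa using hn⟩⟩
  exact le_ciInf fun S => h S.1 S.2.1 S.2.2

/-- The positions at which every admissible node set has conductance at least `c`. -/
def expandingPositions (n : ℕ) (r c : ℝ) : Set (Fin n → Plane) :=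
  {Y | ∀ S : Finset (Fin n), S.Nonempty → 2 * S.card ≤ n → c ≤ setConductance r S Y}

theorem measurableSet_expandingPositions (n : ℕ) (r c : ℝ) :
    MeasurableSet (expandingPositions n r c) := by
  have : expandingPositions n r c = ⋂ S : {S : Finset (Fin n) // S.Nonempty ∧ 2 * S.card ≤ n},
      {Y | c ≤ setConductance r S.1 Y} := by
    ext Y
    simp [expandingPositions]
  rw [this]
  exact MeasurableSet.iInter fun S =>
    measurableSet_le measurable_const (measurable_setConductance S.1)

theorem expandingPositions_add_intVec (c : ℝ) (X : Fin n → Plane) (m : Fin n → Fin 2 → ℤ) :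
    (fun i => X i + intVec (m i)) ∈ expandingPositions n r c ↔ X ∈ expandingPositions n r c := by
  simp only [expandingPositions, Set.mem_ofPred_eq, setConductance_add_intVec]

/-- The good event treats all sets simultaneously, has probability at least 1/2 and gives each set
conductance at least c; off it, conductances are nonnegative. -/
theorem half_le_mobileConductance (hn : 2 ≤ n) (hv : 0 < v) {X : Fin n → Plane} {c : ℝ}
    (hc : 0 ≤ c) (h : moveLaw v X (expandingPositions n r c)ᶜ < 1 / 2) :
    c / 2 ≤ mobileConductance r v X := by
  have := isProbabilityMeasure_moveLaw X hv
  refine le_mobileConductance hn X fun S hS hSn => ?_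
  have hE := measurableSet_expandingPositions n r c
  have h1 : 1 / 2 ≤ (moveLaw v X).real (expandingPositions n r c) := by
    have h2 := probReal_add_probReal_compl (μ := moveLaw v X) hE
    have h3 : (moveLaw v X).real (expandingPositions n r c)ᶜ ≤ 1 / 2 := by
      rw [measureReal_def]
      refine ENNReal.toReal_le_of_le_ofReal (by norm_num) (h.le.trans ?_)
      rw [ENNReal.ofReal_div_of_pos (by norm_num)]
      simp
    linarith
  calc c / 2 ≤ ∫ Y, (expandingPositions n r c).indicator (fun _ => c) Y ∂(moveLaw v X) := by
        rw [integral_indicator hE]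
        simp only [integral_const, smul_eq_mul, measureReal_restrict_apply_univ]
        nlinarith
    _ ≤ _ := by
        refine integral_mono ((integrable_const c).indicator hE)
          (integrable_setConductance S _) fun Y => ?_
        by_cases hY : Y ∈ expandingPositions n r c
        · rw [Set.indicator_of_mem hY]
          exact hY S hS hSn
        · rw [Set.indicator_of_notMem hY]
          exact setConductance_nonneg S Y

/-- Each cut pair is a contact of probability at least 1/d when the degrees are at most d. -/
theorem card_cutPairs_div_le {Y : Fin n → Plane} {d : ℝ}
    (hd : ∀ i, (((geometricGraph r Y).neighborSet i).ncard : ℝ) ≤ d) (S : Finset (Fin n)) :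
    (cutPairs (geometricGraph r Y) S).card / d ≤ ∑ i ∈ S, ∑ j ∈ Sᶜ, contactProb r Y i j := by
  have h1 : ∀ p ∈ cutPairs (geometricGraph r Y) S, 1 / d ≤ contactProb r Y p.1 p.2 :=
    fun p hp => contactProb_ge (hd p.1) (mem_cutPairs.1 hp).2.2
  have h2 : cutPairs (geometricGraph r Y) S ⊆ S ×ˢ Sᶜ := by
    intro p hp
    rw [mem_cutPairs] at hp
    exact Finset.mem_product.2 ⟨hp.1, Finset.mem_compl.2 hp.2.1⟩
  calc (cutPairs (geometricGraph r Y) S).card / d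
      = ∑ p ∈ cutPairs (geometricGraph r Y) S, 1 / d := by
        rw [Finset.sum_const, nsmul_eq_mul, mul_one_div]
    _ ≤ ∑ p ∈ cutPairs (geometricGraph r Y) S, contactProb r Y p.1 p.2 := Finset.sum_le_sum h1
    _ ≤ ∑ p ∈ S ×ˢ Sᶜ, contactProb r Y p.1 p.2 :=
        Finset.sum_le_sum_of_subset_of_nonneg h2 fun _ _ _ => contactProb_nonneg _ _ _
    _ = _ := Finset.sum_product _ _ _

/-- A geometric graph that is connected and has few bad cells expands. -/
theorem mem_expandingPositions {X : Fin n → Plane} {M L K : ℕ} {u g Z : ℝ}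
    (hconn : (geometricGraph r X).Connected) (hM : (K + 1) * 5 ≤ M) (hL : 0 < L)
    (hr1 : 4 ≤ ((M * L : ℕ) : ℝ) * r) (hr2 : ((M * L : ℕ) : ℝ) * r ≤ 5)
    (hu : ∀ a b, ((nodesInCell (M * L) X a b).card : ℝ) ≤ u) (hu0 : 0 < u) (hg : 0 < g)
    (hbad : ∀ p q : ℤ, 0 ≤ p → p < L → 0 ≤ q → q < L → (badCells (M * L) M
      (fun i => cellIdx (M * L) (X i 0)) (fun i => cellIdx (M * L) (X i 1)) g p q).card ≤ K)
    (hZ1 : 2 * ((2 * (2 * M : ℕ) + 1) ^ 2 * u) ≤ Z)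
    (hZ2 : 16 * (M ^ 2 * u) ^ 2 * L ^ 3 / (g ^ 2 / 4 * n) ≤ Z) :
    X ∈ expandingPositions n r (1 / (121 * u * Z)) := by
  intro S hS hSn
  have hN : 0 < M * L := Nat.mul_pos (by omega) hL
  have hn : 0 < Fintype.card (Fin n) := by
    obtain ⟨i, _⟩ := hS
    exact Fintype.card_pos_iff.2 ⟨i⟩
  have h1 := card_le_cutPairs_of_few_badCells (S := S) hconn (D := 5) (by norm_num)
    (by exact_mod_cast hM) (fun i => ⟨cellIdx_nonneg hN _, cellIdx_lt hN _⟩)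
    (fun i => ⟨cellIdx_nonneg hN _, cellIdx_lt hN _⟩) (adj_of_mem_nodesInCell hN hr1)
    (exists_cell_of_adj hN (by exact_mod_cast hr2)) hg hu hbad (by simpa using hSn) hn
  rw [Fintype.card_fin] at h1
  have hS0 : (0 : ℝ) < S.card := by exact_mod_cast hS.card_pos
  have h2 : (S.card : ℝ) ≤ Z * (cutPairs (geometricGraph r X) S).card :=
    h1.trans (mul_le_mul_of_nonneg_right (max_le hZ1 hZ2) (Nat.cast_nonneg _))
  have hZ : 0 < Z := lt_of_lt_of_le (by positivity) hZ1
  -- Edges span at most 5 cells, so degrees are at most 121 u, with 121 = (2 · 5 + 1)².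
  have h3 := card_cutPairs_div_le (fun i => ncard_neighborSet_le hN (D := 5)
    (by exact_mod_cast hr2) hu i) S
  refine le_trans ?_ (div_le_div_of_nonneg_right h3 hS0.le)
  norm_num
  rw [le_div_iff₀ hS0, le_div_iff₀ (by positivity)]
  calc _ = (S.card : ℝ) / Z := by field_simp
    _ ≤ _ := by rw [div_le_iff₀ hZ]; linarith

end Conductance

/-! ### Union bounds for overfull and sparse cells. -/

section CellCounts

variable {n : ℕ}

theorem mem_nodesInCell_iff {N : ℕ} {X : Fin n → Plane} {a b : ℤ} {i : Fin n} :
    i ∈ nodesInCell N X a b ↔ X i ∈ cellRegion N (a % N) (b % N) := by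
  rw [mem_nodesInCell]
  unfold Int.ModEq cellRegion cellIdx
  simp only [Int.emod_emod, Set.mem_ofPred_eq]

theorem measure_le_card_mul {α ι : Type*} [MeasurableSpace α] {μ : Measure α} {E : Set α}
    (T : Finset ι) (F : ι → Set α) (hE : E ⊆ ⋃ t ∈ T, F t) {x : ℝ}
    (hF : ∀ t ∈ T, μ (F t) ≤ ENNReal.ofReal x) : μ E ≤ ENNReal.ofReal (T.card * x) := by
  calc μ E ≤ μ (⋃ t ∈ T, F t) := measure_mono hE
    _ ≤ ∑ t ∈ T, μ (F t) := measure_biUnion_finset_le _ _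
    _ ≤ ∑ t ∈ T, ENNReal.ofReal x := Finset.sum_le_sum hF
    _ = _ := by
      rw [Finset.sum_const, nsmul_eq_mul, ENNReal.ofReal_mul (Nat.cast_nonneg _),
        ENNReal.ofReal_natCast]

theorem emod_mem_range {N : ℕ} (hN : 0 < N) (a : ℤ) : 0 ≤ a % N ∧ a % N < N :=
  ⟨Int.emod_nonneg _ (by exact_mod_cast hN.ne'), Int.emod_lt_of_pos _ (by exact_mod_cast hN)⟩

/-- No cell of a grid receives too many nodes. -/
theorem initialLaw_cell_overfull_le {N : ℕ} (hN : 0 < N) (u : ℝ) :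
    initialLaw n {X | ¬ ∀ a b, ((nodesInCell N X a b).card : ℝ) ≤ u} ≤
      ENNReal.ofReal (N ^ 2 * Real.exp (2 * (n / N ^ 2) - u)) := by
  classical
  set J := Finset.Ico (0 : ℤ) N
  have hcard : (((J ×ˢ J).card : ℕ) : ℝ) = N ^ 2 := by
    rw [Finset.card_product]; simp [J, sq]
  refine (measure_le_card_mul (J ×ˢ J) (x := Real.exp (2 * (n / N ^ 2) - u))
    (fun w => {X | u ≤ (Finset.univ.filter
    fun i => X i ∈ cellRegion N w.1 w.2).card}) ?_ ?_).trans_eq (by rw [hcard])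
  · intro X hX
    simp only [Set.mem_ofPred_eq, not_forall, not_le] at hX
    obtain ⟨a, b, hab⟩ := hX
    refine Set.mem_iUnion₂.2 ⟨(a % N, b % N), ?_, ?_⟩
    · exact Finset.mem_product.2 ⟨Finset.mem_Ico.2 (emod_mem_range hN a),
        Finset.mem_Ico.2 (emod_mem_range hN b)⟩
    · have : nodesInCell N X a b =
          Finset.univ.filter fun i => X i ∈ cellRegion N (a % N) (b % N) := by
        ext i; simp [mem_nodesInCell_iff]
      rw [this] at hab
      exact hab.le
  · intro w hw
    simp only [J, Finset.mem_product, Finset.mem_Ico] at hw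
    have h := count_ge_le (uniformLaw unitSquare) (measurableSet_cellRegion N w.1 w.2) n u
    rw [uniformLaw_cellRegion hN hw.1.1 hw.1.2 hw.2.1 hw.2.2, mul_one_div] at h
    exact h

/-- No cell of a grid receives too few nodes. -/
theorem initialLaw_cell_sparse_le {N : ℕ} (hN : 0 < N) (g : ℝ) :
    initialLaw n {X | ¬ ∀ a b, g ≤ ((nodesInCell N X a b).card : ℝ)} ≤
      ENNReal.ofReal (N ^ 2 * Real.exp (g - n / N ^ 2 / 2)) := by
  classical
  set J := Finset.Ico (0 : ℤ) N
  have hcard : (((J ×ˢ J).card : ℕ) : ℝ) = N ^ 2 := by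
    rw [Finset.card_product]; simp [J, sq]
  refine (measure_le_card_mul (J ×ˢ J) (x := Real.exp (g - n / N ^ 2 / 2))
    (fun w => {X | ((Finset.univ.filter
    fun i => X i ∈ cellRegion N w.1 w.2).card : ℝ) ≤ g}) ?_ ?_).trans_eq (by rw [hcard])
  · intro X hX
    simp only [Set.mem_ofPred_eq, not_forall, not_le] at hX
    obtain ⟨a, b, hab⟩ := hX
    refine Set.mem_iUnion₂.2 ⟨(a % N, b % N), ?_, ?_⟩
    · exact Finset.mem_product.2 ⟨Finset.mem_Ico.2 (emod_mem_range hN a),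
        Finset.mem_Ico.2 (emod_mem_range hN b)⟩
    · have : nodesInCell N X a b =
          Finset.univ.filter fun i => X i ∈ cellRegion N (a % N) (b % N) := by
        ext i; simp [mem_nodesInCell_iff]
      rw [this] at hab
      exact hab.le
  · intro w hw
    simp only [J, Finset.mem_product, Finset.mem_Ico] at hw
    have h := count_le_le (uniformLaw unitSquare) (measurableSet_cellRegion N w.1 w.2) n g
    rw [uniformLaw_cellRegion hN hw.1.1 hw.1.2 hw.2.1 hw.2.2, mul_one_div] at h
    exact h

theorem emod_injOn_Ico {N : ℕ} {s a b : ℤ} (ha : s ≤ a) (ha' : a < s + N) (hb : s ≤ b)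
    (hb' : b < s + N) (h : a % N = b % N) : a = b := by
  have h1 : (N : ℤ) ∣ b - a := (Int.modEq_iff_dvd).1 h
  have h2 := Int.eq_zero_of_abs_lt_dvd h1 (by rw [abs_lt]; constructor <;> omega)
  omega

/-- It is unlikely that a neighbourhood of a window contains more than `K` sparse cells. -/
theorem initialLaw_badCells_le {M L K : ℕ} {g : ℝ} (hM : 0 < M) (hL : 3 ≤ L) :
    initialLaw n {X | ¬ ∀ p q : ℤ, 0 ≤ p → p < L → 0 ≤ q → q < L → (badCells (M * L) M
      (fun i => cellIdx (M * L) (X i 0)) (fun i => cellIdx (M * L) (X i 1)) g p q).card ≤ K} ≤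
      ENNReal.ofReal (L ^ 2 * 2 ^ (9 * M ^ 2) * Real.exp ((K + 1) * g -
        (K + 1) * (n / ((M * L : ℕ) : ℝ) ^ 2) / 2)) := by
  classical
  set N := M * L with hNdef
  have hN : 0 < N := Nat.mul_pos hM (by omega)
  -- As L ≥ 3, a 3 × 3 block of windows does not wrap onto itself, so its cells are distinct on the
  -- torus and their areas add up.
  have hN3 : (3 : ℤ) * M ≤ N := by
    rw [hNdef]; push_cast; nlinarith
  set J := Finset.Ico (0 : ℤ) L
  set box : ℤ × ℤ → Finset (ℤ × ℤ) := fun w => Finset.Ico (M * (w.1 - 1)) (M * (w.1 + 2)) ×ˢ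
    Finset.Ico (M * (w.2 - 1)) (M * (w.2 + 2))
  have hside : ∀ p : ℤ, (M : ℤ) * (p + 2) = M * (p - 1) + 3 * M := fun p => by ring
  have hbox : ∀ w, (box w).card = 9 * M ^ 2 := by
    intro w
    simp only [box, Finset.card_product, hside, Int.card_Ico, add_sub_cancel_left]
    have : ((3 : ℤ) * M).toNat = 3 * M := by omega
    rw [this]; ring
  -- More than `K` sparse cells near a window means that some K + 1 cells there have together at
  -- most (K + 1) g nodes. The union bound runs over these sets of cells; each block has at most
  -- 2^(9M²) of them.
  set T := (J ×ˢ J).sigma fun w => (box w).powersetCard (K + 1)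
  have hT : (T.card : ℝ) ≤ L ^ 2 * 2 ^ (9 * M ^ 2) := by
    have : T.card ≤ L ^ 2 * 2 ^ (9 * M ^ 2) := by
      rw [Finset.card_sigma]
      calc _ ≤ ∑ w ∈ J ×ˢ J, 2 ^ (9 * M ^ 2) := by
            refine Finset.sum_le_sum fun w _ => ?_
            rw [← hbox w, ← Finset.card_powerset]
            exact Finset.card_le_card fun s hs =>
              Finset.mem_powerset.2 (Finset.mem_powersetCard.1 hs).1
        _ = _ := by
            rw [Finset.sum_const, Finset.card_product]
            simp [J, sq]
    exact_mod_cast this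
  set region : Finset (ℤ × ℤ) → Set Plane := fun B =>
    ⋃ w ∈ B, cellRegion N (w.1 % N) (w.2 % N)
  have hregion : ∀ B, MeasurableSet (region B) := fun B =>
    Finset.measurableSet_biUnion _ fun w _ => measurableSet_cellRegion _ _ _
  refine (measure_le_card_mul T (fun t => {X | ((Finset.univ.filter
    fun i => X i ∈ region t.2).card : ℝ) ≤ (K + 1) * g}) ?_ fun t ht => ?_ ).trans
    (ENNReal.ofReal_le_ofReal (mul_le_mul_of_nonneg_right hT (Real.exp_pos _).le))
  · intro X hX
    simp only [Set.mem_ofPred_eq, not_forall, not_le] at hX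
    obtain ⟨p, q, hp, hp', hq, hq', hcard⟩ := hX
    obtain ⟨B, hB, hBcard⟩ := Finset.exists_subset_card_eq (Nat.succ_le_of_lt hcard)
    refine Set.mem_iUnion₂.2 ⟨⟨(p, q), B⟩, ?_, ?_⟩
    · refine Finset.mem_sigma.2 ⟨?_, Finset.mem_powersetCard.2 ⟨hB.trans ?_, hBcard⟩⟩
      · exact Finset.mem_product.2 ⟨Finset.mem_Ico.2 ⟨hp, hp'⟩, Finset.mem_Ico.2 ⟨hq, hq'⟩⟩
      · exact Finset.filter_subset _ _
    · have hsub : (Finset.univ.filter fun i => X i ∈ region B) ⊆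
          B.biUnion fun w => nodesInCell N X w.1 w.2 := by
        intro i hi
        obtain ⟨w, hw, hiw⟩ := Set.mem_iUnion₂.1 (Finset.mem_filter.1 hi).2
        exact Finset.mem_biUnion.2 ⟨w, hw, mem_nodesInCell_iff.2 hiw⟩
      have h1 : ((Finset.univ.filter fun i => X i ∈ region B).card : ℝ) ≤
          ∑ w ∈ B, ((nodesInCell N X w.1 w.2).card : ℝ) := by
        exact_mod_cast (Finset.card_le_card hsub).trans Finset.card_biUnion_le
      have h2 : ∑ w ∈ B, ((nodesInCell N X w.1 w.2).card : ℝ) ≤ ∑ w ∈ B, g :=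
        Finset.sum_le_sum fun w hw => (Finset.mem_filter.1 (hB hw)).2.le
      rw [Finset.sum_const, hBcard, nsmul_eq_mul] at h2
      push_cast at h2
      exact h1.trans h2
  · obtain ⟨hw, hB⟩ := Finset.mem_sigma.1 ht
    obtain ⟨hB, hBcard⟩ := Finset.mem_powersetCard.1 hB
    have hmeas : (uniformLaw unitSquare).real (region t.2) = (K + 1) / (N : ℝ) ^ 2 := by
      rw [measureReal_biUnion_finset]
      · have : ∀ w ∈ t.2, (uniformLaw unitSquare).real (cellRegion N (w.1 % N) (w.2 % N)) =
            1 / (N : ℝ) ^ 2 := fun w _ => uniformLaw_cellRegion hN (emod_mem_range hN _).1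
              (emod_mem_range hN _).2 (emod_mem_range hN _).1 (emod_mem_range hN _).2
        rw [Finset.sum_congr rfl this, Finset.sum_const, hBcard, nsmul_eq_mul]
        push_cast
        ring
      · intro w hw' w' hw'' hne
        refine Set.disjoint_left.2 fun x hx hx' => hne ?_
        have h1 := hB hw'
        have h2 := hB hw''
        simp only [box, Finset.mem_product, Finset.mem_Ico, hside] at h1 h2
        refine Prod.ext ?_ ?_
        · exact emod_injOn_Ico h1.1.1 (by omega) h2.1.1 (by omega) (hx.1.symm.trans hx'.1)
        · exact emod_injOn_Ico h1.2.1 (by omega) h2.2.1 (by omega) (hx.2.symm.trans hx'.2)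
      · exact fun w _ => measurableSet_cellRegion _ _ _
    have h := count_le_le (uniformLaw unitSquare) (hregion t.2) n ((K + 1) * g)
    rw [hmeas] at h
    refine h.trans (ENNReal.ofReal_le_ofReal (Real.exp_le_exp.2 (le_of_eq ?_)))
    ring

end CellCounts

/-! ### The upper bound from a strip. -/

section UpperBound

variable {n : ℕ} {r v : ℝ}

theorem ae_moveLaw_mem_closedBall (X : Fin n → Plane) (hv : 0 < v) :
    ∀ᵐ Y ∂(moveLaw v X), ∀ i, Y i ∈ Metric.closedBall (X i) v := by
  have := fun i => isProbabilityMeasure_uniformLaw_closedBall (X i) hv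
  rw [ae_all_iff]
  intro i
  have h : ∀ᵐ y ∂(uniformLaw (Metric.closedBall (X i) v)), y ∈ Metric.closedBall (X i) v :=
    ProbabilityTheory.ae_cond_mem measurableSet_closedBall
  exact (Measure.quasiMeasurePreserving_eval
    (fun i => uniformLaw (Metric.closedBall (X i) v)) i).ae h

open Classical in
/-- The nodes of the strip `[a, b) × [0, 1)`. -/
def stripNodes (X : Fin n → Plane) (a b : ℝ) : Finset (Fin n) :=
  Finset.univ.filter fun i => X i ∈ {x : Plane | Int.fract (x 0) ∈ Set.Ico a b}

theorem mem_stripNodes {X : Fin n → Plane} {a b : ℝ} {i : Fin n} :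
    i ∈ stripNodes X a b ↔ a ≤ Int.fract (X i 0) ∧ Int.fract (X i 0) < b := by
  simp [stripNodes]

/-- Each endpoint moves by at most v, so adjacency after the move forces distance less than 2v + r
before it, too little to leave the strip from its core. -/
theorem not_adj_of_far_from_boundary {X Y : Fin n → Plane}
    (hY : ∀ i, Y i ∈ Metric.closedBall (X i) v) {b : ℝ} {i j : Fin n}
    (hi : i ∈ stripNodes X (2 * v + r) (b - (2 * v + r))) (hj : j ∉ stripNodes X 0 b) :
    ¬ (geometricGraph r Y).Adj i j := by
  rintro ⟨_, h⟩
  obtain ⟨m, hm⟩ := torusDist_lt_iff.1 h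
  have h1 : ‖X i - X j + intVec m‖ < 2 * v + r := by
    have e : X i - X j + intVec m = (Y i - Y j + intVec m) + ((X i - Y i) + (Y j - X j)) := by
      abel
    have h2 := hY i
    have h3 := hY j
    rw [mem_closedBall_iff_norm'] at h2
    rw [mem_closedBall_iff_norm] at h3
    rw [e]
    calc _ ≤ ‖Y i - Y j + intVec m‖ + (‖X i - Y i‖ + ‖Y j - X j‖) :=
          (norm_add_le _ _).trans (add_le_add_right (norm_add_le _ _) _)
      _ < _ := by linarith
  have h2 := (abs_coord_le_norm _ 0).trans_lt h1
  simp only [PiLp.add_apply, PiLp.sub_apply, intVec_apply] at h2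
  rw [mem_stripNodes] at hi hj
  have hj' : b ≤ Int.fract (X j 0) := by
    by_contra hlt
    exact hj ⟨Int.fract_nonneg _, not_le.1 hlt⟩
  have hj1 := Int.fract_lt_one (X j 0)
  have ei := Int.self_sub_floor (X i 0)
  have ej := Int.self_sub_floor (X j 0)
  -- The winding number between the representatives in [0, 1): k ≤ 0 means passing the side at b,
  -- and k ≥ 1 the side at 0.
  set k : ℤ := m 0 + ⌊X i 0⌋ - ⌊X j 0⌋ with hk
  have h3 : |Int.fract (X i 0) - Int.fract (X j 0) + k| < 2 * v + r := by
    have e : Int.fract (X i 0) - Int.fract (X j 0) + k = X i 0 - X j 0 + m 0 := by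
      rw [hk]; push_cast
      linarith
    rwa [e]
  rw [abs_lt] at h3
  rcases le_or_gt k 0 with hk0 | hk0
  · have : (k : ℝ) ≤ 0 := by exact_mod_cast hk0
    linarith
  · have : (1 : ℝ) ≤ k := by exact_mod_cast hk0
    linarith

open Classical in
-- Almost surely only the nodes of the two boundary layers can contact the outside, each
-- contributing at most 1.
theorem mobileConductance_le_strip (hv : 0 < v) (X : Fin n → Plane) {b : ℝ}
    (hS : (stripNodes X 0 b).Nonempty) (hSn : 2 * (stripNodes X 0 b).card ≤ n) :
    mobileConductance r v X ≤ ((stripNodes X 0 (2 * v + r)).card +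
      (stripNodes X (b - (2 * v + r)) b).card) / (stripNodes X 0 b).card := by
  have := isProbabilityMeasure_moveLaw X hv
  refine (mobileConductance_le X hS hSn).trans ?_
  set S := stripNodes X 0 b
  set B := stripNodes X 0 (2 * v + r) ∪ stripNodes X (b - (2 * v + r)) b
  have hB : (B.card : ℝ) ≤ (stripNodes X 0 (2 * v + r)).card +
      (stripNodes X (b - (2 * v + r)) b).card := by exact_mod_cast Finset.card_union_le _ _
  have hS0 : (0 : ℝ) < S.card := by exact_mod_cast hS.card_pos
  have hae : ∀ᵐ Y ∂(moveLaw v X), setConductance r S Y ≤ B.card / S.card := by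
    filter_upwards [ae_moveLaw_mem_closedBall X hv] with Y hY
    refine div_le_div_of_nonneg_right ?_ hS0.le
    calc ∑ i ∈ S, ∑ j ∈ Sᶜ, contactProb r Y i j
        ≤ ∑ i ∈ S, if i ∈ B then (1 : ℝ) else 0 := by
          refine Finset.sum_le_sum fun i hi => ?_
          split_ifs with hiB
          · exact sum_contactProb_le_one Y i _
          · refine (Finset.sum_eq_zero fun j hj => ?_).le
            unfold contactProb
            rw [if_neg]
            refine not_adj_of_far_from_boundary hY (b := b) ?_ (Finset.mem_compl.1 hj)
            rw [Finset.mem_union, not_or, mem_stripNodes, mem_stripNodes] at hiB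
            rw [mem_stripNodes] at hi ⊢
            have h1 := Int.fract_nonneg (X i 0)
            constructor
            · by_contra h
              exact hiB.1 ⟨h1, not_le.1 h⟩
            · by_contra h
              exact hiB.2 ⟨not_lt.1 h, hi.2⟩
      _ ≤ ∑ i : Fin n, if i ∈ B then (1 : ℝ) else 0 :=
          Finset.sum_le_univ_sum_of_nonneg fun i => by split_ifs <;> norm_num
      _ = B.card := by simp
  calc ∫ Y, setConductance r S Y ∂(moveLaw v X) ≤ ∫ Y, (B.card : ℝ) / S.card ∂(moveLaw v X) :=
        integral_mono_ae (integrable_setConductance S _) (integrable_const _) hae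
    _ = B.card / S.card := by simp
    _ ≤ _ := div_le_div_of_nonneg_right hB hS0.le

theorem mobileConductance_le_one (hn : 2 ≤ n) (hv : 0 < v) (X : Fin n → Plane) :
    mobileConductance r v X ≤ 1 := by
  have := isProbabilityMeasure_moveLaw X hv
  refine (mobileConductance_le X (S := {⟨0, by omega⟩}) (by simp) (by simpa using hn)).trans ?_
  calc _ ≤ ∫ Y, (1 : ℝ) ∂(moveLaw v X) :=
        integral_mono (integrable_setConductance _ _) (integrable_const _)
          fun Y => setConductance_le_one _ Y
    _ = 1 := by simp

theorem initialLaw_stripNodes_ge_le {a b : ℝ} (ha : 0 ≤ a) (hab : a ≤ b) (hb : b ≤ 1) (s : ℝ) :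
    initialLaw n {X | s ≤ (stripNodes X a b).card} ≤
      ENNReal.ofReal (Real.exp (2 * (n * (b - a)) - s)) := by
  have h := count_ge_le (uniformLaw unitSquare) (measurableSet_strip a b) n s
  rw [uniformLaw_strip ha hab hb] at h
  rw [initialLaw]
  convert h
  ext i
  simp [mem_stripNodes]

theorem initialLaw_stripNodes_le_le {a b : ℝ} (ha : 0 ≤ a) (hab : a ≤ b) (hb : b ≤ 1) (s : ℝ) :
    initialLaw n {X | ((stripNodes X a b).card : ℝ) ≤ s} ≤
      ENNReal.ofReal (Real.exp (s - n * (b - a) / 2)) := by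
  have h := count_le_le (uniformLaw unitSquare) (measurableSet_strip a b) n s
  rw [uniformLaw_strip ha hab hb] at h
  rw [initialLaw]
  convert h
  ext i
  simp [mem_stripNodes]

theorem initialLaw_mobileConductance_gt_le (hn : 2 ≤ n) (hv : 0 < v) (hr : 0 < r) :
    initialLaw n {X | ¬ mobileConductance r v X ≤ 192 * (2 * v + r)} ≤
      ENNReal.ofReal (Real.exp (-(n / 32))) + ENNReal.ofReal (Real.exp (-(n / 4))) +
      (ENNReal.ofReal (Real.exp (-(n * r))) + ENNReal.ofReal (Real.exp (-(n * r)))) := by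
  set w := 2 * v + r with hw
  have hw0 : 0 < w := by positivity
  have hrw : r ≤ w := by linarith
  -- For w ≥ 1/16 the bound exceeds 1 and is trivial. Otherwise the layers fit in a strip of width
  -- 1/8; with more than n/32 nodes in the strip and fewer than 3nw in each layer, the ratio is at
  -- most 6nw / (n/32) = 192 w.
  rcases le_or_gt (1 / 16) w with hw16 | hw16
  · have : {X : Fin n → Plane | ¬ mobileConductance r v X ≤ 192 * w} = ∅ := by
      refine Set.eq_empty_iff_forall_notMem.2 fun X hX => hX ?_
      exact (mobileConductance_le_one hn hv X).trans (by linarith)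
    rw [this, measure_empty]
    exact zero_le
  · have hn0 : (0 : ℝ) < n := by exact_mod_cast (by omega : 0 < n)
    have hnr : Real.exp (2 * (n * w) - 3 * n * w) ≤ Real.exp (-(n * r)) := by
      rw [Real.exp_le_exp]; nlinarith
    have h1 := initialLaw_stripNodes_le_le (n := n) (a := 0) (b := 1 / 8) le_rfl (by norm_num)
      (by norm_num) (n / 32)
    have h2 := initialLaw_stripNodes_ge_le (n := n) (a := 0) (b := 1 / 8) le_rfl (by norm_num)
      (by norm_num) (n / 2)
    have h3 := initialLaw_stripNodes_ge_le (n := n) (a := 0) (b := w) le_rfl hw0.le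
      (by linarith) (3 * n * w)
    have h4 := initialLaw_stripNodes_ge_le (n := n) (a := 1 / 8 - w) (b := 1 / 8) (by linarith)
      (by linarith) (by norm_num) (3 * n * w)
    rw [sub_zero] at h3
    rw [sub_sub_cancel] at h4
    have e1 : (n : ℝ) / 32 - n * (1 / 8 - 0) / 2 = -(n / 32) := by ring
    have e2 : 2 * ((n : ℝ) * (1 / 8 - 0)) - n / 2 = -(n / 4) := by ring
    rw [e1] at h1
    rw [e2] at h2
    refine le_trans (measure_mono ?_) ((measure_union_le _ _).trans (add_le_add
      ((measure_union_le _ _).trans (add_le_add h1 h2)) ((measure_union_le _ _).trans (add_le_add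
        (h3.trans (ENNReal.ofReal_le_ofReal hnr)) (h4.trans (ENNReal.ofReal_le_ofReal hnr))))))
    intro X hX
    by_contra hcon
    simp only [Set.mem_union, Set.mem_ofPred_eq, not_or, not_le] at hcon
    obtain ⟨⟨c1, c2⟩, c3, c4⟩ := hcon
    apply hX
    have hS0 : (0 : ℝ) < (stripNodes X 0 (1 / 8)).card := lt_trans (by positivity) c1
    have hSn : 2 * (stripNodes X 0 (1 / 8)).card ≤ n := by
      have : 2 * ((stripNodes X 0 (1 / 8)).card : ℝ) ≤ n := by linarith
      exact_mod_cast this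
    refine (mobileConductance_le_strip hv X (Finset.card_pos.1 (by exact_mod_cast hS0))
      hSn).trans ?_
    rw [div_le_iff₀ hS0]
    nlinarith

/-- A squeeze between 0 and q, which needs no measurability of the events. -/
theorem whp_of_tendsto {p : (n : ℕ) → (Fin n → Plane) → Prop} {q : ℕ → ENNReal}
    (h : ∀ᶠ n in atTop, initialLaw n {X | ¬ p n X} ≤ q n) (hq : Tendsto q atTop (𝓝 0)) :
    WithHighProbability p :=
  tendsto_of_tendsto_of_tendsto_of_le_of_le' tendsto_const_nhds hq
    (Eventually.of_forall fun _ => zero_le) h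

theorem tendsto_ofReal_exp_neg {f : ℕ → ℝ} (hf : Tendsto f atTop atTop) :
    Tendsto (fun n => ENNReal.ofReal (Real.exp (-f n))) atTop (𝓝 0) := by
  have := ENNReal.tendsto_ofReal (Real.tendsto_exp_neg_atTop_nhds_zero.comp hf)
  simpa using this

theorem whp_mobileConductance_le {r v : ℕ → ℝ} (hr : ∀ n, 0 < r n) (hv : ∀ n, 0 < v n)
    (hnr : Tendsto (fun n : ℕ => n * r n) atTop atTop) :
    WithHighProbability fun n X => mobileConductance (r n) (v n) X ≤ 192 * (2 * v n + r n) := by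
  refine whp_of_tendsto ((eventually_ge_atTop 2).mono fun n hn =>
    initialLaw_mobileConductance_gt_le hn (hv n) (hr n)) ?_
  have h1 := tendsto_ofReal_exp_neg (tendsto_natCast_atTop_atTop.atTop_div_const
    (show (0 : ℝ) < 32 by norm_num))
  have h2 := tendsto_ofReal_exp_neg (tendsto_natCast_atTop_atTop.atTop_div_const
    (show (0 : ℝ) < 4 by norm_num))
  have h3 := tendsto_ofReal_exp_neg hnr
  simpa using (h1.add h2).add (h3.add h3)

end UpperBound

/-! ### Expansion at the scale of the transmission range. -/

section RangeScale

theorem exists_range_bounds {r : ℕ → ℝ} (hr_pos : ∀ n, 0 < r n)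
    (hr : r =Θ[atTop] fun n : ℕ => Real.sqrt (Real.log n / n)) :
    ∃ a > 0, ∃ b > 0, ∀ᶠ n : ℕ in atTop,
      a * Real.log n ≤ n * r n ^ 2 ∧ n * r n ^ 2 ≤ b * Real.log n := by
  obtain ⟨C, hC, h1⟩ := hr.1.exists_pos
  obtain ⟨C', hC', h2⟩ := hr.2.exists_pos
  refine ⟨1 / C' ^ 2, by positivity, C ^ 2, by positivity, ?_⟩
  filter_upwards [h1.bound, h2.bound, eventually_ge_atTop 1] with n hn1 hn2 hn
  have hn0 : (0 : ℝ) < n := by exact_mod_cast hn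
  have hlog : 0 ≤ Real.log n := Real.log_nonneg (by exact_mod_cast hn)
  rw [Real.norm_of_nonneg (hr_pos n).le, Real.norm_of_nonneg (Real.sqrt_nonneg _)] at hn1 hn2
  have hsq : Real.sqrt (Real.log n / n) ^ 2 = Real.log n / n := Real.sq_sqrt (by positivity)
  constructor
  · have h3 := pow_le_pow_left₀ (Real.sqrt_nonneg _) hn2 2
    rw [mul_pow, hsq, div_le_iff₀ hn0] at h3
    rw [div_mul_eq_mul_div, one_mul, div_le_iff₀ (by positivity)]
    linarith
  · have h3 := pow_le_pow_left₀ (hr_pos n).le hn1 2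
    rw [mul_pow, hsq, ← mul_div_assoc, le_div_iff₀ hn0] at h3
    linarith

theorem tendsto_log_natCast : Tendsto (fun n : ℕ => Real.log n) atTop atTop :=
  Real.tendsto_log_atTop.comp tendsto_natCast_atTop_atTop

theorem tendsto_log_pow_div (k : ℕ) :
    Tendsto (fun n : ℕ => Real.log n ^ k / n) atTop (𝓝 0) :=
  ((Real.isLittleO_pow_log_id_atTop (n := k)).tendsto_div_nhds_zero).comp tendsto_natCast_atTop_atTop

/-- Since r² is at most b log n / n, its decay beats every power of the logarithm. -/
theorem eventually_mul_log_pow_le {r : ℕ → ℝ} {b : ℝ} (hb : 0 < b)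
    (h : ∀ᶠ n : ℕ in atTop, n * r n ^ 2 ≤ b * Real.log n) (k : ℕ) {ε : ℝ} (hε : 0 < ε) :
    ∀ᶠ n : ℕ in atTop, r n * Real.log n ^ k ≤ ε := by
  have h1 := (tendsto_log_pow_div (2 * k + 1)).eventually_le_const
    (show (0 : ℝ) < ε ^ 2 / b by positivity)
  filter_upwards [h, h1, eventually_ge_atTop 1] with n hn1 hn2 hn
  have hn0 : (0 : ℝ) < n := by exact_mod_cast hn
  have hlog : 0 ≤ Real.log n := Real.log_nonneg (by exact_mod_cast hn)
  rw [div_le_div_iff₀ hn0 hb] at hn2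
  refine le_of_sq_le_sq ?_ hε.le
  have h3 : n * (r n * Real.log n ^ k) ^ 2 ≤ n * ε ^ 2 := by
    calc n * (r n * Real.log n ^ k) ^ 2 = n * r n ^ 2 * (Real.log n ^ k) ^ 2 := by ring
      _ ≤ b * Real.log n * (Real.log n ^ k) ^ 2 := by gcongr
      _ = Real.log n ^ (2 * k + 1) * b := by ring
      _ ≤ _ := by linarith
  exact le_of_mul_le_mul_left h3 hn0

theorem tendsto_natCast_mul_range {r : ℕ → ℝ} (hr_pos : ∀ n, 0 < r n) {a : ℝ} (ha : 0 < a)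
    (h : ∀ᶠ n : ℕ in atTop, a * Real.log n ≤ n * r n ^ 2) :
    Tendsto (fun n : ℕ => n * r n) atTop atTop := by
  refine tendsto_atTop.2 fun C => ?_
  filter_upwards [h, tendsto_log_natCast.eventually_ge_atTop (C ^ 2 / a),
    eventually_ge_atTop 1] with n hn1 hn2 hn
  have hn0 : (1 : ℝ) ≤ n := by exact_mod_cast hn
  rw [div_le_iff₀ ha] at hn2
  have h3 : C ^ 2 ≤ (n * r n) ^ 2 := by
    calc C ^ 2 ≤ n * r n ^ 2 := by linarith
      _ ≤ n * (n * r n ^ 2) := le_mul_of_one_le_left (by positivity) hn0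
      _ = _ := by ring
  exact (le_abs_self C).trans (abs_le_of_sq_le_sq h3 (mul_pos (by linarith) (hr_pos n)).le)

theorem exp_neg_mul_log {n : ℕ} (hn : 0 < n) (k : ℕ) :
    Real.exp (-(k * Real.log n)) = 1 / (n : ℝ) ^ k := by
  rw [Real.exp_neg, mul_comm, Real.exp_mul, Real.exp_log (by exact_mod_cast hn),
    Real.rpow_natCast, one_div]

variable {n N : ℕ} {r a b : ℝ}

/-- The mean number of nodes in a cell of a grid at the scale of the transmission range. -/
theorem cell_mean_bounds (hN1 : 4 ≤ N * r) (hN2 : N * r ≤ 5) (hr : 0 < r)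
    (h1 : a * Real.log n ≤ n * r ^ 2) (h2 : n * r ^ 2 ≤ b * Real.log n) :
    a * Real.log n / 25 ≤ n / (N : ℝ) ^ 2 ∧ n / (N : ℝ) ^ 2 ≤ b * Real.log n / 16 := by
  have hN : (0 : ℝ) < N := by
    by_contra h
    have : (N : ℝ) * r ≤ 0 := mul_nonpos_of_nonpos_of_nonneg (not_lt.1 h) hr.le
    linarith
  have h3 : ((N : ℝ) * r) ^ 2 ≤ 25 := by nlinarith
  have h4 : 16 ≤ ((N : ℝ) * r) ^ 2 := by nlinarith
  have h5 : n / (N : ℝ) ^ 2 * ((N : ℝ) * r) ^ 2 = n * r ^ 2 := by field_simp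
  have h6 : 0 ≤ n / (N : ℝ) ^ 2 := by positivity
  constructor <;> nlinarith

/-- With overwhelming probability no cell of a grid at the scale of the transmission range has
more than a logarithmic number of nodes. -/
theorem initialLaw_cell_overfull_le_inv_pow (ha : 0 < a) (hN1 : 4 ≤ N * r)
    (hN2 : N * r ≤ 5) (hr : 0 < r) (hn : 1 ≤ Real.log n)
    (h1 : a * Real.log n ≤ n * r ^ 2) (h2 : n * r ^ 2 ≤ b * Real.log n) :
    initialLaw n {X | ¬ ∀ p q, ((nodesInCell N X p q).card : ℝ) ≤ (b / 8 + 6) * Real.log n} ≤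
      ENNReal.ofReal (25 / a * (1 / (n : ℝ) ^ 5)) := by
  have hn0 : 0 < n := by
    rcases Nat.eq_zero_or_pos n with h | h
    · rw [h] at hn; norm_num at hn
    · exact h
  have hn0' : (0 : ℝ) < n := by exact_mod_cast hn0
  have hN : 0 < N := by
    rcases Nat.eq_zero_or_pos N with h | h
    · rw [h] at hN1; norm_num at hN1
    · exact h
  have hN' : (0 : ℝ) < N := by exact_mod_cast hN
  obtain ⟨h3, h4⟩ := cell_mean_bounds hN1 hN2 hr h1 h2
  refine (initialLaw_cell_overfull_le hN _).trans (ENNReal.ofReal_le_ofReal ?_)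
  -- The term b/8 absorbs twice the mean, and 6 log n remains. The union bound over O(n) cells then
  -- costs one power of n.
  have h5 : Real.exp (2 * (n / (N : ℝ) ^ 2) - (b / 8 + 6) * Real.log n) ≤ 1 / (n : ℝ) ^ 6 := by
    rw [← exp_neg_mul_log hn0 6, Real.exp_le_exp]
    push_cast
    linarith
  have h6 : (N : ℝ) ^ 2 ≤ 25 / a * n := by
    have : a / 25 ≤ n / (N : ℝ) ^ 2 := by nlinarith
    rw [div_le_div_iff₀ (by norm_num) (by positivity)] at this
    rw [div_mul_eq_mul_div, le_div_iff₀ ha]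
    linarith
  calc _ ≤ 25 / a * n * (1 / (n : ℝ) ^ 6) := by gcongr
    _ = _ := by field_simp

/-- Round 4/(rM) up to L: this raises M L r from 4 by at most rM ≤ 1, so the cell side is within a
constant of r and N is a multiple of M. -/
theorem exists_grid {r : ℝ} (hr : 0 < r) {M : ℕ} (hM : 0 < M) (hMr : r * M ≤ 1) :
    ∃ L : ℕ, 3 ≤ L ∧ 4 ≤ ((M * L : ℕ) : ℝ) * r ∧ ((M * L : ℕ) : ℝ) * r ≤ 5 := by
  have hM' : (0 : ℝ) < M := by exact_mod_cast hM
  have hrM : 0 < r * M := by positivity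
  have h1 := Nat.le_ceil (4 / (r * M))
  have h2 := Nat.ceil_lt_add_one (a := 4 / (r * M)) (by positivity)
  set L := ⌈4 / (r * M)⌉₊
  have h3 : 4 / (r * M) * (r * M) = 4 := div_mul_cancel₀ _ hrM.ne'
  have h4 : (4 : ℝ) ≤ 4 / (r * M) := by rw [le_div_iff₀ hrM]; linarith
  refine ⟨L, ?_, ?_, ?_⟩
  · have : (3 : ℝ) ≤ L := by linarith
    exact_mod_cast this
  · push_cast
    nlinarith
  · push_cast
    nlinarith

/-- **Expansion of the connected random geometric graph at the connectivity threshold.** -/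
theorem exists_tendsto_expandingPositions {r : ℕ → ℝ} (hr_pos : ∀ n, 0 < r n)
    (hr : r =Θ[atTop] fun n : ℕ => Real.sqrt (Real.log n / n))
    (hconn : WithHighProbability fun n X => (geometricGraph (r n) X).Connected) :
    ∃ c > 0, Tendsto (fun n => initialLaw n (expandingPositions n (r n) (c * r n))ᶜ) atTop
      (𝓝 0) := by
  obtain ⟨a, ha, b, hb, hab⟩ := exists_range_bounds hr_pos hr
  -- With g = x/4, where x ≥ a log n / 25 is the mean occupancy, the exponent for K + 1 sparse cells
  -- is -(K + 1) x/4 ≤ -2 log n, enough to beat the O(n) windows. The factor 5 in `M` is the edge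
  -- span in cells.
  obtain ⟨K, hK⟩ := exists_nat_gt (200 / a)
  set M : ℕ := (K + 1) * 5 with hM
  have hM0 : 0 < M := by omega
  have hM0' : (0 : ℝ) < M := by exact_mod_cast hM0
  set B : ℝ := b / 8 + 6 with hB
  have hB0 : 0 < B := by positivity
  set C₁ : ℝ := 2 * ((2 * (2 * M : ℕ) + 1) ^ 2 * B) with hC₁
  set C₂ : ℝ := 1024 * 125 * 625 * M ^ 4 * B ^ 2 / a ^ 3 with hC₂
  have hC : 0 < C₁ + C₂ := by positivity
  refine ⟨1 / (121 * B * (C₁ + C₂)), by positivity, ?_⟩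
  have hlim : Tendsto (fun n : ℕ => initialLaw n {X | ¬ (geometricGraph (r n) X).Connected} +
      (ENNReal.ofReal (25 / a * (1 / (n : ℝ) ^ 5)) +
        ENNReal.ofReal (25 / a * 2 ^ (9 * M ^ 2) * (1 / (n : ℝ))))) atTop (𝓝 0) := by
    have h1 : Tendsto (fun n : ℕ => 25 / a * (1 / (n : ℝ) ^ 5)) atTop (𝓝 0) := by
      have : Tendsto (fun n : ℕ => (n : ℝ) ^ 5) atTop atTop :=
        (tendsto_pow_atTop (by norm_num)).comp tendsto_natCast_atTop_atTop
      simpa using (this.inv_tendsto_atTop.const_mul (25 / a))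
    have h2 : Tendsto (fun n : ℕ => 25 / a * 2 ^ (9 * M ^ 2) * (1 / (n : ℝ))) atTop (𝓝 0) := by
      simpa using (tendsto_one_div_atTop_nhds_zero_nat (𝕜 := ℝ)).const_mul
        (25 / a * 2 ^ (9 * M ^ 2))
    have h3 := ENNReal.tendsto_ofReal h1
    have h4 := ENNReal.tendsto_ofReal h2
    rw [ENNReal.ofReal_zero] at h3 h4
    simpa using Tendsto.add hconn (h3.add h4)
  refine tendsto_of_tendsto_of_tendsto_of_le_of_le' tendsto_const_nhds hlim
    (Eventually.of_forall fun _ => zero_le) ?_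
  have hMr := eventually_mul_log_pow_le hb (hab.mono fun n h => h.2) 0
    (show 0 < 1 / (M : ℝ) by positivity)
  have hrl := eventually_mul_log_pow_le hb (hab.mono fun n h => h.2) 2 zero_lt_one
  filter_upwards [hab, hMr, hrl, tendsto_log_natCast.eventually_ge_atTop 1,
    eventually_ge_atTop 1] with n ⟨h1, h2⟩ hMr hrl hlog hn
  have hn0 : (0 : ℝ) < n := by exact_mod_cast hn
  rw [pow_zero, mul_one, le_div_iff₀ hM0'] at hMr
  obtain ⟨L, hL3, hL4, hL5⟩ := exists_grid (hr_pos n) hM0 hMr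
  set l := Real.log n with hl
  have hl0 : 0 < l := by linarith
  have hrn := hr_pos n
  obtain ⟨h3, h4⟩ := cell_mean_bounds hL4 hL5 hrn h1 h2
  set x : ℝ := n / ((M * L : ℕ) : ℝ) ^ 2 with hx
  have hx0 : 0 < x := lt_of_lt_of_le (by positivity) h3
  have hNL : (L : ℝ) ≤ ((M * L : ℕ) : ℝ) := by
    exact_mod_cast Nat.le_mul_of_pos_left L hM0
  have hLr : (L : ℝ) * r n ≤ 5 := (mul_le_mul_of_nonneg_right hNL hrn.le).trans hL5
  have hover := initialLaw_cell_overfull_le_inv_pow ha hL4 hL5 hrn hlog h1 h2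
  have hsparse := initialLaw_badCells_le (n := n) (M := M) (L := L) (K := K) (g := x / 4) hM0 hL3
  have hsparse' : initialLaw n {X | ¬ ∀ p q : ℤ, 0 ≤ p → p < L → 0 ≤ q → q < L →
      (badCells (M * L) M (fun i => cellIdx (M * L) (X i 0))
        (fun i => cellIdx (M * L) (X i 1)) (x / 4) p q).card ≤ K} ≤
      ENNReal.ofReal (25 / a * 2 ^ (9 * M ^ 2) * (1 / (n : ℝ))) := by
    refine hsparse.trans (ENNReal.ofReal_le_ofReal ?_)
    have e1 : Real.exp ((K + 1) * (x / 4) - (K + 1) * x / 2) ≤ 1 / (n : ℝ) ^ 2 := by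
      rw [← exp_neg_mul_log (by omega) 2, Real.exp_le_exp, ← hl]
      rw [div_lt_iff₀ ha] at hK
      push_cast
      have : 200 * l ≤ (K + 1) * (25 * x) := by
        calc 200 * l ≤ (K + 1) * a * l := by nlinarith
          _ = (K + 1) * (a * l) := by ring
          _ ≤ _ := mul_le_mul_of_nonneg_left (by linarith) (by positivity)
      linarith
    have e2 : (L : ℝ) ^ 2 ≤ 25 / a * n := by
      have e3 : (L : ℝ) ^ 2 * r n ^ 2 ≤ 25 := by
        rw [← mul_pow]; nlinarith [mul_nonneg (Nat.cast_nonneg (α := ℝ) L) hrn.le]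
      rw [div_mul_eq_mul_div, le_div_iff₀ ha]
      calc (L : ℝ) ^ 2 * a ≤ (L : ℝ) ^ 2 * (n * r n ^ 2) := by gcongr; nlinarith
        _ = (L : ℝ) ^ 2 * r n ^ 2 * n := by ring
        _ ≤ 25 * n := mul_le_mul_of_nonneg_right e3 hn0.le
    calc _ ≤ 25 / a * n * 2 ^ (9 * M ^ 2) * (1 / (n : ℝ) ^ 2) := by gcongr
      _ = _ := by field_simp
  refine le_trans (measure_mono ?_) ((measure_union_le _ _).trans (add_le_add le_rfl
    ((measure_union_le _ _).trans (add_le_add hover hsparse'))))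
  intro X hX
  by_contra hcon
  simp only [Set.mem_union, Set.mem_ofPred_eq, not_or, not_not] at hcon
  obtain ⟨c1, c2, c3⟩ := hcon
  apply hX
  -- With u = B log n, this Z makes 1/(121 u Z) a constant times r. `C₁` handles the exceptional
  -- nodes, using r log² n ≤ 1, and `C₂` the isoperimetric term.
  have hexp := mem_expandingPositions (Z := (C₁ + C₂) / (r n * l)) c1 (le_of_eq hM.symm) (by omega)
    hL4 hL5 c2 (by positivity) (by positivity) c3 ?_ ?_
  · have e : 1 / (121 * B * (C₁ + C₂)) * r n =
        1 / (121 * (B * l) * ((C₁ + C₂) / (r n * l))) := by field_simp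
    rw [e]
    exact hexp
  · rw [le_div_iff₀ (by positivity)]
    calc _ = C₁ * (r n * l ^ 2) := by rw [hC₁]; ring
      _ ≤ C₁ * 1 := by gcongr
      _ ≤ _ := by rw [mul_one]; exact le_add_of_nonneg_right (by positivity)
  · rw [div_le_div_iff₀ (by positivity) (by positivity)]
    have e1 : ((L : ℝ) * r n) ^ 3 ≤ 5 ^ 3 := pow_le_pow_left₀ (by positivity) hLr 3
    have e2 : (a * l / 25) ^ 2 ≤ x ^ 2 := pow_le_pow_left₀ (by positivity) h3 2
    have e3 : a ^ 3 * l ^ 3 ≤ 625 * (x ^ 2 * (n * r n ^ 2)) := by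
      calc a ^ 3 * l ^ 3 = 625 * ((a * l / 25) ^ 2 * (a * l)) := by ring
        _ ≤ _ := by gcongr
    -- The factor r² completes L³ r to (L r)³ ≤ 125.
    refine le_of_mul_le_mul_right ?_ (show 0 < r n ^ 2 by positivity)
    have e4 : 16 * ((M : ℝ) ^ 2 * (B * l)) ^ 2 * L ^ 3 * (r n * l) * r n ^ 2 =
        16 * M ^ 4 * B ^ 2 * l ^ 3 * (L * r n) ^ 3 := by ring
    rw [e4]
    calc 16 * (M : ℝ) ^ 4 * B ^ 2 * l ^ 3 * (L * r n) ^ 3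
        ≤ 16 * M ^ 4 * B ^ 2 * l ^ 3 * 5 ^ 3 := by gcongr
      _ = 16 * 125 * M ^ 4 * B ^ 2 / a ^ 3 * (a ^ 3 * l ^ 3) := by field_simp; norm_num
      _ ≤ 16 * 125 * M ^ 4 * B ^ 2 / a ^ 3 * (625 * (x ^ 2 * (n * r n ^ 2))) := by gcongr
      _ = C₂ * ((x / 4) ^ 2 / 4 * n) * r n ^ 2 := by rw [hC₂]; ring
      _ ≤ _ := by
          gcongr
          exact le_add_of_nonneg_left (by positivity)

/-- Expansion is typical for uniform positions, which the move preserves in law. By Markov, for most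
X expansion fails after the move with conditional probability below 1/2. -/
theorem whp_le_mobileConductance_of_range {r v : ℕ → ℝ} (hr_pos : ∀ n, 0 < r n)
    (hr : r =Θ[atTop] fun n : ℕ => Real.sqrt (Real.log n / n))
    (hconn : WithHighProbability fun n X => (geometricGraph (r n) X).Connected)
    (hv_pos : ∀ n, 0 < v n) :
    ∃ c > 0, WithHighProbability fun n X => c * r n ≤ mobileConductance (r n) (v n) X := by
  obtain ⟨c, hc, hlim⟩ := exists_tendsto_expandingPositions hr_pos hr hconn
  refine ⟨c / 2, by positivity, whp_of_tendsto
    (q := fun n => initialLaw n (expandingPositions n (r n) (c * r n))ᶜ / (1 / 2)) ?_ ?_⟩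
  · filter_upwards [eventually_ge_atTop 2] with n hn
    have hE := measurableSet_expandingPositions n (r n) (c * r n)
    refine le_trans (measure_mono ?_) (initialLaw_moveLaw_ge_le (hv_pos n) hE.compl
      (fun X m => by rw [Set.mem_compl_iff, expandingPositions_add_intVec, Set.mem_compl_iff])
      (ε := 1 / 2) (by simp) (by simp))
    intro X hX
    by_contra hcon
    apply hX
    have := half_le_mobileConductance hn (hv_pos n) (mul_pos hc (hr_pos n)).le (not_le.1 hcon)
    calc c / 2 * r n = c * r n / 2 := by ring
      _ ≤ _ := this
  · have := ENNReal.Tendsto.div_const hlim (b := 1 / 2) (Or.inr (by simp))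
    simpa using this

end RangeScale

/-! ### Pairs meeting after the move, and cuts at the scale of the velocity. -/

section VelocityScale

variable {n : ℕ} {r v : ℝ}

theorem map_pair_moveLaw (hv : 0 < v) (X : Fin n → Plane) {i j : Fin n} (hij : i ≠ j) :
    (moveLaw v X).map (fun Y => (Y i, Y j)) =
      (uniformLaw (Metric.closedBall (X i) v)).prod (uniformLaw (Metric.closedBall (X j) v)) := by
  have h1 := fun i => isProbabilityMeasure_uniformLaw_closedBall (X i) hv
  have h2 := isProbabilityMeasure_moveLaw X hv
  have h3 := (ProbabilityTheory.iIndepFun_pi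
    (μ := fun i => uniformLaw (Metric.closedBall (X i) v)) (X := fun _ y => y)
    fun i => aemeasurable_id).indepFun hij
  have h4 := (ProbabilityTheory.indepFun_iff_map_prod_eq_prod_map_map
    (measurable_pi_apply i).aemeasurable (measurable_pi_apply j).aemeasurable).1 h3
  have h5 := fun i => (measurePreserving_eval
    (fun i => uniformLaw (Metric.closedBall (X i) v)) i).map_eq
  rw [moveLaw]
  refine h4.trans ?_
  congr 1
  · exact h5 i
  · exact h5 j

theorem uniformLaw_closedBall_ball {x y : Plane} {s : ℝ} (hs : 0 ≤ s) (hv : 0 < v)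
    (h : Metric.ball y s ⊆ Metric.closedBall x v) :
    uniformLaw (Metric.closedBall x v) (Metric.ball y s) = ENNReal.ofReal (s ^ 2 / v ^ 2) := by
  rw [uniformLaw, ProbabilityTheory.cond_apply measurableSet_closedBall,
    Set.inter_eq_right.2 h, Measure.addHaar_closedBall _ _ hv.le, Measure.addHaar_ball _ _ hs]
  have hd : Module.finrank ℝ Plane = 2 := by simp
  have h0 : volume (Metric.ball (0 : Plane) 1) ≠ 0 := (Metric.measure_ball_pos _ _ one_pos).ne'
  have h1 : volume (Metric.ball (0 : Plane) 1) ≠ ⊤ := measure_ball_lt_top.ne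
  have h2 : ENNReal.ofReal (v ^ 2) ≠ 0 := by
    rw [Ne, ENNReal.ofReal_eq_zero, not_le]; positivity
  rw [hd, mul_comm, ← div_eq_mul_inv, ENNReal.mul_div_mul_right _ _ h0 h1,
    ← ENNReal.ofReal_div_of_pos (by positivity)]

/-- Two nodes within distance `v` before the move are neighbours after the move with probability
of order at least `r ^ 2 / v ^ 2`. -/
theorem moveLaw_adj_ge (hr : 0 < r) (hrv : r ≤ v / 4) (X : Fin n → Plane) {i j : Fin n}
    (hij : (geometricGraph v X).Adj i j) :
    r ^ 2 / (16 * v ^ 2) ≤ (moveLaw v X).real {Y | (geometricGraph r Y).Adj i j} := by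
  have hv : 0 < v := by linarith
  have h1 := fun i => isProbabilityMeasure_uniformLaw_closedBall (X i) hv
  have h2 := isProbabilityMeasure_moveLaw X hv
  obtain ⟨m, hm⟩ := torusDist_lt_iff.1 hij.2
  -- Half the displacement between the nodes: X i - e is their midpoint, at distance at most v/2
  -- from X i and, modulo the lattice, from X j.
  set e : Plane := (1 / 2 : ℝ) • (X i - X j + intVec m) with he
  have hee : e + e = X i - X j + intVec m := by
    rw [he, ← add_smul]; norm_num
  have hen : ‖e‖ ≤ v / 2 := by
    rw [he, norm_smul]
    norm_num
    linarith
  set T : Set (Plane × Plane) := {p | ‖p.1 - p.2 + intVec m‖ < r} with hT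
  have hTm : MeasurableSet T := measurableSet_lt (by fun_prop) measurable_const
  have hsub : (fun Y : Fin n → Plane => (Y i, Y j)) ⁻¹' T ⊆
      {Y | (geometricGraph r Y).Adj i j} :=
    fun Y hY => ⟨hij.1, torusDist_lt_iff.2 ⟨m, hY⟩⟩
  have hpair : Measurable fun Y : Fin n → Plane => (Y i, Y j) :=
    (measurable_pi_apply i).prodMk (measurable_pi_apply j)
  set μ := uniformLaw (Metric.closedBall (X i) v) with hμ
  set ν := uniformLaw (Metric.closedBall (X j) v) with hν
  have key : ENNReal.ofReal (r ^ 2 / (16 * v ^ 2)) ≤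
      moveLaw v X ((fun Y : Fin n → Plane => (Y i, Y j)) ⁻¹' T) := by
    rw [← Measure.map_apply hpair hTm, map_pair_moveLaw hv X hij.1, Measure.prod_apply hTm]
    -- If node i lands within v/4 of the midpoint (probability 1/16), the disk of radius r about it
    -- lies in the disk available to node j, since r + v/4 + v/2 ≤ v.
    have hball : ∀ y ∈ Metric.ball (X i - e) (v / 4), ENNReal.ofReal (r ^ 2 / v ^ 2) ≤
        ν (Prod.mk y ⁻¹' T) := by
      intro y hy
      rw [mem_ball_iff_norm] at hy
      rw [hν, ← uniformLaw_closedBall_ball (y := y + intVec m) hr.le hv]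
      · refine measure_mono fun z hz => ?_
        rw [mem_ball_iff_norm'] at hz
        simp only [hT, Set.mem_preimage, Set.mem_ofPred_eq]
        rwa [show y - z + intVec m = y + intVec m - z by abel]
      · intro z hz
        rw [mem_ball_iff_norm] at hz
        rw [mem_closedBall_iff_norm]
        have e1 : z - X j = (z - (y + intVec m)) + ((y - (X i - e)) + e) := by
          have : e = X i - X j + intVec m - e := eq_sub_of_add_eq hee
          nth_rewrite 2 [this]
          abel
        rw [e1]
        calc _ ≤ ‖z - (y + intVec m)‖ + (‖y - (X i - e)‖ + ‖e‖) :=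
              (norm_add_le _ _).trans (add_le_add_right (norm_add_le _ _) _)
          _ ≤ v := by linarith
    have hμball : μ (Metric.ball (X i - e) (v / 4)) = ENNReal.ofReal (1 / 16) := by
      rw [hμ, uniformLaw_closedBall_ball (by positivity) hv]
      · congr 1
        field_simp
        norm_num
      · intro z hz
        rw [mem_ball_iff_norm] at hz
        rw [mem_closedBall_iff_norm]
        have e1 : z - X i = (z - (X i - e)) + (-e) := by abel
        rw [e1]
        refine (norm_add_le _ _).trans ?_
        rw [norm_neg]
        linarith
    calc ENNReal.ofReal (r ^ 2 / (16 * v ^ 2))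
        = ENNReal.ofReal (r ^ 2 / v ^ 2) * μ (Metric.ball (X i - e) (v / 4)) := by
          rw [hμball, ← ENNReal.ofReal_mul (by positivity)]
          congr 1
          field_simp
      _ = ∫⁻ y in Metric.ball (X i - e) (v / 4), ENNReal.ofReal (r ^ 2 / v ^ 2) ∂μ := by
          rw [setLIntegral_const]
      _ ≤ ∫⁻ y in Metric.ball (X i - e) (v / 4), ν (Prod.mk y ⁻¹' T) ∂μ :=
          setLIntegral_mono' measurableSet_ball hball
      _ ≤ _ := setLIntegral_le_lintegral _ _
  rw [measureReal_def]
  refine (ENNReal.ofReal_le_iff_le_toReal (measure_ne_top _ _)).1 (key.trans (measure_mono hsub))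

/-- The positions for which some cell has more than `u` nodes. -/
def overfullPositions (n N : ℕ) (u : ℝ) : Set (Fin n → Plane) :=
  {X | ¬ ∀ a b, ((nodesInCell N X a b).card : ℝ) ≤ u}

theorem measurableSet_overfullPositions (n N : ℕ) (u : ℝ) :
    MeasurableSet (overfullPositions n N u) := by
  classical
  have h1 : ∀ a b, Measurable fun X : Fin n → Plane => ((nodesInCell N X a b).card : ℝ) := by
    intro a b
    have : ∀ X : Fin n → Plane, ((nodesInCell N X a b).card : ℝ) =
        ∑ i, (cellRegion N (a % N) (b % N)).indicator (fun _ => (1 : ℝ)) (X i) := by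
      intro X
      simp only [Set.indicator_apply, Finset.sum_boole]
      congr 2
      ext i
      simp [mem_nodesInCell_iff]
    simp only [this]
    exact Finset.measurable_sum _ fun i _ =>
      (measurable_const.indicator (measurableSet_cellRegion _ _ _)).comp (measurable_pi_apply i)
  have h2 : overfullPositions n N u = ⋃ a, ⋃ b, {X | u < ((nodesInCell N X a b).card : ℝ)} := by
    ext X
    simp [overfullPositions]
  rw [h2]
  exact MeasurableSet.iUnion fun a => MeasurableSet.iUnion fun b =>
    measurableSet_lt measurable_const (h1 a b)

theorem nodesInCell_add_intVec (N : ℕ) (X : Fin n → Plane) (m : Fin n → Fin 2 → ℤ) (a b : ℤ) :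
    nodesInCell N (fun i => X i + intVec (m i)) a b = nodesInCell N X a b := by
  ext i
  simp only [mem_nodesInCell, PiLp.add_apply, intVec_apply, cellIdx_add_int]

theorem overfullPositions_add_intVec (N : ℕ) (u : ℝ) (X : Fin n → Plane)
    (m : Fin n → Fin 2 → ℤ) :
    (fun i => X i + intVec (m i)) ∈ overfullPositions n N u ↔ X ∈ overfullPositions n N u := by
  simp only [overfullPositions, Set.mem_ofPred_eq, nodesInCell_add_intVec]

/-- A lower bound for the expected conductance of a set by its cut at the scale of the velocity. -/
theorem le_integral_setConductance (hr : 0 < r) (hrv : r ≤ v / 4) {X : Fin n → Plane} {N : ℕ}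
    {u : ℝ} (hu : 0 < u) (hN1 : 4 ≤ N * r) (hN2 : N * r ≤ 5)
    (hover : (moveLaw v X).real (overfullPositions n N u) ≤ r ^ 2 / (32 * v ^ 2))
    {S : Finset (Fin n)} :
    (cutPairs (geometricGraph v X) S).card * (r ^ 2 / (32 * v ^ 2)) / (121 * u) / S.card ≤
      ∫ Y, setConductance r S Y ∂(moveLaw v X) := by
  have hv : 0 < v := by linarith
  have hμ := isProbabilityMeasure_moveLaw X hv
  have hN : 0 < N := by
    rcases Nat.eq_zero_or_pos N with h | h
    · rw [h] at hN1; norm_num at hN1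
    · exact h
  set E := overfullPositions n N u with hE
  have hEm := measurableSet_overfullPositions n N u
  set Q := cutPairs (geometricGraph v X) S
  have hQ : Q ⊆ S ×ˢ Sᶜ := by
    intro p hp
    have := mem_cutPairs.1 hp
    exact Finset.mem_product.2 ⟨this.1, Finset.mem_compl.2 this.2.1⟩
  set A : Fin n × Fin n → Set (Fin n → Plane) := fun p => {Y | (geometricGraph r Y).Adj p.1 p.2}
  have hA : ∀ p, MeasurableSet (A p) := fun p => measurableSet_adj p.1 p.2
  -- Off `E` the degrees are at most 121 u. On `E` the left side is nonpositive, which avoids any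
  -- independence between adjacency and degrees.
  have hpt : ∀ Y p, 1 / (121 * u) * ((A p).indicator (fun _ => (1 : ℝ)) Y -
      E.indicator (fun _ => (1 : ℝ)) Y) ≤ contactProb r Y p.1 p.2 := by
    intro Y p
    by_cases hYE : Y ∈ E
    · refine le_trans ?_ (contactProb_nonneg _ _ _)
      rw [Set.indicator_of_mem hYE]
      refine mul_nonpos_of_nonneg_of_nonpos (by positivity) ?_
      by_cases hYA : Y ∈ A p <;> simp [hYA]
    · rw [Set.indicator_of_notMem hYE]
      by_cases hYA : Y ∈ A p
      · rw [Set.indicator_of_mem hYA, sub_zero, mul_one]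
        refine contactProb_ge ?_ hYA
        have := ncard_neighborSet_le hN (D := 5) (by exact_mod_cast hN2)
          (not_not.1 hYE) p.1
        norm_num at this
        exact this
      · rw [Set.indicator_of_notMem hYA]
        simpa using contactProb_nonneg Y p.1 p.2
  have hint : ∀ p, Integrable (fun Y => 1 / (121 * u) *
      ((A p).indicator (fun _ => (1 : ℝ)) Y - E.indicator (fun _ => (1 : ℝ)) Y))
      (moveLaw v X) := fun p => (((integrable_const _).indicator (hA p)).sub
        ((integrable_const _).indicator hEm)).const_mul _
  have hval : ∀ p ∈ Q, 1 / (121 * u) * (r ^ 2 / (32 * v ^ 2)) ≤ ∫ Y, 1 / (121 * u) *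
      ((A p).indicator (fun _ => (1 : ℝ)) Y - E.indicator (fun _ => (1 : ℝ)) Y)
      ∂(moveLaw v X) := by
    intro p hp
    rw [integral_const_mul, integral_sub ((integrable_const _).indicator (hA p))
      ((integrable_const _).indicator hEm), integral_indicator (hA p), integral_indicator hEm]
    simp only [integral_const, smul_eq_mul, mul_one, measureReal_restrict_apply_univ]
    -- The overfull event costs at most half of the meeting probability r²/(16 v²).
    have h1 := moveLaw_adj_ge hr hrv X (mem_cutPairs.1 hp).2.2
    refine mul_le_mul_of_nonneg_left ?_ (by positivity)
    have h2 : r ^ 2 / (16 * v ^ 2) = 2 * (r ^ 2 / (32 * v ^ 2)) := by field_simp; norm_num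
    have h3 : (moveLaw v X).real (A p) =
      (moveLaw v X).real {Y | (geometricGraph r Y).Adj p.1 p.2} := rfl
    linarith
  calc _ = (∑ p ∈ Q, 1 / (121 * u) * (r ^ 2 / (32 * v ^ 2))) / (S.card : ℝ) := by
        rw [Finset.sum_const, nsmul_eq_mul]; ring
    _ ≤ (∑ p ∈ Q, ∫ Y, 1 / (121 * u) * ((A p).indicator (fun _ => (1 : ℝ)) Y -
        E.indicator (fun _ => (1 : ℝ)) Y) ∂(moveLaw v X)) / (S.card : ℝ) :=
        div_le_div_of_nonneg_right (Finset.sum_le_sum hval) (Nat.cast_nonneg _)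
    _ = ∫ Y, (∑ p ∈ Q, 1 / (121 * u) * ((A p).indicator (fun _ => (1 : ℝ)) Y -
        E.indicator (fun _ => (1 : ℝ)) Y)) / (S.card : ℝ) ∂(moveLaw v X) := by
        rw [integral_div, integral_finsetSum _ fun p _ => hint p]
    _ ≤ _ := by
        refine integral_mono ((integrable_finsetSum _ fun p _ => hint p).div_const _)
          (integrable_setConductance S _) fun Y => ?_
        refine div_le_div_of_nonneg_right ?_ (Nat.cast_nonneg _)
        rw [← Finset.sum_product']
        exact (Finset.sum_le_sum fun p _ => hpt Y p).trans
          (Finset.sum_le_sum_of_subset_of_nonneg hQ fun _ _ _ => contactProb_nonneg _ _ _)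

open Classical in
/-- The cut at the scale of the velocity, when all cells at that scale are regularly filled. -/
theorem card_le_cutPairs_of_regular {X : Fin n → Plane} {L : ℕ} {g u : ℝ} (hL : 0 < L)
    (hLv : 4 ≤ L * v) (hg : 0 < g) (hgood : ∀ a b, g ≤ ((nodesInCell L X a b).card : ℝ))
    (hu : ∀ a b, ((nodesInCell L X a b).card : ℝ) ≤ u) {S : Finset (Fin n)}
    (hS : S.Nonempty) (hSn : 2 * S.card ≤ n) :
    (S.card : ℝ) ≤ max (2 * (2 / g)) (16 * u ^ 2 * L ^ 3 / (g ^ 2 / 4 * n)) *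
      (cutPairs (geometricGraph v X) S).card := by
  have hn : 0 < Fintype.card (Fin n) := by
    obtain ⟨i, _⟩ := hS
    exact Fintype.card_pos_iff.2 ⟨i⟩
  have h := card_le_cutPairs_of_good_cells (G := geometricGraph v X) (L := L) (g := g) (u := u)
    (cx := fun i => cellIdx L (X i 0)) (cy := fun i => cellIdx L (X i 1))
    (fun i => ⟨cellIdx_nonneg hL _, cellIdx_lt hL _⟩)
    (fun i => ⟨cellIdx_nonneg hL _, cellIdx_lt hL _⟩)
    (fun i j h1 h2 hij => adj_of_mem_nodesInCell hL hLv _ _ _ _ i j h1 h2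
      (mem_nodesInCell.2 ⟨rfl, rfl⟩) (mem_nodesInCell.2 ⟨rfl, rfl⟩) hij) hg ?_ ?_ (S := S)
    (by simpa using hSn) hn
  · rw [Fintype.card_fin] at h
    exact h
  · intro a b h1 h2 h3 h4
    refine (hgood a b).trans ?_
    gcongr
    intro i hi
    rw [mem_nodesInCell] at hi
    exact Finset.mem_filter.2 ⟨Finset.mem_univ _,
      eq_of_modEq_of_mem_range hi.1 (cellIdx_nonneg hL _) (cellIdx_lt hL _) h1 h2,
      eq_of_modEq_of_mem_range hi.2 (cellIdx_nonneg hL _) (cellIdx_lt hL _) h3 h4⟩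
  · intro a b
    refine le_trans ?_ (hu a b)
    gcongr
    intro i hi
    rw [Finset.mem_filter] at hi
    exact mem_nodesInCell.2 ⟨by rw [hi.2.1], by rw [hi.2.2]⟩

end VelocityScale

/-! ### The velocity-scale lower bound and the combination of bounds. -/

section Main

theorem whp_and {p q : (n : ℕ) → (Fin n → Plane) → Prop} (hp : WithHighProbability p)
    (hq : WithHighProbability q) : WithHighProbability fun n X => p n X ∧ q n X := by
  refine whp_of_tendsto (q := fun n => initialLaw n {X | ¬ p n X} + initialLaw n {X | ¬ q n X})
    (Eventually.of_forall fun n => le_trans (measure_mono ?_) (measure_union_le _ _)) ?_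
  · intro X hX
    simp only [Set.mem_ofPred_eq, Set.mem_union] at hX ⊢
    tauto
  · simpa using Tendsto.add hp hq

theorem whp_mono {p q : (n : ℕ) → (Fin n → Plane) → Prop} (hp : WithHighProbability p)
    (h : ∀ᶠ n in atTop, ∀ X, p n X → q n X) : WithHighProbability q :=
  whp_of_tendsto (h.mono fun _ hn => measure_mono fun X hX hpX => hX (hn X hpX)) hp

/-- Since r = o(v), velocity-scale cells are all well filled, so connectivity plays no role: the cut
before the move is of order |S| n v³, and its pairs meet with probability of order r²/v² and contact
with probability of order 1/(n r²). -/
theorem whp_le_mobileConductance_of_velocity {r v : ℕ → ℝ} (hr_pos : ∀ n, 0 < r n)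
    (hr : r =Θ[atTop] fun n : ℕ => Real.sqrt (Real.log n / n)) (hv_pos : ∀ n, 0 < v n)
    (hv_bdd : BddAbove (Set.range v)) (hrv : r =o[atTop] v) :
    ∃ c > 0, WithHighProbability fun n X => c * v n ≤ mobileConductance (r n) (v n) X := by
  obtain ⟨a, ha, b, hb, hab⟩ := exists_range_bounds hr_pos hr
  obtain ⟨V, hV⟩ := hv_bdd
  have hvV : ∀ n, v n ≤ V := fun n => hV ⟨n, rfl⟩
  have hV0 : 0 < V := (hv_pos 0).trans_le (hvV 0)
  -- With L = ⌈4/v⌉, rounding adds at most v ≤ V to L v, so 4 ≤ L v ≤ W.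
  set W : ℝ := 4 + V with hW
  have hW0 : 0 < W := by positivity
  set B : ℝ := b / 8 + 6 with hB
  have hB0 : 0 < B := by positivity
  set C : ℝ := 16 * W ^ 2 * V + 16384 * W ^ 3 with hC
  have hC0 : 0 < C := by positivity
  refine ⟨a / (32 * 121 * B * C), by positivity, ?_⟩
  refine whp_of_tendsto (q := fun n : ℕ => ENNReal.ofReal (1 / (n : ℝ)) +
    (ENNReal.ofReal (1 / (n : ℝ)) + ENNReal.ofReal (25 / a * (1 / (n : ℝ) ^ 3)))) ?_ ?_
  swap
  · have h1 : Tendsto (fun n : ℕ => 25 / a * (1 / (n : ℝ) ^ 3)) atTop (𝓝 0) := by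
      have : Tendsto (fun n : ℕ => (n : ℝ) ^ 3) atTop atTop :=
        (tendsto_pow_atTop (by norm_num)).comp tendsto_natCast_atTop_atTop
      simpa using (this.inv_tendsto_atTop.const_mul (25 / a))
    have h3 := ENNReal.tendsto_ofReal h1
    have h4 := ENNReal.tendsto_ofReal (tendsto_one_div_atTop_nhds_zero_nat (𝕜 := ℝ))
    rw [ENNReal.ofReal_zero] at h3 h4
    simpa using h4.add (h4.add h3)
  have hr1 := eventually_mul_log_pow_le hb (hab.mono fun n h => h.2) 0 zero_lt_one
  -- The ratio is chosen so that the mean occupancy x is at least 8 log n; then the Chernoff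
  -- exponents for the thresholds 4x and x/4 are both at most -2 log n.
  have hδ := hrv.bound (show 0 < Real.sqrt (a / (8 * W ^ 2)) by positivity)
  have h14 := hrv.bound (show (0 : ℝ) < 1 / 4 by norm_num)
  have hlarge := tendsto_natCast_atTop_atTop.eventually_ge_atTop (32 * V ^ 2 / a)
  filter_upwards [hab, hr1, hδ, h14, hlarge, tendsto_log_natCast.eventually_ge_atTop 1,
    eventually_ge_atTop 2] with n ⟨h1, h2⟩ hr1 hδ h14 hlarge hlog hn
  have hrn := hr_pos n
  have hvn := hv_pos n
  have hvVn := hvV n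
  have hn0 : (0 : ℝ) < n := by exact_mod_cast (by omega : 0 < n)
  rw [pow_zero, mul_one] at hr1
  rw [Real.norm_of_nonneg hrn.le, Real.norm_of_nonneg hvn.le] at hδ h14
  obtain ⟨N, -, hN1, hN2⟩ := exists_grid hrn one_pos (by simpa using hr1)
  rw [one_mul] at hN1 hN2
  obtain ⟨l, hl⟩ : ∃ l, l = Real.log n := ⟨_, rfl⟩
  have hover := initialLaw_cell_overfull_le_inv_pow ha hN1 hN2 hrn hlog h1 h2
  rw [← hl] at h1 h2 hlog hover
  -- the grid at the scale of the velocity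
  obtain ⟨L, hL, hL4, hLW⟩ : ∃ L : ℕ, 0 < L ∧ 4 ≤ L * v n ∧ L * v n ≤ W := by
    have k1 := Nat.le_ceil (4 / v n)
    have k2 := Nat.ceil_lt_add_one (a := 4 / v n) (by positivity)
    have k3 : 4 / v n * v n = 4 := div_mul_cancel₀ _ hvn.ne'
    refine ⟨⌈4 / v n⌉₊, Nat.ceil_pos.2 (by positivity), ?_, ?_⟩ <;> nlinarith
  have hL0 : (0 : ℝ) < L := by exact_mod_cast hL
  set x : ℝ := n / (L : ℝ) ^ 2 with hx
  have hx0 : 0 < x := by positivity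
  have hxL : (L : ℝ) ^ 2 * x = n := by rw [hx]; field_simp
  have hLv2 : (L : ℝ) ^ 2 * v n ^ 2 ≤ W ^ 2 := by
    rw [← mul_pow]; exact pow_le_pow_left₀ (by positivity) hLW 2
  have hx8 : 8 * l ≤ x := by
    have k1 := pow_le_pow_left₀ hrn.le hδ 2
    rw [mul_pow, Real.sq_sqrt (by positivity)] at k1
    have k2 : a * l ≤ a / 8 * x := by
      calc a * l ≤ n * r n ^ 2 := h1
        _ ≤ n * (a / (8 * W ^ 2) * v n ^ 2) := by gcongr
        _ = a / (8 * W ^ 2) * x * (L ^ 2 * v n ^ 2) := by rw [← hxL]; ring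
        _ ≤ a / (8 * W ^ 2) * x * W ^ 2 := by gcongr
        _ = _ := by field_simp
    have k3 : a * (8 * l) ≤ a * x := by linarith
    exact le_of_mul_le_mul_left k3 ha
  have hLn : (L : ℝ) ^ 2 ≤ n := by
    rw [← hxL]
    exact le_mul_of_one_le_right (by positivity) (by linarith)
  have hexp : ∀ t ≤ -(2 * l), (L : ℝ) ^ 2 * Real.exp t ≤ 1 / (n : ℝ) := by
    intro t ht
    have k1 := exp_neg_mul_log (n := n) (by omega) 2
    push_cast at k1
    rw [← hl] at k1
    calc (L : ℝ) ^ 2 * Real.exp t ≤ (n : ℝ) * (1 / (n : ℝ) ^ 2) := by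
          rw [← k1]; gcongr
      _ = 1 / (n : ℝ) := by field_simp
  have hfull : initialLaw n {X | ¬ ∀ p q, ((nodesInCell L X p q).card : ℝ) ≤ 4 * x} ≤
      ENNReal.ofReal (1 / (n : ℝ)) :=
    (initialLaw_cell_overfull_le hL _).trans (ENNReal.ofReal_le_ofReal (hexp _ (by linarith)))
  have hsparse : initialLaw n {X | ¬ ∀ p q, x / 4 ≤ ((nodesInCell L X p q).card : ℝ)} ≤
      ENNReal.ofReal (1 / (n : ℝ)) :=
    (initialLaw_cell_sparse_le hL _).trans (ENNReal.ofReal_le_ofReal (hexp _ (by linarith)))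
  -- Overfull cells have probability of order n⁻⁵, so Markov with threshold n⁻² leaves n⁻³; and n⁻²
  -- is eventually below r²/(32 v²).
  have hmove : initialLaw n {X | ENNReal.ofReal (1 / (n : ℝ) ^ 2) ≤
      moveLaw (v n) X (overfullPositions n N (B * l))} ≤
      ENNReal.ofReal (25 / a * (1 / (n : ℝ) ^ 3)) := by
    refine (initialLaw_moveLaw_ge_le hvn (measurableSet_overfullPositions n N (B * l))
      (overfullPositions_add_intVec N (B * l)) ?_ ENNReal.ofReal_ne_top).trans ?_
    · rw [Ne, ENNReal.ofReal_eq_zero, not_le]; positivity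
    · refine (ENNReal.div_le_div_right hover _).trans ?_
      rw [← ENNReal.ofReal_div_of_pos (by positivity)]
      refine ENNReal.ofReal_le_ofReal (le_of_eq ?_)
      field_simp
  refine le_trans (measure_mono ?_) ((measure_union_le _ _).trans (add_le_add hfull
    ((measure_union_le _ _).trans (add_le_add hsparse hmove))))
  intro X hX
  by_contra hcon
  simp only [Set.mem_union, Set.mem_ofPred_eq, not_or, not_not, not_le] at hcon
  obtain ⟨c1, c2, c3⟩ := hcon
  apply hX
  have hμ := isProbabilityMeasure_moveLaw X hvn
  refine le_mobileConductance hn X fun S hS hSn => ?_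
  have hoverX : (moveLaw (v n) X).real (overfullPositions n N (B * l)) ≤
      r n ^ 2 / (32 * v n ^ 2) := by
    have k1 : (moveLaw (v n) X).real (overfullPositions n N (B * l)) ≤ 1 / (n : ℝ) ^ 2 :=
      ENNReal.toReal_le_of_le_ofReal (by positivity) c3.le
    refine k1.trans ?_
    rw [div_le_div_iff₀ (by positivity) (by positivity), one_mul]
    rw [div_le_iff₀ ha] at hlarge
    calc 32 * v n ^ 2 ≤ 32 * V ^ 2 := by gcongr
      _ ≤ n * a := hlarge
      _ ≤ n * (a * l) := by gcongr; exact le_mul_of_one_le_right ha.le hlog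
      _ ≤ n * (n * r n ^ 2) := by gcongr
      _ = _ := by ring
  refine le_trans ?_ (le_integral_setConductance hrn (by linarith) (by positivity) hN1 hN2 hoverX)
  have hcut := card_le_cutPairs_of_regular hL hL4 (by positivity) c2 c1 hS hSn
  have hS0 : (0 : ℝ) < S.card := by exact_mod_cast hS.card_pos
  set q : ℝ := ((cutPairs (geometricGraph (v n) X) S).card : ℝ)
  have hq0 : 0 ≤ q := Nat.cast_nonneg _
  have hZ : max (2 * (2 / (x / 4))) (16 * (4 * x) ^ 2 * L ^ 3 / ((x / 4) ^ 2 / 4 * n)) ≤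
      C / (n * v n ^ 3) := by
    refine max_le ?_ ?_
    · calc 2 * (2 / (x / 4)) = 16 * (L ^ 2 * v n ^ 2) * v n / (n * v n ^ 3) := by
            rw [hx]; field_simp; norm_num
        _ ≤ 16 * W ^ 2 * V / (n * v n ^ 3) := by gcongr
        _ ≤ _ := by
          gcongr
          exact le_add_of_nonneg_right (by positivity)
    · calc 16 * (4 * x) ^ 2 * L ^ 3 / ((x / 4) ^ 2 / 4 * n) =
            16384 * (L * v n) ^ 3 / (n * v n ^ 3) := by
            field_simp; norm_num
        _ ≤ 16384 * W ^ 3 / (n * v n ^ 3) := by gcongr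
        _ ≤ _ := by
          gcongr
          exact le_add_of_nonneg_left (by positivity)
  have hSq : S.card * (n * v n ^ 3) ≤ C * q := by
    have := hcut.trans (mul_le_mul_of_nonneg_right hZ hq0)
    rw [div_mul_eq_mul_div, le_div_iff₀ (by positivity)] at this
    exact this
  rw [le_div_iff₀ hS0, le_div_iff₀ (by positivity)]
  calc a / (32 * 121 * B * C) * v n * S.card * (121 * (B * l))
      = a * l * (S.card * v n / (32 * C)) := by field_simp
    _ ≤ n * r n ^ 2 * (S.card * v n / (32 * C)) := by gcongr
    _ = S.card * (n * v n ^ 3) * (r n ^ 2 / (32 * v n ^ 2) / C) := by field_simp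
    _ ≤ C * q * (r n ^ 2 / (32 * v n ^ 2) / C) := by gcongr
    _ = q * (r n ^ 2 / (32 * v n ^ 2)) := by field_simp

/-- The strip bound is of order 2v + r in every regime, so only its comparison with f and a lower
bound vary. -/
theorem conductanceScalesAs_of_bounds {r v f : ℕ → ℝ} (hr : ∀ n, 0 < r n) (hv : ∀ n, 0 < v n)
    (hnr : Tendsto (fun n : ℕ => n * r n) atTop atTop)
    (hlow : ∃ c > 0, WithHighProbability fun n X => c * f n ≤ mobileConductance (r n) (v n) X)
    {C : ℝ} (hC : 0 < C) (hf : ∀ᶠ n in atTop, 2 * v n + r n ≤ C * f n) :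
    ConductanceScalesAs r v f := by
  obtain ⟨c, hc, hlow⟩ := hlow
  refine ⟨c, hc, 192 * C, by positivity, whp_and hlow
    (whp_mono (whp_mobileConductance_le hr hv hnr) (hf.mono fun n hn X hX => ?_))⟩
  linarith

end Main

end MobileNetwork

end

theorem theorem4 (r v : ℕ → ℝ)
    (hr_pos : ∀ n, 0 < r n)
    (hr : r =Θ[atTop] fun n : ℕ => Real.sqrt (Real.log n / n))
    (hconn : MobileNetwork.WithHighProbability fun n X =>
      (MobileNetwork.geometricGraph (r n) X).Connected)
    (hv_pos : ∀ n, 0 < v n)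
    (hv_bdd : BddAbove (Set.range v)) :
    (r =o[atTop] v → MobileNetwork.ConductanceScalesAs r v v) ∧
    (v =o[atTop] r → MobileNetwork.ConductanceScalesAs r v r) ∧
    (v =Θ[atTop] r →
      MobileNetwork.ConductanceScalesAs r v v ∧ MobileNetwork.ConductanceScalesAs r v r) := by
  open MobileNetwork in
  obtain ⟨a, ha, b, hb, hab⟩ := exists_range_bounds hr_pos hr
  have hnr := tendsto_natCast_mul_range hr_pos ha (hab.mono fun n h => h.1)
  have hlow := whp_le_mobileConductance_of_range hr_pos hr hconn hv_pos
  have hbound : ∀ {f g : ℕ → ℝ}, (∀ n, 0 < f n) → (∀ n, 0 < g n) → f =O[atTop] g →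
      ∃ C > 0, ∀ᶠ n in atTop, f n ≤ C * g n := by
    intro f g hf hg hfg
    obtain ⟨C, hC, h⟩ := hfg.exists_pos
    refine ⟨C, hC, h.bound.mono fun n hn => ?_⟩
    rwa [Real.norm_of_nonneg (hf n).le, Real.norm_of_nonneg (hg n).le] at hn
  -- Only v = O(r) is needed, so this serves both v = o(r) and v = Θ(r).
  have hscale_r : v =O[atTop] r → ConductanceScalesAs r v r := by
    intro hvr
    obtain ⟨C, hC, h⟩ := hbound hv_pos hr_pos hvr
    exact conductanceScalesAs_of_bounds hr_pos hv_pos hnr hlow (C := 2 * C + 1) (by positivity)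
      (h.mono fun n hn => by linarith)
  refine ⟨fun hrv => ?_, fun hvr => hscale_r hvr.isBigO, fun hvr => ⟨?_, hscale_r hvr.1⟩⟩
  · obtain ⟨C, hC, h⟩ := hbound hr_pos hv_pos hrv.isBigO
    exact conductanceScalesAs_of_bounds hr_pos hv_pos hnr
      (whp_le_mobileConductance_of_velocity hr_pos hr hv_pos hv_bdd hrv) (C := 2 + C)
      (by positivity) (h.mono fun n hn => by linarith)
  -- For v = Θ(r) the range-scale lower bound suffices: v ≤ C' r turns c r into (c/C') v.
  · obtain ⟨C, hC, h⟩ := hbound hr_pos hv_pos hvr.2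
    obtain ⟨C', hC', h'⟩ := hbound hv_pos hr_pos hvr.1
    obtain ⟨c, hc, hlow⟩ := hlow
    refine conductanceScalesAs_of_bounds hr_pos hv_pos hnr ⟨c / C', by positivity,
      whp_mono hlow (h'.mono fun n hn X hX => le_trans ?_ hX)⟩ (C := 2 + C)
      (by positivity) (h.mono fun n hn => by linarith)
    calc c / C' * v n ≤ c / C' * (C' * r n) := by gcongr
      _ = c * r n := by field_simp
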